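/- **Theorem 1.4 (Blow-up of the free boundary problem).** Let $\mu>0$, $\mu+\lambda\ge 0$, $\gamma>1$, $q>2$, $a_0>0$. Consider the free boundary problem for the two-dimensional radially symmetric compressible MHD system on $\Omega_t=\{x\in\mathbb R^2: |x|\le a(t)\}$, $a(t)>0$, $$\begin{cases}\rho_t+(\rho u)_r+\dfrac{\rho u}{r}=0,\\[2mm] \rho(u_t+uu_r)+P_r=(2\mu+\lambda)\Big(u_r+\dfrac ur\Big)_r-B\Big(B_r+\dfrac Br\Big),\\[2mm] P_t+uP_r+\gamma P\Big(u_r+\dfrac ur\Big)=0,\\[2mm] B_t+(uB)_r=0,\end{cases}\qquad 0<r<a(t),$$ for $\rho(x,t)=\rho(|x|,t)$, $P(x,t)=P(|x|,t)$, $\vec u(x,t)=\frac{x}{|x|}u(|x|,t)$, $\vec B(x,t)=\frac{(-x_2,x_1)}{|x|}B(|x|,t)$, with initial data $(\rho_0,u_0,P_0,B_0)$ on $[0,a_0]$, $\rho_0\ge0$, $P_0\ge0$, and with $$u(0,t)=B(0,t)=0,\qquad \Big(\frac{B^2}{2}+P-(2\mu+\lambda)\Big(u_r+\frac ur\Big)\Big)(a(t),t)=0,\qquad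 a'(t)=u(a(t),t),\quad a(0)=a_0 .$$ A *strong solution* on $[0,T']$ satisfies the equations almost everywhere (with weak derivatives) and $$(\rho,P,\vec B)\in C([0,T'];W^{1,q}(\Omega_t)),\quad (\rho_t,P_t,\vec B_t)\in C([0,T'];L^q(\Omega_t)),$$ $$\vec u\in C([0,T'];H^2(\Omega_t))\cap L^2(0,T';W^{2,q}(\Omega_t)),\quad \vec u_t\in L^2(0,T';H^1(\Omega_t)),\quad \sqrt\rho\,\vec u_t\in L^\infty(0,T';L^2(\Omega_t)).$$ Here $f\in C([0,T'];L^p(\Omega_t))$ means that the extension of $f(\cdot,t)$ by zero is continuous in $t$ with values in $L^p(\mathbb R^2)$, and continuity in $W^{k,p}(\Omega_t)$ means this for all derivatives up to order $k$. A solution is strong on $[0,T)$, $0<T\le\infty$, if it is strong on $[0,T']$ for every $0<T'<T$. Let $$E_0=\int_0^{a_0}\Big(\tfrac12\rho_0u_0^2+\tfrac{1}{\gamma-1}P_0+\tfrac12B_0^2\Big)r\,dr .$$ There is a constant $C>0$ depending only on $a_0,E_0,\mu,\lambda$ such that the following holds. Suppose that for some $r_0\in(0,a_0)$ $$\rho_0(r)=0,\quad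 P_0(r)=0\quad\text{for } r\in[0,r_0],\qquad\text{and}\qquad \int_0^{r_0}B_0(r)\,dr\neq0 .$$ Then a strong solution blows up in finite time: if it is strong on $[0,T)$, $0<T\le\infty$, then $T<\infty$, and for every $\alpha\in(1,2)$ $$T\le\exp\left(E_0\left(\frac{\big|\int_0^{r_0}B_0(r)\,dr\big|^2(2-\alpha)^2}{2\sqrt{2\mu+\lambda}\;C\left[\frac{\alpha}{\sqrt{2\alpha-2}}+\frac{\alpha+1}{\sqrt{2\alpha}}\right]}\right)^{-2}\right)-1 .$$ (The existence of a strong solution is not asserted.) -/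

import Mathlib

namespace RadialMHD

open MeasureTheory Set Filter Topology
open scoped ContDiff

/-- The Euclidean plane. -/
abbrev Plane : Type := EuclideanSpace ℝ (Fin 2)

/-! ### Weak derivatives -/

/-- `g` is the weak derivative of `f` in the direction `v` on the open set `Ω`:
both are locally integrable on `Ω` and `∫ f ∂ᵥφ = - ∫ g φ` for every `φ ∈ C_c^∞(Ω)`. -/
def HasWeakDirDeriv {X F : Type} [NormedAddCommGroup X] [NormedSpace ℝ X] [MeasureSpace X]
    [NormedAddCommGroup F] [NormedSpace ℝ F] (Ω : Set X) (v : X) (f g : X → F) : Prop :=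
  LocallyIntegrableOn f Ω volume ∧ LocallyIntegrableOn g Ω volume ∧
    ∀ φ : X → ℝ, ContDiff ℝ ∞ φ → HasCompactSupport φ → tsupport φ ⊆ Ω →
      ∫ x in Ω, fderiv ℝ φ x v • f x = - ∫ x in Ω, φ x • g x

/-- `G` is the weak (total) derivative of `f` on the open set `Ω` of the plane. -/
def HasWeakGrad {F : Type} [NormedAddCommGroup F] [NormedSpace ℝ F]
    (Ω : Set Plane) (f : Plane → F) (G : Plane → Plane →L[ℝ] F) : Prop :=
  ∀ v : Plane, HasWeakDirDeriv Ω v f (fun x => G x v)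

/-! ### Moving domains and the function spaces over them -/

/-- The (open) fluid domain at time `t`: the disk of radius `a t` about the origin. -/
def fluidDomain (a : ℝ → ℝ) (t : ℝ) : Set Plane := Metric.ball 0 (a t)

/-- The space-time fluid domain `{(t, x) : 0 < t < T, |x| < a t}`. -/
def spaceTime (a : ℝ → ℝ) (T : ℝ) : Set (ℝ × Plane) :=
  {z | z.1 ∈ Ioo 0 T ∧ z.2 ∈ fluidDomain a z.1}

/-- The same domain in the coordinates `(t, r)`: `{(t, r) : 0 < t < T, 0 < r < a t}`. -/
def radialSpaceTime (a : ℝ → ℝ) (T : ℝ) : Set (ℝ × ℝ) :=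
  {z | z.1 ∈ Ioo 0 T ∧ z.2 ∈ Ioo 0 (a z.1)}

section Spaces

variable {F : Type} [NormedAddCommGroup F] [NormedSpace ℝ F]

/-- `f ∈ C([0,T]; L^p(Ω_t))`: every `f t` is in `L^p(Ω_t)`, and the extension of `f t` by zero
outside `Ω_t` depends continuously on `t ∈ [0,T]` in `L^p(ℝ²)`. (For `p < ∞` and `a` continuous
and positive this is the same as continuity in `L^p` of the unit disk of the rescaled functions
`y ↦ f t (a t • y)`.) -/
def InCLp (a : ℝ → ℝ) (T : ℝ) (p : ENNReal) (f : ℝ → Plane → F) : Prop :=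
  (∀ t ∈ Icc 0 T, MemLp (f t) p (volume.restrict (fluidDomain a t))) ∧
  ∀ s ∈ Icc 0 T, Tendsto
    (fun t => eLpNorm ((fluidDomain a t).indicator (f t) - (fluidDomain a s).indicator (f s))
      p volume) (𝓝[Icc 0 T] s) (𝓝 0)

/-- `f ∈ C([0,T]; W^{1,p}(Ω_t))`. -/
def InCW1 (a : ℝ → ℝ) (T : ℝ) (p : ENNReal) (f : ℝ → Plane → F) : Prop :=
  InCLp a T p f ∧ ∃ G : ℝ → Plane → Plane →L[ℝ] F,
    (∀ t ∈ Icc 0 T, HasWeakGrad (fluidDomain a t) (f t) (G t)) ∧ InCLp a T p G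

/-- `f ∈ C([0,T]; W^{2,p}(Ω_t))`. -/
def InCW2 (a : ℝ → ℝ) (T : ℝ) (p : ENNReal) (f : ℝ → Plane → F) : Prop :=
  InCLp a T p f ∧ ∃ G : ℝ → Plane → Plane →L[ℝ] F,
    (∀ t ∈ Icc 0 T, HasWeakGrad (fluidDomain a t) (f t) (G t)) ∧ InCW1 a T p G

/-- `f ∈ L²(0,T; L^p(Ω_t))`. -/
def InL2Lp (a : ℝ → ℝ) (T : ℝ) (p : ENNReal) (f : ℝ → Plane → F) : Prop :=
  AEStronglyMeasurable (fun z : ℝ × Plane => f z.1 z.2) (volume.restrict (spaceTime a T)) ∧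
  ∫⁻ t in Ioo 0 T, (eLpNorm (f t) p (volume.restrict (fluidDomain a t))) ^ 2 < ⊤

/-- `f ∈ L²(0,T; W^{1,p}(Ω_t))`. -/
def InL2W1 (a : ℝ → ℝ) (T : ℝ) (p : ENNReal) (f : ℝ → Plane → F) : Prop :=
  InL2Lp a T p f ∧ ∃ G : ℝ → Plane → Plane →L[ℝ] F,
    (∀ᵐ t ∂(volume.restrict (Ioo 0 T)), HasWeakGrad (fluidDomain a t) (f t) (G t)) ∧
      InL2Lp a T p G

/-- `f ∈ L²(0,T; W^{2,p}(Ω_t))`. -/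
def InL2W2 (a : ℝ → ℝ) (T : ℝ) (p : ENNReal) (f : ℝ → Plane → F) : Prop :=
  InL2Lp a T p f ∧ ∃ G : ℝ → Plane → Plane →L[ℝ] F,
    (∀ᵐ t ∂(volume.restrict (Ioo 0 T)), HasWeakGrad (fluidDomain a t) (f t) (G t)) ∧
      InL2W1 a T p G

/-- `f ∈ L^∞(0,T; L^p(Ω_t))`. -/
def InLinfLp (a : ℝ → ℝ) (T : ℝ) (p : ENNReal) (f : ℝ → Plane → F) : Prop :=
  AEStronglyMeasurable (fun z : ℝ × Plane => f z.1 z.2) (volume.restrict (spaceTime a T)) ∧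
  ∃ M : ENNReal, M < ⊤ ∧
    ∀ᵐ t ∂(volume.restrict (Ioo 0 T)), eLpNorm (f t) p (volume.restrict (fluidDomain a t)) ≤ M

/-- `g` is the weak time derivative `∂_t f` in the space-time fluid domain. -/
def HasWeakTimeDeriv (a : ℝ → ℝ) (T : ℝ) (f g : ℝ → Plane → F) : Prop :=
  HasWeakDirDeriv (spaceTime a T) ((1, 0) : ℝ × Plane)
    (fun z => f z.1 z.2) (fun z => g z.1 z.2)

end Spaces

/-! ### Radially symmetric fields with a given profile -/

/-- The scalar field `x ↦ f(|x|)`. -/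
noncomputable def scalarField (f : ℝ → ℝ) (x : Plane) : ℝ := f ‖x‖

/-- The vector field `x ↦ f(|x|) x / |x|`. -/
noncomputable def radialField (f : ℝ → ℝ) (x : Plane) : Plane := (f ‖x‖ / ‖x‖) • x

/-- The vector field `x ↦ f(|x|) (-x₂, x₁) / |x|`. -/
noncomputable def azimuthalField (f : ℝ → ℝ) (x : Plane) : Plane :=
  (f ‖x‖ / ‖x‖) • !₂[-x 1, x 0]

/-! ### The equations -/

/-- The radially symmetric compressible MHD system for profiles `ρ, u, P, B` of `(t, r)`,
```
  ρ_t + (ρ u)_r + ρ u / r = 0,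
  ρ (u_t + u u_r) + P_r = (2 μ + lam) (u_r + u / r)_r - B (B_r + B / r),
  P_t + u P_r + γ P (u_r + u / r) = 0,
  B_t + (u B)_r = 0,
```
almost everywhere in the open set `D` of points `(t, r)`, all derivatives being weak ones. -/
def SolvesRadialSystem (μ lam γ : ℝ) (D : Set (ℝ × ℝ)) (ρ u P B : ℝ → ℝ → ℝ) : Prop :=
  ∃ ρ_t ρu_r u_t u_r div_r P_t P_r B_t B_r uB_r : ℝ × ℝ → ℝ,
    HasWeakDirDeriv D (1, 0) (fun z => ρ z.1 z.2) ρ_t ∧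
    HasWeakDirDeriv D (0, 1) (fun z => ρ z.1 z.2 * u z.1 z.2) ρu_r ∧
    HasWeakDirDeriv D (1, 0) (fun z => u z.1 z.2) u_t ∧
    HasWeakDirDeriv D (0, 1) (fun z => u z.1 z.2) u_r ∧
    HasWeakDirDeriv D (0, 1) (fun z => u_r z + u z.1 z.2 / z.2) div_r ∧
    HasWeakDirDeriv D (1, 0) (fun z => P z.1 z.2) P_t ∧
    HasWeakDirDeriv D (0, 1) (fun z => P z.1 z.2) P_r ∧
    HasWeakDirDeriv D (1, 0) (fun z => B z.1 z.2) B_t ∧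
    HasWeakDirDeriv D (0, 1) (fun z => B z.1 z.2) B_r ∧
    HasWeakDirDeriv D (0, 1) (fun z => u z.1 z.2 * B z.1 z.2) uB_r ∧
    ∀ᵐ z ∂(volume.restrict D),
      ρ_t z + ρu_r z + ρ z.1 z.2 * u z.1 z.2 / z.2 = 0 ∧
      ρ z.1 z.2 * (u_t z + u z.1 z.2 * u_r z) + P_r z
        = (2 * μ + lam) * div_r z - B z.1 z.2 * (B_r z + B z.1 z.2 / z.2) ∧
      P_t z + u z.1 z.2 * P_r z + γ * P z.1 z.2 * (u_r z + u z.1 z.2 / z.2) = 0 ∧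
      B_t z + uB_r z = 0

/-- The profile is continuous in `(t, r)` up to the boundary of the fluid domain. -/
def IsContinuousProfile (a : ℝ → ℝ) (T : ℝ) (f : ℝ → ℝ → ℝ) : Prop :=
  ContinuousOn (fun z : ℝ × ℝ => f z.1 z.2) {z | z.1 ∈ Icc 0 T ∧ z.2 ∈ Icc 0 (a z.1)}

/-- Strong solutions on `[0,T]`, with initial data `ρ₀, u₀, P₀, B₀` on the disk of radius `a₀`,
of the radially symmetric free boundary problem. `ρ, u, P, B` are the profiles (functions of time
and radius) of the density, velocity, pressure and magnetic field; `a` is the free radius. -/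
structure IsStrongSolution (μ lam γ q a₀ : ℝ) (ρ₀ u₀ P₀ B₀ : ℝ → ℝ) (T : ℝ)
    (a : ℝ → ℝ) (ρ u P B : ℝ → ℝ → ℝ) : Prop where
  /-- the free boundary: `a > 0`, `a(0) = a₀`, `a'(t) = u(a(t), t)` -/
  radius_pos : ∀ t ∈ Icc 0 T, 0 < a t
  radius_zero : a 0 = a₀
  radius_deriv : ∀ t ∈ Icc 0 T, HasDerivWithinAt a (u t (a t)) (Icc 0 T) t
  /-- the fields in `C([0,T]; W^{1,q})` and `C([0,T]; H²)` are represented by their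
  continuous versions -/
  cont_density : IsContinuousProfile a T ρ
  cont_velocity : IsContinuousProfile a T u
  cont_pressure : IsContinuousProfile a T P
  cont_magnetic : IsContinuousProfile a T B
  /-- `ρ, P, B ∈ C([0,T]; W^{1,q})` -/
  density_W1 : InCW1 a T (ENNReal.ofReal q) (fun t => scalarField (ρ t))
  pressure_W1 : InCW1 a T (ENNReal.ofReal q) (fun t => scalarField (P t))
  magnetic_W1 : InCW1 a T (ENNReal.ofReal q) (fun t => azimuthalField (B t))
  /-- `ρ_t, P_t, B_t ∈ C([0,T]; L^q)` -/
  density_time : ∃ g : ℝ → Plane → ℝ,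
    HasWeakTimeDeriv a T (fun t => scalarField (ρ t)) g ∧ InCLp a T (ENNReal.ofReal q) g
  pressure_time : ∃ g : ℝ → Plane → ℝ,
    HasWeakTimeDeriv a T (fun t => scalarField (P t)) g ∧ InCLp a T (ENNReal.ofReal q) g
  magnetic_time : ∃ g : ℝ → Plane → Plane,
    HasWeakTimeDeriv a T (fun t => azimuthalField (B t)) g ∧ InCLp a T (ENNReal.ofReal q) g
  /-- `u ∈ C([0,T]; H²) ∩ L²(0,T; W^{2,q})` -/
  velocity_H2 : InCW2 a T 2 (fun t => radialField (u t))
  velocity_W2 : InL2W2 a T (ENNReal.ofReal q) (fun t => radialField (u t))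
  /-- `u_t ∈ L²(0,T; H¹)` and `√ρ u_t ∈ L^∞(0,T; L²)` -/
  velocity_time : ∃ g : ℝ → Plane → Plane,
    HasWeakTimeDeriv a T (fun t => radialField (u t)) g ∧ InL2W1 a T 2 g ∧
      InLinfLp a T 2 (fun t x => √(scalarField (ρ t) x) • g t x)
  /-- the equations -/
  system : SolvesRadialSystem μ lam γ (radialSpaceTime a T) ρ u P B
  /-- the initial data -/
  initial : ∀ r ∈ Icc 0 a₀, ρ 0 r = ρ₀ r ∧ u 0 r = u₀ r ∧ P 0 r = P₀ r ∧ B 0 r = B₀ r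
  /-- the conditions at the center -/
  center : ∀ t ∈ Icc 0 T, u t 0 = 0 ∧ B t 0 = 0
  /-- the effective flux `B²/2 + P - (2μ + lam) (u_r + u/r)` vanishes at `r = a(t)` -/
  free_surface : ∀ t ∈ Icc 0 T, ∃ u_r : ℝ,
    HasDerivWithinAt (u t) u_r (Icc 0 (a t)) (a t) ∧
      (B t (a t)) ^ 2 / 2 + P t (a t) - (2 * μ + lam) * (u_r + u t (a t) / a t) = 0

/-- The initial energy (without the factor `2π`)
`∫₀^{a₀} (ρ₀ u₀² / 2 + P₀ / (γ - 1) + B₀² / 2) r dr`. -/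
noncomputable def initialEnergy (γ a₀ : ℝ) (ρ₀ u₀ P₀ B₀ : ℝ → ℝ) : ℝ :=
  ∫ r in (0 : ℝ)..a₀,
    (ρ₀ r * (u₀ r) ^ 2 / 2 + P₀ r / (γ - 1) + (B₀ r) ^ 2 / 2) * r

/-- The bound for the lifespan, with `C` the constant and `b = ∫₀^{r₀} B₀`:
`exp (E₀ (b² (2-α)² / (2 √(2μ+lam) C [α/√(2α-2) + (α+1)/√(2α)]))⁻²) - 1`. -/
noncomputable def lifespanBound (μ lam E₀ b C α : ℝ) : ℝ :=
  Real.exp (E₀ * (|b| ^ 2 * (2 - α) ^ 2 /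
    (2 * √(2 * μ + lam) * C * (α / √(2 * α - 2) + (α + 1) / √(2 * α)))) ^ (-2 : ℤ)) - 1

end RadialMHD

namespace RadialMHD

open MeasureTheory Set Filter Topology
open scoped ContDiff ENNReal NNReal

/-! ### Primitives of locally integrable functions -/

/-! Write κ = 2μ + λ and δ = u_r + u/r, and let R(t) be a particle path with R(0) = r₀. Four facts
give the bound. The density and the pressure stay zero below R(t) (`RadialFlow.vacuum`). The flux b
= ∫₀^{R(t)} B dr is conserved (`RadialFlow.integral_magnetic_eq`). The energy, which is nonnegative,
decreases at the rate D = κ ∫₀^{a(t)} r δ² dr (`RadialFlow.exists_dissipation`), so ∫ D dt ≤ E₀.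
Finally the radius grows slowly: a u(a) = ∫ r δ dr and Young's inequality give a(t) ≤ C √(1 + t),
where C = |a₀| + 1 + |E₀/κ| suffices.

The heart is `RadialSlice.sq_flux_le`. In the vacuum disk the momentum equation reduces to (κδ -
B²/2)_r = B²/r. Testing it with r^α (R - r), which vanishes at both ends, bounds R ∫ r^(α-1) B² by
integrals of δ, and hence by √(∫ r δ²); the Cauchy-Schwarz inequality bounds b² by R^(2-α) ∫ r^(α-1)
B². The powers of R combine to b² (2-α)²/2 ≤ κ √(∫ r δ²) R K, where K is the bracket in the
statement. Since R ≤ a ≤ C √(1 + t), this says D(t) ≥ X²/(1 + t), X being the quotient inside the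
lifespan bound. Integrating in time yields X² log(1 + T) ≤ E₀ (`RadialFlow.sq_mul_log_le`).

The rest justifies this calculus for weak derivatives. Circular averages turn weak derivatives of
planar fields into weak derivatives of profiles. As q > 2, the weight 1/|x| is in the dual Lebesgue
space on disks, so ρ_t, P_t, B_t, δ and δ_r are integrable with respect to dr dt up to the center;
for u_t only r u_t is needed. Fubini's theorem and du Bois-Reymond's lemma make the equations hold
on almost every time slice with absolutely continuous functions
(`IsStrongSolution.exists_radialFlow`). Time derivatives of integrals over (0, R(t)) come from a
transport theorem that asks only for an integrable f_t (`IsTimePrimitive.isPrimitiveOn_integral`).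
The path R comes from Peano's theorem, its uniqueness being irrelevant. The signs of ρ and P, and
the vacuum, persist by Gronwall's inequality for ∫ r (f⁻)² dr, because the supremum of |δ| over a
slice is integrable in time. -/

/-- `f` is a primitive of the (interval integrable) function `g` on `I`. -/
def IsPrimitiveOn (f g : ℝ → ℝ) (I : Set ℝ) : Prop :=
  ∀ x ∈ I, ∀ y ∈ I, IntervalIntegrable g volume x y ∧ ∫ s in x..y, g s = f y - f x

namespace IsPrimitiveOn

variable {f g f₁ g₁ f₂ g₂ : ℝ → ℝ} {I J : Set ℝ}

lemma mono (h : IsPrimitiveOn f g I) (hJ : J ⊆ I) : IsPrimitiveOn f g J :=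
  fun x hx y hy => h x (hJ hx) y (hJ hy)

lemma absCont (h : IsPrimitiveOn f g I) (hI : I.OrdConnected) {x y : ℝ} (hx : x ∈ I)
    (hy : y ∈ I) : AbsolutelyContinuousOnInterval f x y := by
  have h1 := (h x hx y hy).1.absolutelyContinuousOnInterval_intervalIntegral
    (c := x) left_mem_uIcc
  have h2 : AbsolutelyContinuousOnInterval (fun _ : ℝ => f x) x y :=
    (contDiff_const.contDiffOn (𝕜 := ℝ) (n := 1)).absolutelyContinuousOnInterval
  -- The sums defining absolute continuity see only points of the segment, and there f is its
  -- integral plus a constant.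
  refine (h1.add h2).congr' ?_
  have hsub := hI.uIcc_subset hx hy
  filter_upwards [mem_inf_of_right (mem_principal_self _)] with E hE
  refine Finset.sum_congr rfl fun i hi => ?_
  have hE' := hE.1 i hi
  simp only [Pi.add_apply]
  rw [(h x hx _ (hsub hE'.1)).2, (h x hx _ (hsub hE'.2)).2]
  simp

/-- The gate for all calculus rules below: absolute continuity survives products and C¹
compositions, and the pointwise derivative, known almost everywhere, then determines the integrals.
-/
lemma of_absCont (hI : I.OrdConnected)
    (hac : ∀ x ∈ I, ∀ y ∈ I, AbsolutelyContinuousOnInterval f x y)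
    (hd : ∀ᵐ z, z ∈ I → HasDerivAt f (g z) z) : IsPrimitiveOn f g I := by
  intro x hx y hy
  have hsub : uIoc x y ⊆ I := uIoc_subset_uIcc.trans (hI.uIcc_subset hx hy)
  have he : ∀ᵐ z, z ∈ uIoc x y → deriv f z = g z := by
    filter_upwards [hd] with z hz hz'
    exact (hz (hsub hz')).deriv
  refine ⟨(hac x hx y hy).intervalIntegrable_deriv.congr_ae ?_, ?_⟩
  · exact (ae_restrict_iff' measurableSet_uIoc).2 he
  · rw [← (hac x hx y hy).integral_deriv_eq_sub]
    exact (intervalIntegral.integral_congr_ae he).symm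

lemma continuousOn (h : IsPrimitiveOn f g I) (hI : I.OrdConnected) {x y : ℝ} (hx : x ∈ I)
    (hy : y ∈ I) : ContinuousOn f (uIcc x y) := (h.absCont hI hx hy).continuousOn

lemma continuousOn_Ioo {p q : ℝ} (h : IsPrimitiveOn f g (Ioo p q)) :
    ContinuousOn f (Ioo p q) := by
  intro x hx
  obtain ⟨y, hy1, hy2⟩ := exists_between hx.1
  obtain ⟨z, hz1, hz2⟩ := exists_between hx.2
  have := h.continuousOn ordConnected_Ioo (x := y) (y := z) ⟨hy1, hy2.trans hx.2⟩
    ⟨hx.1.trans hz1, hz2⟩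
  rw [uIcc_of_le (hy2.le.trans hz1.le)] at this
  exact (this.continuousAt (Icc_mem_nhds hy2 hz1)).continuousWithinAt

lemma ae_hasDerivAt_Ioo {x y : ℝ} (h : IsPrimitiveOn f g (Icc x y)) :
    ∀ᵐ z, z ∈ Ioo x y → HasDerivAt f (g z) z := by
  by_cases hxy : x ≤ y
  swap
  · filter_upwards with z hz
    exact absurd (hz.1.trans hz.2).le hxy
  have h1 := (h x (left_mem_Icc.2 hxy) y (right_mem_Icc.2 hxy)).1.ae_hasDerivAt_integral
  filter_upwards [h1] with z hz hz'
  have h2 := (hz (by rw [uIcc_of_le hxy]; exact Ioo_subset_Icc_self hz') x left_mem_uIcc).add_const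
    (f x)
  refine h2.congr_of_eventuallyEq ?_
  filter_upwards [Ioo_mem_nhds hz'.1 hz'.2] with w hw
  rw [(h x (left_mem_Icc.2 hxy) w (Ioo_subset_Icc_self hw)).2]
  ring

lemma ae_hasDerivAt (h : IsPrimitiveOn f g I) :
    ∀ᵐ z, z ∈ interior I → HasDerivAt f (g z) z := by
  -- The exceptional null set depends on the interval; rational endpoints keep the number of such
  -- sets countable.
  have h1 : ∀ᵐ z, ∀ x y : ℚ, Icc (x : ℝ) y ⊆ I → z ∈ Ioo (x : ℝ) y → HasDerivAt f (g z) z := by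
    rw [ae_all_iff]; intro x; rw [ae_all_iff]; intro y
    by_cases hxy : Icc (x : ℝ) y ⊆ I
    · filter_upwards [(h.mono hxy).ae_hasDerivAt_Ioo] with z hz _ hz'
      exact hz hz'
    · filter_upwards with z hz
      exact absurd hz hxy
  filter_upwards [h1] with z hz hz'
  obtain ⟨p, q, hpq, hpq'⟩ := mem_nhds_iff_exists_Ioo_subset.1 (mem_interior_iff_mem_nhds.1 hz')
  obtain ⟨x, hx1, hx2⟩ := exists_rat_btwn hpq.1
  obtain ⟨y, hy1, hy2⟩ := exists_rat_btwn hpq.2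
  exact hz x y ((Icc_subset_Ioo hx1 hy2).trans hpq') ⟨hx2, hy1⟩

lemma ae_hasDerivAt_of_mem_Ioo {p q : ℝ} (h : IsPrimitiveOn f g (Ioo p q)) :
    ∀ᵐ z, z ∈ Ioo p q → HasDerivAt f (g z) z := by
  simpa [interior_Ioo] using h.ae_hasDerivAt

lemma mul {p q : ℝ} (h₁ : IsPrimitiveOn f₁ g₁ (Ioo p q)) (h₂ : IsPrimitiveOn f₂ g₂ (Ioo p q)) :
    IsPrimitiveOn (fun x => f₁ x * f₂ x) (fun x => g₁ x * f₂ x + f₁ x * g₂ x) (Ioo p q) := by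
  refine of_absCont ordConnected_Ioo (fun x hx y hy =>
    (h₁.absCont ordConnected_Ioo hx hy).mul (h₂.absCont ordConnected_Ioo hx hy)) ?_
  filter_upwards [h₁.ae_hasDerivAt_of_mem_Ioo, h₂.ae_hasDerivAt_of_mem_Ioo] with z hz₁ hz₂ hz
  exact (hz₁ hz).mul (hz₂ hz)

lemma add {p q : ℝ} (h₁ : IsPrimitiveOn f₁ g₁ (Ioo p q)) (h₂ : IsPrimitiveOn f₂ g₂ (Ioo p q)) :
    IsPrimitiveOn (fun x => f₁ x + f₂ x) (fun x => g₁ x + g₂ x) (Ioo p q) := by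
  refine fun x hx y hy => ⟨(h₁ x hx y hy).1.add (h₂ x hx y hy).1, ?_⟩
  rw [intervalIntegral.integral_add (h₁ x hx y hy).1 (h₂ x hx y hy).1, (h₁ x hx y hy).2,
    (h₂ x hx y hy).2]
  ring

lemma const_mul (h : IsPrimitiveOn f g I) (c : ℝ) :
    IsPrimitiveOn (fun x => c * f x) (fun x => c * g x) I := by
  refine fun x hx y hy => ⟨(h x hx y hy).1.const_mul c, ?_⟩
  rw [intervalIntegral.integral_const_mul, (h x hx y hy).2]
  ring

lemma congr_ae {p q : ℝ} (h : IsPrimitiveOn f g (Ioo p q))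
    (hg : ∀ᵐ z, z ∈ Ioo p q → g z = g₁ z) : IsPrimitiveOn f g₁ (Ioo p q) := by
  refine of_absCont ordConnected_Ioo (fun x hx y hy => h.absCont ordConnected_Ioo hx hy) ?_
  filter_upwards [h.ae_hasDerivAt_of_mem_Ioo, hg] with z hz₁ hz₂ hz
  exact hz₂ hz ▸ hz₁ hz

lemma ae_unique {p q : ℝ} (h₁ : IsPrimitiveOn f g₁ (Ioo p q))
    (h₂ : IsPrimitiveOn f g₂ (Ioo p q)) : ∀ᵐ z, z ∈ Ioo p q → g₁ z = g₂ z := by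
  filter_upwards [h₁.ae_hasDerivAt_of_mem_Ioo, h₂.ae_hasDerivAt_of_mem_Ioo] with z hz₁ hz₂ hz
  exact (hz₁ hz).unique (hz₂ hz)

lemma comp {p q : ℝ} {ψ ψ' : ℝ → ℝ} (h : IsPrimitiveOn f g (Ioo p q))
    (hψ : ∀ s, HasDerivAt ψ (ψ' s) s) (hψ' : Continuous ψ') :
    IsPrimitiveOn (fun x => ψ (f x)) (fun x => ψ' (f x) * g x) (Ioo p q) := by
  have hC1 : ContDiff ℝ 1 ψ := by
    rw [contDiff_one_iff_deriv]
    refine ⟨fun s => (hψ s).differentiableAt, ?_⟩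
    rwa [show deriv ψ = ψ' from funext fun s => (hψ s).deriv]
  refine of_absCont ordConnected_Ioo (fun x hx y hy => ?_) ?_
  · have hac := h.absCont ordConnected_Ioo hx hy
    -- On the segment f takes values in [-M, M], where the C¹ function ψ is Lipschitz; this
    -- transfers absolute continuity to the composition.
    obtain ⟨M, hM⟩ := hac.exists_bound
    obtain ⟨K, hK⟩ := hC1.contDiffOn.exists_lipschitzOnWith (by decide)
      (convex_Icc (-M) M) isCompact_Icc
    have h0 := Tendsto.const_mul (K : ℝ) hac
    rw [mul_zero] at h0
    refine squeeze_zero' ?_ ?_ h0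
    · filter_upwards with E
      positivity
    · filter_upwards [mem_inf_of_right (mem_principal_self _)] with E hE
      rw [Finset.mul_sum]
      refine Finset.sum_le_sum fun i hi => ?_
      exact hK.dist_le_mul _ (abs_le.1 (hM _ (hE.1 i hi).1)) _ (abs_le.1 (hM _ (hE.1 i hi).2))
  · filter_upwards [h.ae_hasDerivAt_of_mem_Ioo] with z hz₁ hz
    exact (hψ (f z)).comp z (hz₁ hz)

lemma of_hasDerivAt {p q : ℝ} (hd : ∀ z ∈ Ioo p q, HasDerivAt f (g z) z)
    (hg : ContinuousOn g (Ioo p q)) : IsPrimitiveOn f g (Ioo p q) := by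
  intro x hx y hy
  have hsub : uIcc x y ⊆ Ioo p q := ordConnected_Ioo.uIcc_subset hx hy
  have hi : IntervalIntegrable g volume x y := (hg.mono hsub).intervalIntegrable
  exact ⟨hi, intervalIntegral.integral_eq_sub_of_hasDerivAt (fun z hz => hd z (hsub hz)) hi⟩

/-- Extension of a primitive to the closed interval. -/
lemma Icc_of_Ioo {p q : ℝ} (hpq : p < q) (h : IsPrimitiveOn f g (Ioo p q))
    (hf : ContinuousOn f (Icc p q)) (hg : IntegrableOn g (Ioo p q)) :
    IsPrimitiveOn f g (Icc p q) := by
  have hg' : IntervalIntegrable g volume p q := by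
    rw [intervalIntegrable_iff_integrableOn_Ioo_of_le hpq.le]; exact hg
  have hi : ∀ x ∈ Icc p q, ∀ y ∈ Icc p q, IntervalIntegrable g volume x y := fun x hx y hy =>
    hg'.mono_set (by rw [uIcc_of_le hpq.le]; exact ordConnected_Icc.uIcc_subset hx hy)
  obtain ⟨m, hm⟩ := exists_between hpq
  have hm' : m ∈ Icc p q := ⟨hm.1.le, hm.2.le⟩
  have hcont : ContinuousOn (fun x => ∫ s in m..x, g s) (Icc p q) := by
    have := (hg'.absolutelyContinuousOnInterval_intervalIntegral (c := m)
      (by rw [uIcc_of_le hpq.le]; exact hm')).continuousOn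
    rwa [uIcc_of_le hpq.le] at this
  -- Both sides are continuous on the closed interval, so the identity extends from the open one by
  -- density.
  have key : EqOn (fun x => ∫ s in m..x, g s) (fun x => f x - f m) (Icc p q) := by
    have : EqOn (fun x => ∫ s in m..x, g s) (fun x => f x - f m) (Ioo p q) :=
      fun x hx => (h m hm x hx).2
    refine this.of_subset_closure hcont (hf.sub continuousOn_const) Ioo_subset_Icc_self ?_
    rw [closure_Ioo hpq.ne]
  intro x hx y hy
  refine ⟨hi x hx y hy, ?_⟩
  rw [← intervalIntegral.integral_interval_sub_left (hi m hm' y hy) (hi m hm' x hx)]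
  have h1 := key hx
  have h2 := key hy
  simp only at h1 h2
  rw [h1, h2]; ring

end IsPrimitiveOn

/-! ### Weak derivatives: uniqueness and the one-dimensional case -/

section Generic

variable {X F : Type} [NormedAddCommGroup X] [MeasureSpace X] [NormedAddCommGroup F]
  [NormedSpace ℝ F]

lemma integrableOn_smul_of_tsupport_subset [OpensMeasurableSpace X] [SecondCountableTopology X]
    {Ω : Set X} {f : X → F}
    (hf : LocallyIntegrableOn f Ω volume) {φ : X → ℝ} (hφ : Continuous φ)
    (hc : HasCompactSupport φ) (hs : tsupport φ ⊆ Ω) :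
    IntegrableOn (fun x => φ x • f x) Ω volume := by
  have h1 : IntegrableOn (fun x => φ x • f x) (tsupport φ) volume :=
    (hf.integrableOn_compact_subset hs hc).continuousOn_smul hφ.continuousOn hc
  refine h1.of_forall_sdiff_eq_zero ?_ ?_ |>.mono_set (subset_univ _)
  · exact MeasurableSet.univ
  · intro x hx
    rw [image_eq_zero_of_notMem_tsupport hx.2, zero_smul]

lemma setIntegral_smul_of_tsupport_subset {Ω : Set X} {φ : X → ℝ} (hs : tsupport φ ⊆ Ω)
    (f : X → F) : ∫ x in Ω, φ x • f x = ∫ x, φ x • f x :=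
  setIntegral_eq_integral_of_forall_compl_eq_zero fun x hx => by
    rw [image_eq_zero_of_notMem_tsupport fun h => hx (hs h), zero_smul]

variable [NormedSpace ℝ X]

lemma setIntegral_fderiv_smul_of_tsupport_subset {Ω : Set X} {φ : X → ℝ} (hs : tsupport φ ⊆ Ω)
    (v : X) (f : X → F) : ∫ x in Ω, fderiv ℝ φ x v • f x = ∫ x, fderiv ℝ φ x v • f x :=
  setIntegral_eq_integral_of_forall_compl_eq_zero fun x hx => by
    rw [image_eq_zero_of_notMem_tsupport fun h => hx (hs (tsupport_fderiv_subset ℝ h))]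
    simp

lemma HasWeakDirDeriv.mono {Ω Ω' : Set X} {v : X} {f g : X → F} (h : HasWeakDirDeriv Ω v f g)
    (hΩ : Ω' ⊆ Ω) : HasWeakDirDeriv Ω' v f g := by
  refine ⟨h.1.mono_set hΩ, h.2.1.mono_set hΩ, fun φ hφ hc hs => ?_⟩
  have := h.2.2 φ hφ hc (hs.trans hΩ)
  rwa [setIntegral_smul_of_tsupport_subset (hs.trans hΩ),
    setIntegral_fderiv_smul_of_tsupport_subset (hs.trans hΩ),
    ← setIntegral_smul_of_tsupport_subset hs,
    ← setIntegral_fderiv_smul_of_tsupport_subset hs] at this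

/-- The fundamental lemma of the calculus of variations. It identifies the derivatives occurring in
the radial system with those built from circular averages, so that integrability of the latter
passes to the former. -/
lemma HasWeakDirDeriv.ae_unique [BorelSpace X] [FiniteDimensional ℝ X] [CompleteSpace F]
    {Ω : Set X} (hΩ : IsOpen Ω) {v : X} {f f' g g' : X → F} (h : HasWeakDirDeriv Ω v f g)
    (h' : HasWeakDirDeriv Ω v f' g') (hff : ∀ᵐ x, x ∈ Ω → f x = f' x) :
    ∀ᵐ x, x ∈ Ω → g x = g' x := by
  have := hΩ.ae_eq_zero_of_integral_contDiff_smul_eq_zero (μ := volume) (h.2.1.sub h'.2.1) ?_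
  · filter_upwards [this] with x hx hxΩ
    exact sub_eq_zero.1 (hx hxΩ)
  intro φ hφ hc hs
  have h0 : ∀ x ∉ Ω, φ x • (g - g') x = 0 := fun x hx => by
    rw [image_eq_zero_of_notMem_tsupport fun h => hx (hs h), zero_smul]
  rw [← setIntegral_eq_integral_of_forall_compl_eq_zero h0]
  simp only [Pi.sub_apply, smul_sub]
  rw [integral_sub (integrableOn_smul_of_tsupport_subset h.2.1 hφ.continuous hc hs)
    (integrableOn_smul_of_tsupport_subset h'.2.1 hφ.continuous hc hs), sub_eq_zero]
  rw [← neg_inj, ← h.2.2 φ hφ hc hs, ← h'.2.2 φ hφ hc hs]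
  refine integral_congr_ae ?_
  filter_upwards [(ae_restrict_iff' hΩ.measurableSet).2 hff] with x hx
  rw [hx]

end Generic

lemma exists_Icc_of_isCompact_subset_Ioo {p q : ℝ} (hpq : p < q) {K : Set ℝ} (hK : IsCompact K)
    (hs : K ⊆ Ioo p q) : ∃ x ∈ Ioo p q, ∃ y ∈ Ioo p q, x < y ∧ K ⊆ Ioo x y := by
  rcases K.eq_empty_or_nonempty with rfl | hne
  · obtain ⟨x, hx⟩ := exists_between hpq
    obtain ⟨y, hy⟩ := exists_between hx.2
    exact ⟨x, hx, y, ⟨hx.1.trans hy.1, hy.2⟩, hy.1, empty_subset _⟩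
  · have h1 := hs (hK.sInf_mem hne)
    have h2 := hs (hK.sSup_mem hne)
    obtain ⟨x, hx⟩ := exists_between h1.1
    obtain ⟨y, hy⟩ := exists_between h2.2
    have h3 : sInf K ≤ sSup K := csInf_le_csSup hne hK.bddBelow hK.bddAbove
    refine ⟨x, ⟨hx.1, hx.2.trans h1.2⟩, y, ⟨h2.1.trans hy.1, hy.2⟩,
      hx.2.trans_le (h3.trans hy.1.le), fun z hz => ⟨hx.2.trans_le (csInf_le hK.bddBelow hz),
        (le_csSup hK.bddAbove hz).trans_lt hy.1⟩⟩

lemma setIntegral_Ioo_eq_intervalIntegral {p q x y : ℝ} (hx : x ∈ Ioo p q) (hy : y ∈ Ioo p q)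
    (hxy : x < y) {k : ℝ → ℝ} (hk : ∀ s ∉ Ioo x y, k s = 0) :
    ∫ s in Ioo p q, k s = ∫ s in x..y, k s := by
  rw [intervalIntegral.integral_of_le hxy.le, integral_Ioc_eq_integral_Ioo]
  refine setIntegral_eq_of_subset_of_forall_sdiff_eq_zero measurableSet_Ioo
    (Ioo_subset_Ioo hx.1.le hy.2.le) fun s hs => hk s hs.2

lemma fderiv_apply_one (φ : ℝ → ℝ) (x : ℝ) : fderiv ℝ φ x 1 = deriv φ x := by
  simp

lemma deriv_eq_zero_of_notMem_tsupport {φ : ℝ → ℝ} {x : ℝ} (hx : x ∉ tsupport φ) :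
    deriv φ x = 0 :=
  image_eq_zero_of_notMem_tsupport fun h => hx (tsupport_deriv_subset h)

lemma IsPrimitiveOn.locallyIntegrableOn {p q : ℝ} {f g : ℝ → ℝ}
    (h : IsPrimitiveOn f g (Ioo p q)) : LocallyIntegrableOn g (Ioo p q) volume := by
  intro z hz
  obtain ⟨x, hx⟩ := exists_between hz.1
  obtain ⟨y, hy⟩ := exists_between hz.2
  have := (h x ⟨hx.1, hx.2.trans hz.2⟩ y ⟨hz.1.trans hy.1, hy.2⟩).1
  rw [intervalIntegrable_iff_integrableOn_Icc_of_le (hx.2.trans hy.1).le] at this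
  exact ⟨Icc x y, mem_nhdsWithin_of_mem_nhds (Icc_mem_nhds hx.2 hy.1), this⟩

lemma IsPrimitiveOn.hasWeakDirDeriv {p q : ℝ} (hpq : p < q) {f g : ℝ → ℝ}
    (h : IsPrimitiveOn f g (Ioo p q)) : HasWeakDirDeriv (Ioo p q) (1 : ℝ) f g := by
  refine ⟨h.continuousOn_Ioo.locallyIntegrableOn measurableSet_Ioo, h.locallyIntegrableOn, ?_⟩
  intro φ hφ hc hs
  obtain ⟨x, hx, y, hy, hxy, hK⟩ := exists_Icc_of_isCompact_subset_Ioo hpq hc hs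
  have h1 : IsPrimitiveOn φ (deriv φ) (Ioo p q) :=
    IsPrimitiveOn.of_hasDerivAt (fun z _ => (hφ.differentiable (by simp)).differentiableAt.hasDerivAt)
      (hφ.continuous_deriv (by simp)).continuousOn
  have h2 := (h1.mul h) x hx y hy
  have hx0 : φ x = 0 := image_eq_zero_of_notMem_tsupport fun h => lt_irrefl _ (hK h).1
  have hy0 : φ y = 0 := image_eq_zero_of_notMem_tsupport fun h => lt_irrefl _ (hK h).2
  rw [setIntegral_Ioo_eq_intervalIntegral hx hy hxy, setIntegral_Ioo_eq_intervalIntegral hx hy hxy]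
  · have hsub : uIcc x y ⊆ Ioo p q := ordConnected_Ioo.uIcc_subset hx hy
    have i1 : IntervalIntegrable (fun s => deriv φ s * f s) volume x y :=
      (((hφ.continuous_deriv (by simp)).continuousOn).mul
        (h.continuousOn_Ioo.mono hsub)).intervalIntegrable
    have i2 : IntervalIntegrable (fun s => φ s * g s) volume x y :=
      (h x hx y hy).1.continuousOn_mul hφ.continuous.continuousOn
    have h3 := h2.2
    rw [intervalIntegral.integral_add i1 i2] at h3
    simp only [hx0, hy0] at h3
    simp only [fderiv_apply_one, smul_eq_mul]
    linarith
  · intro s hs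
    rw [image_eq_zero_of_notMem_tsupport fun h => hs (hK h), zero_smul]
  · intro s hs
    rw [fderiv_apply_one, deriv_eq_zero_of_notMem_tsupport fun h => hs (hK h), zero_smul]

lemma exists_smooth_integral_eq_one {p q : ℝ} (hpq : p < q) : ∃ θ : ℝ → ℝ, ContDiff ℝ ∞ θ ∧
    HasCompactSupport θ ∧ tsupport θ ⊆ Ioo p q ∧ ∫ x, θ x = 1 := by
  let b : ContDiffBump ((p + q) / 2) := ⟨(q - p) / 8, (q - p) / 4, by linarith, by linarith⟩
  refine ⟨b.normed volume, b.contDiff_normed, b.hasCompactSupport_normed, ?_, b.integral_normed⟩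
  rw [b.tsupport_normed_eq, Real.closedBall_eq_Icc]
  intro x hx
  have : b.rOut = (q - p) / 4 := rfl
  rw [this] at hx
  constructor <;> linarith [hx.1, hx.2]

/-- A test function of mean zero is the derivative of a test function: its primitive vanishes to the
left of the support, and to the right because the total integral is zero. -/
lemma intervalIntegral_primitive_tsupport {φ : ℝ → ℝ} (hφ : ContDiff ℝ ∞ φ) {x y : ℝ}
    (hxy : x < y) (hK : tsupport φ ⊆ Ioo x y) (h0 : ∫ s, φ s = 0) :
    ContDiff ℝ ∞ (fun z => ∫ s in x..z, φ s) ∧ tsupport (fun z => ∫ s in x..z, φ s) ⊆ Icc x y ∧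
      ∀ z, HasDerivAt (fun z => ∫ s in x..z, φ s) (φ z) z := by
  have hd : ∀ z, HasDerivAt (fun z => ∫ s in x..z, φ s) (φ z) z := fun z =>
    hφ.continuous.integral_hasStrictDerivAt x z |>.hasDerivAt
  refine ⟨?_, ?_, hd⟩
  · rw [contDiff_infty_iff_deriv]
    refine ⟨fun z => (hd z).differentiableAt, ?_⟩
    rwa [show deriv (fun z => ∫ s in x..z, φ s) = φ from funext fun z => (hd z).deriv]
  · have hz : ∀ s ∉ Ioo x y, φ s = 0 := fun s hs =>
      image_eq_zero_of_notMem_tsupport fun h => hs (hK h)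
    refine closure_minimal (fun z hz' => ?_) isClosed_Icc
    by_contra hc
    apply hz'
    rcases lt_or_ge z x with h | h
    · refine intervalIntegral.integral_zero_ae (Eventually.of_forall fun s hs => hz s fun h' => ?_)
      rw [uIoc_of_ge h.le] at hs
      exact absurd hs.2 (not_le.2 h'.1)
    · have hy : y < z := by
        by_contra h'
        exact hc ⟨h, not_lt.1 h'⟩
      have h1 : ∫ s in x..y, φ s = 0 := by
        rw [intervalIntegral.integral_of_le hxy.le, integral_Ioc_eq_integral_Ioo,
          setIntegral_eq_integral_of_forall_compl_eq_zero hz, h0]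
      have h2 : ∫ s in y..z, φ s = 0 := by
        refine intervalIntegral.integral_zero_ae (Eventually.of_forall fun s hs => hz s fun h' => ?_)
        rw [uIoc_of_le hy.le] at hs
        exact absurd hs.1 (not_lt.2 h'.2.le)
      simp only
      rw [← intervalIntegral.integral_add_adjacent_intervals
        (hφ.continuous.intervalIntegrable _ _) (hφ.continuous.intervalIntegrable y z), h1, h2,
        add_zero]

/-- The lemma of du Bois-Reymond. -/
theorem ae_eq_const_of_integral_deriv_mul_eq_zero {p q : ℝ} (hpq : p < q) {h : ℝ → ℝ}
    (hh : LocallyIntegrableOn h (Ioo p q) volume)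
    (H : ∀ φ : ℝ → ℝ, ContDiff ℝ ∞ φ → HasCompactSupport φ → tsupport φ ⊆ Ioo p q →
      ∫ x in Ioo p q, deriv φ x * h x = 0) : ∃ c, ∀ᵐ x, x ∈ Ioo p q → h x = c := by
  obtain ⟨θ, hθ, hθc, hθs, hθ1⟩ := exists_smooth_integral_eq_one hpq
  set c := ∫ x in Ioo p q, θ x * h x with hc_def
  refine ⟨c, ?_⟩
  have hhc : LocallyIntegrableOn (fun x => h x - c) (Ioo p q) volume :=
    hh.sub (continuousOn_const.locallyIntegrableOn measurableSet_Ioo)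
  have := isOpen_Ioo.ae_eq_zero_of_integral_contDiff_smul_eq_zero hhc ?_
  · filter_upwards [this] with x hx hx'
    linarith [hx hx']
  intro φ hφ hφc hφs
  set I := ∫ x, φ x
  -- Subtracting a multiple of the normalized bump θ makes the mean zero, so χ is the derivative of
  -- an admissible test function.
  set χ : ℝ → ℝ := fun x => φ x - I * θ x with hχ_def
  have hχ : ContDiff ℝ ∞ χ := hφ.sub (contDiff_const.mul hθ)
  have iφ := hφ.continuous.integrable_of_hasCompactSupport (μ := volume) hφc
  have iθ := hθ.continuous.integrable_of_hasCompactSupport (μ := volume) hθc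
  have hχ0 : ∫ x, χ x = 0 := by
    rw [hχ_def, integral_sub iφ (iθ.const_mul I), integral_const_mul, hθ1]
    ring
  have hKc : IsCompact (tsupport φ ∪ tsupport θ) := IsCompact.union hφc hθc
  obtain ⟨x, hx, y, hy, hxy, hK⟩ := exists_Icc_of_isCompact_subset_Ioo hpq hKc
    (union_subset hφs hθs)
  have hχs : tsupport χ ⊆ Ioo x y := by
    refine (closure_minimal (fun z hz => ?_) hKc.isClosed).trans hK
    by_contra hz'
    rw [mem_union, not_or] at hz'
    apply hz
    simp only [hχ_def]
    rw [image_eq_zero_of_notMem_tsupport hz'.1, image_eq_zero_of_notMem_tsupport hz'.2]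
    simp
  obtain ⟨h1, h2, h3⟩ := intervalIntegral_primitive_tsupport hχ hxy hχs hχ0
  have h4 := H _ h1 (HasCompactSupport.of_support_subset_isCompact isCompact_Icc
    ((subset_tsupport _).trans h2)) (h2.trans (Icc_subset_Ioo hx.1 hy.2))
  have i1 := integrableOn_smul_of_tsupport_subset hh hφ.continuous hφc hφs
  have i2 := integrableOn_smul_of_tsupport_subset hh hθ.continuous hθc hθs
  simp only [smul_eq_mul] at i1 i2
  have h5 : ∫ x in Ioo p q, φ x * h x = I * c := by
    have : ∀ z, deriv (fun z => ∫ s in x..z, χ s) z * h z = φ z * h z - I * (θ z * h z) :=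
      fun z => by rw [(h3 z).deriv]; simp only [hχ_def]; ring
    simp only [this] at h4
    rw [integral_sub i1 (i2.const_mul I), integral_const_mul] at h4
    linarith
  have h0 : ∀ x ∉ Ioo p q, φ x • (h x - c) = 0 := fun x hx => by
    rw [image_eq_zero_of_notMem_tsupport fun h => hx (hφs h), zero_smul]
  rw [← setIntegral_eq_integral_of_forall_compl_eq_zero h0]
  have : ∀ z, φ z • (h z - c) = φ z * h z - φ z * c := fun z => by rw [smul_eq_mul]; ring
  simp only [this]
  rw [integral_sub i1 (iφ.integrableOn.mul_const c), h5, integral_mul_const,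
    setIntegral_eq_integral_of_forall_compl_eq_zero fun x hx =>
      image_eq_zero_of_notMem_tsupport fun h => hx (hφs h)]
  ring

theorem HasWeakDirDeriv.exists_isPrimitiveOn {p q : ℝ} (hpq : p < q) {f g : ℝ → ℝ}
    (h : HasWeakDirDeriv (Ioo p q) (1 : ℝ) f g) :
    ∃ F, IsPrimitiveOn F g (Ioo p q) ∧ ∀ᵐ x, x ∈ Ioo p q → f x = F x := by
  obtain ⟨m, hm⟩ := exists_between hpq
  have hi : ∀ x ∈ Ioo p q, ∀ y ∈ Ioo p q, IntervalIntegrable g volume x y := by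
    intro x hx y hy
    have := h.2.1.integrableOn_compact_subset (ordConnected_Ioo.uIcc_subset hx hy) isCompact_uIcc
    exact (intervalIntegrable_iff_integrableOn_Icc_of_le (μ := volume) min_le_max).2 this
      |>.mono_set (by rw [uIcc_of_le (min_le_max), uIcc])
  have hF : IsPrimitiveOn (fun x => ∫ s in m..x, g s) g (Ioo p q) := by
    refine fun x hx y hy => ⟨hi x hx y hy, ?_⟩
    rw [intervalIntegral.integral_interval_sub_left (hi m hm y hy) (hi m hm x hx)]
  have hFw := hF.hasWeakDirDeriv hpq
  obtain ⟨c, hc⟩ := ae_eq_const_of_integral_deriv_mul_eq_zero hpq (h.1.sub hFw.1) (by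
    intro φ hφ hφc hφs
    have hd : ContDiff ℝ ∞ (deriv φ) := (contDiff_infty_iff_deriv.1 hφ).2
    have i1 := integrableOn_smul_of_tsupport_subset h.1 hd.continuous hφc.deriv
      (tsupport_deriv_subset.trans hφs)
    have i2 := integrableOn_smul_of_tsupport_subset hFw.1 hd.continuous hφc.deriv
      (tsupport_deriv_subset.trans hφs)
    have e1 := h.2.2 φ hφ hφc hφs
    have e2 := hFw.2.2 φ hφ hφc hφs
    simp only [fderiv_apply_one, smul_eq_mul] at e1 e2 i1 i2
    simp only [Pi.sub_apply, mul_sub]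
    rw [integral_sub i1 i2, e1, e2, sub_self])
  refine ⟨fun x => (∫ s in m..x, g s) + c, fun x hx y hy => ⟨hi x hx y hy, ?_⟩, ?_⟩
  · rw [(hF x hx y hy).2]; ring
  · filter_upwards [hc] with x hx hx'
    have := hx hx'
    simp only [Pi.sub_apply] at this
    linarith

lemma eqOn_Ioo_of_ae_eq {p q : ℝ} {f g : ℝ → ℝ} (hf : ContinuousOn f (Ioo p q))
    (hg : ContinuousOn g (Ioo p q)) (h : ∀ᵐ x, x ∈ Ioo p q → f x = g x) :
    EqOn f g (Ioo p q) :=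
  Measure.eqOn_open_of_ae_eq (μ := volume) ((ae_restrict_iff' measurableSet_Ioo).2 h)
    isOpen_Ioo hf hg

/-- A weakly differentiable function agrees almost everywhere with an integral of its derivative,
and continuous functions that agree almost everywhere on an open interval are equal. -/
theorem HasWeakDirDeriv.isPrimitiveOn {p q : ℝ} {f g : ℝ → ℝ}
    (h : HasWeakDirDeriv (Ioo p q) (1 : ℝ) f g) (hf : ContinuousOn f (Ioo p q)) :
    IsPrimitiveOn f g (Ioo p q) := by
  rcases lt_or_ge p q with hpq | hpq
  · obtain ⟨F, hF, hfF⟩ := h.exists_isPrimitiveOn hpq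
    have := eqOn_Ioo_of_ae_eq hf hF.continuousOn_Ioo hfF
    intro x hx y hy
    rw [this hx, this hy]
    exact hF x hx y hy
  · intro x hx
    exact absurd (hx.1.trans hx.2) (not_lt.2 hpq)

/-! ### Weak partial derivatives of continuous functions of two variables -/

lemma fderiv_mul_fst_snd {η χ : ℝ → ℝ} (hη : Differentiable ℝ η) (hχ : Differentiable ℝ χ)
    (z : ℝ × ℝ) : fderiv ℝ (fun z : ℝ × ℝ => η z.1 * χ z.2) z (1, 0) = deriv η z.1 * χ z.2 := by
  have h1 : HasFDerivAt (fun z : ℝ × ℝ => η z.1) _ z :=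
    (hη z.1).hasFDerivAt.comp z hasFDerivAt_fst
  have h2 : HasFDerivAt (fun z : ℝ × ℝ => χ z.2) _ z :=
    (hχ z.2).hasFDerivAt.comp z hasFDerivAt_snd
  have h3 : HasFDerivAt (fun z : ℝ × ℝ => η z.1 * χ z.2) _ z := h1.mul h2
  rw [h3.fderiv]
  simp [mul_comm]

lemma hasCompactSupport_mul_fst_snd {η χ : ℝ → ℝ} (hη : HasCompactSupport η)
    (hχ : HasCompactSupport χ) : HasCompactSupport (fun z : ℝ × ℝ => η z.1 * χ z.2) ∧
      tsupport (fun z : ℝ × ℝ => η z.1 * χ z.2) ⊆ tsupport η ×ˢ tsupport χ := by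
  have hK : IsCompact (tsupport η ×ˢ tsupport χ) := IsCompact.prod hη hχ
  have hs : Function.support (fun z : ℝ × ℝ => η z.1 * χ z.2) ⊆ tsupport η ×ˢ tsupport χ :=
    fun z hz => ⟨subset_tsupport _ (left_ne_zero_of_mul hz),
      subset_tsupport _ (right_ne_zero_of_mul hz)⟩
  exact ⟨HasCompactSupport.of_support_subset_isCompact hK hs, closure_minimal hs hK.isClosed⟩

/-- Absolute continuity on almost every line. Product test functions η(t)χ(r) show that each average
∫ χ(r) f(t, r) dr is a primitive in t. For fixed times s and t, varying χ gives the fundamental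
theorem of calculus for almost every r. Rational times leave one null set, and continuity of f in t
recovers all times. -/
theorem HasWeakDirDeriv.ae_isPrimitiveOn_fst {U : Set (ℝ × ℝ)} {f g : ℝ × ℝ → ℝ}
    (h : HasWeakDirDeriv U ((1, 0) : ℝ × ℝ) f g) (hf : ContinuousOn f U) {t₁ t₂ r₁ r₂ : ℝ}
    (hU : Icc t₁ t₂ ×ˢ Icc r₁ r₂ ⊆ U) :
    ∀ᵐ r, r ∈ Ioo r₁ r₂ → IsPrimitiveOn (fun t => f (t, r)) (fun t => g (t, r)) (Ioo t₁ t₂) := by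
  have hQc : IsCompact (Icc t₁ t₂ ×ˢ Icc r₁ r₂) := isCompact_Icc.prod isCompact_Icc
  have hQ : Ioo t₁ t₂ ×ˢ Ioo r₁ r₂ ⊆ Icc t₁ t₂ ×ˢ Icc r₁ r₂ :=
    prod_mono Ioo_subset_Icc_self Ioo_subset_Icc_self
  have hgi : IntegrableOn g (Ioo t₁ t₂ ×ˢ Ioo r₁ r₂) volume :=
    (h.2.1.integrableOn_compact_subset hU hQc).mono_set hQ
  have hfi : IntegrableOn f (Ioo t₁ t₂ ×ˢ Ioo r₁ r₂) volume :=
    (h.1.integrableOn_compact_subset hU hQc).mono_set hQ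
  have hmul : ∀ {k : ℝ × ℝ → ℝ} {χ : ℝ → ℝ}, IntegrableOn k (Ioo t₁ t₂ ×ˢ Ioo r₁ r₂) volume →
      Continuous χ → HasCompactSupport χ →
      IntegrableOn (fun z => χ z.2 * k z) (Ioo t₁ t₂ ×ˢ Ioo r₁ r₂) volume := by
    intro k χ hk hχ hχc
    obtain ⟨C, hC⟩ := hχc.exists_bound_of_continuous hχ
    exact hk.bdd_mul (c := C) (hχ.comp continuous_snd).aestronglyMeasurable
      (Eventually.of_forall fun z => hC z.2)
  have hfst : ∀ {k : ℝ × ℝ → ℝ} {η : ℝ → ℝ}, IntegrableOn k (Ioo t₁ t₂ ×ˢ Ioo r₁ r₂) volume →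
      Continuous η → HasCompactSupport η →
      IntegrableOn (fun z => η z.1 * k z) (Ioo t₁ t₂ ×ˢ Ioo r₁ r₂) volume := by
    intro k χ hk hχ hχc
    obtain ⟨C, hC⟩ := hχc.exists_bound_of_continuous hχ
    exact hk.bdd_mul (c := C) (hχ.comp continuous_fst).aestronglyMeasurable
      (Eventually.of_forall fun z => hC z.1)
  have hslice : ∀ᵐ r, r ∈ Ioo r₁ r₂ → IntegrableOn (fun t => g (t, r)) (Ioo t₁ t₂) := by
    have h1 : Integrable g ((volume.restrict (Ioo t₁ t₂)).prod (volume.restrict (Ioo r₁ r₂))) := by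
      rw [Measure.prod_restrict]; exact hgi
    exact (ae_restrict_iff' measurableSet_Ioo).1 h1.prod_left_ae
  have hfcont : ∀ r ∈ Ioo r₁ r₂, ContinuousOn (fun t => f (t, r)) (Ioo t₁ t₂) := fun r hr =>
    hf.comp (by fun_prop) fun t ht => hU (hQ ⟨ht, hr⟩)
  -- the weighted averages in the second variable
  have hF : ∀ χ : ℝ → ℝ, ContDiff ℝ ∞ χ → HasCompactSupport χ → tsupport χ ⊆ Ioo r₁ r₂ →
      IsPrimitiveOn (fun t => ∫ r in Ioo r₁ r₂, χ r * f (t, r))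
        (fun t => ∫ r in Ioo r₁ r₂, χ r * g (t, r)) (Ioo t₁ t₂) := by
    intro χ hχ hχc hχs
    refine HasWeakDirDeriv.isPrimitiveOn ⟨?_, ?_, ?_⟩ ?_
    · have := hmul hfi hχ.continuous hχc
      rw [IntegrableOn, Measure.volume_eq_prod, ← Measure.prod_restrict] at this
      exact IntegrableOn.locallyIntegrableOn this.integral_prod_left
    · have := hmul hgi hχ.continuous hχc
      rw [IntegrableOn, Measure.volume_eq_prod, ← Measure.prod_restrict] at this
      exact IntegrableOn.locallyIntegrableOn this.integral_prod_left
    · intro η hη hηc hηs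
      obtain ⟨hc, hs⟩ := hasCompactSupport_mul_fst_snd hηc hχc
      have h1 := (h.mono (hQ.trans hU)).2.2 (fun z => η z.1 * χ z.2)
        ((hη.comp contDiff_fst).mul (hχ.comp contDiff_snd)) hc (hs.trans (prod_mono hηs hχs))
      have hd : ∀ z : ℝ × ℝ, fderiv ℝ (fun z : ℝ × ℝ => η z.1 * χ z.2) z (1, 0) • f z
          = deriv η z.1 * (χ z.2 * f z) := fun z => by
        rw [fderiv_mul_fst_snd (hη.differentiable (by simp)) (hχ.differentiable (by simp)),
          smul_eq_mul, mul_assoc]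
      simp only [hd, smul_eq_mul, mul_assoc] at h1
      rw [Measure.volume_eq_prod, setIntegral_prod, setIntegral_prod] at h1
      · simpa only [integral_const_mul, smul_eq_mul, fderiv_apply_one] using h1
      · exact hfst (hmul hgi hχ.continuous hχc) hη.continuous hηc
      · exact hfst (hmul hfi hχ.continuous hχc) (hη.continuous_deriv (by simp)) hηc.deriv
    · obtain ⟨C, hC⟩ := hQc.exists_bound_of_continuousOn (hf.mono hU)
      refine continuousOn_of_dominated (bound := fun r => |χ r| * C) (fun t ht => ?_)
        (fun t ht => ?_) ?_ (Eventually.of_forall fun r => ?_)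
      · refine ContinuousOn.aestronglyMeasurable (hχ.continuous.continuousOn.mul ?_)
          measurableSet_Ioo
        exact hf.comp (by fun_prop) fun r hr => hU (hQ ⟨ht, hr⟩)
      · refine (ae_restrict_iff' measurableSet_Ioo).2 (Eventually.of_forall fun r hr => ?_)
        rw [norm_mul]
        exact mul_le_mul_of_nonneg_left (hC _ (hQ ⟨ht, hr⟩)) (norm_nonneg _)
      · exact ((hχ.continuous.integrable_of_hasCompactSupport hχc).norm.mul_const C).integrableOn
      · by_cases hr : r ∈ Ioo r₁ r₂
        · exact continuousOn_const.mul (hfcont r hr)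
        · rw [image_eq_zero_of_notMem_tsupport fun h => hr (hχs h)]
          simpa using continuousOn_const
  have hpair : ∀ s ∈ Ioo t₁ t₂, ∀ t ∈ Ioo t₁ t₂, ∀ᵐ r, r ∈ Ioo r₁ r₂ →
      f (t, r) - f (s, r) - ∫ τ in s..t, g (τ, r) = 0 := by
    intro s hs t ht
    have hst : uIoc s t ⊆ Ioo t₁ t₂ :=
      uIoc_subset_uIcc.trans (ordConnected_Ioo.uIcc_subset hs ht)
    have hpi : Integrable (fun z : ℝ × ℝ => g z)
        ((volume.restrict (uIoc s t)).prod (volume.restrict (Ioo r₁ r₂))) := by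
      rw [Measure.prod_restrict]
      exact hgi.mono_set (prod_mono hst Subset.rfl)
    have hint : ∀ r, ∫ τ in s..t, g (τ, r) = (if s ≤ t then 1 else -1) *
        ∫ τ in uIoc s t, g (τ, r) := fun r => by
      rw [intervalIntegral.intervalIntegral_eq_integral_uIoc, smul_eq_mul]
    have hsl : ∀ t ∈ Ioo t₁ t₂, ContinuousOn (fun r => f (t, r)) (Ioo r₁ r₂) := fun t ht =>
      hf.comp (by fun_prop) fun r hr => hU (hQ ⟨ht, hr⟩)
    have hli : IntegrableOn (fun r => ∫ τ in s..t, g (τ, r)) (Ioo r₁ r₂) := by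
      simp only [hint]
      exact hpi.integral_prod_right.const_mul _
    have hlf : LocallyIntegrableOn (fun r => f (t, r) - f (s, r)) (Ioo r₁ r₂) volume :=
      ((hsl t ht).sub (hsl s hs)).locallyIntegrableOn measurableSet_Ioo
    refine isOpen_Ioo.ae_eq_zero_of_integral_contDiff_smul_eq_zero
      (hlf.sub hli.locallyIntegrableOn) ?_
    intro χ hχ hχc hχs
    obtain ⟨C, hC⟩ := hχc.exists_bound_of_continuous hχ.continuous
    have h1 := (hF χ hχ hχc hχs s hs t ht).2
    have hb : ∀ t ∈ Ioo t₁ t₂, IntegrableOn (fun r => χ r * f (t, r)) (Ioo r₁ r₂) := fun t ht =>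
      integrableOn_smul_of_tsupport_subset ((hsl t ht).locallyIntegrableOn measurableSet_Ioo)
        hχ.continuous hχc hχs
    have hswap : ∫ τ in s..t, ∫ r in Ioo r₁ r₂, χ r * g (τ, r)
        = ∫ r in Ioo r₁ r₂, χ r * ∫ τ in s..t, g (τ, r) := by
      rw [intervalIntegral.intervalIntegral_eq_integral_uIoc, integral_integral_swap]
      · rw [smul_eq_mul, ← integral_const_mul]
        refine integral_congr_ae (Eventually.of_forall fun r => ?_)
        simp only [hint, integral_const_mul]
        ring
      · exact hpi.bdd_mul (c := C) (hχ.continuous.comp continuous_snd).aestronglyMeasurable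
          (Eventually.of_forall fun z => hC z.2)
    rw [← setIntegral_smul_of_tsupport_subset hχs]
    simp only [smul_eq_mul, mul_sub]
    have i1 : IntegrableOn (fun r => χ r * f (t, r) - χ r * f (s, r)) (Ioo r₁ r₂) :=
      (hb t ht).sub (hb s hs)
    have i2 : IntegrableOn (fun r => χ r * ∫ τ in s..t, g (τ, r)) (Ioo r₁ r₂) :=
      hli.bdd_mul (c := C) hχ.continuous.aestronglyMeasurable (Eventually.of_forall fun z => hC z)
    rw [integral_sub i1 i2, integral_sub (hb t ht) (hb s hs), ← hswap, h1, sub_self]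
  have hall : ∀ᵐ r, ∀ s t : ℚ, (s : ℝ) ∈ Ioo t₁ t₂ → (t : ℝ) ∈ Ioo t₁ t₂ → r ∈ Ioo r₁ r₂ →
      f (t, r) - f (s, r) - ∫ τ in s..t, g (τ, r) = 0 := by
    rw [ae_all_iff]; intro s; rw [ae_all_iff]; intro t
    by_cases hs : (s : ℝ) ∈ Ioo t₁ t₂
    · by_cases ht : (t : ℝ) ∈ Ioo t₁ t₂
      · filter_upwards [hpair s hs t ht] with r hr _ _ using hr
      · filter_upwards with r _ h using absurd h ht
    · filter_upwards with r h using absurd h hs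
  filter_upwards [hall, hslice] with r hr hri hrm
  replace hri := hri hrm
  have hii : ∀ x ∈ Ioo t₁ t₂, ∀ y ∈ Ioo t₁ t₂, IntervalIntegrable (fun t => g (t, r)) volume x y :=
    fun x hx y hy => (intervalIntegrable_iff.2
      (hri.mono_set (uIoc_subset_uIcc.trans (ordConnected_Ioo.uIcc_subset hx hy))))
  intro x hx y hy
  refine ⟨hii x hx y hy, ?_⟩
  obtain ⟨s₀, hs₀⟩ := exists_rat_btwn (hx.1.trans hx.2)
  have hprim : IsPrimitiveOn (fun t => ∫ τ in s₀..t, g (τ, r)) (fun t => g (t, r))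
      (Ioo t₁ t₂) := fun x hx y hy => ⟨hii x hx y hy, by
    rw [intervalIntegral.integral_interval_sub_left (hii _ hs₀ y hy) (hii _ hs₀ x hx)]⟩
  have hEq : EqOn (fun t => f (t, r) - f (s₀, r)) (fun t => ∫ τ in s₀..t, g (τ, r))
      (Ioo t₁ t₂) := by
    have hd : EqOn (fun t => f (t, r) - f (s₀, r)) (fun t => ∫ τ in s₀..t, g (τ, r))
        (Ioo t₁ t₂ ∩ range ((↑) : ℚ → ℝ)) := by
      rintro _ ⟨ht, t, rfl⟩
      exact sub_eq_zero.1 (hr s₀ t hs₀ ht hrm)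
    refine hd.of_subset_closure ((hfcont r hrm).sub continuousOn_const) hprim.continuousOn_Ioo
      inter_subset_left ?_
    -- Rational times are dense in the open interval, and both sides of the identity are continuous
    -- in time.
    exact Rat.denseRange_cast.open_subset_closure_inter isOpen_Ioo
  have h1 := hEq hx
  have h2 := hEq hy
  simp only at h1 h2
  rw [← intervalIntegral.integral_interval_sub_left (hii _ hs₀ y hy) (hii _ hs₀ x hx), ← h1, ← h2]
  ring

/-- Weak derivatives in swapped coordinates. -/
lemma HasWeakDirDeriv.swap {U : Set (ℝ × ℝ)} (hU : IsOpen U) {f g : ℝ × ℝ → ℝ}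
    (h : HasWeakDirDeriv U ((0, 1) : ℝ × ℝ) f g) :
    HasWeakDirDeriv (Prod.swap ⁻¹' U) ((1, 0) : ℝ × ℝ) (f ∘ Prod.swap) (g ∘ Prod.swap) := by
  have hmp : MeasurePreserving (Prod.swap : ℝ × ℝ → ℝ × ℝ) volume volume :=
    Measure.measurePreserving_swap
  have hme : MeasurableEmbedding (Prod.swap : ℝ × ℝ → ℝ × ℝ) :=
    MeasurableEquiv.prodComm.measurableEmbedding
  have hU' : IsOpen (Prod.swap ⁻¹' U) := hU.preimage continuous_swap
  have hloc : ∀ {k : ℝ × ℝ → ℝ}, LocallyIntegrableOn k U volume →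
      LocallyIntegrableOn (k ∘ Prod.swap) (Prod.swap ⁻¹' U) volume := by
    intro k hk
    rw [locallyIntegrableOn_iff (hU'.isLocallyClosed)]
    intro K hK hKc
    have hK' : IsCompact (Prod.swap '' K) := hKc.image continuous_swap
    have := hk.integrableOn_compact_subset (image_subset_iff.2 hK) hK'
    rw [← hmp.integrableOn_comp_preimage hme] at this
    rwa [preimage_image_eq _ Prod.swap_injective] at this
  refine ⟨hloc h.1, hloc h.2.1, fun φ hφ hc hs => ?_⟩
  let e : (ℝ × ℝ) ≃ₜ (ℝ × ℝ) := Homeomorph.prodComm ℝ ℝ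
  have hcs : HasCompactSupport (φ ∘ Prod.swap) := hc.comp_homeomorph e
  have hts : tsupport (φ ∘ Prod.swap) ⊆ U := by
    have : tsupport (φ ∘ Prod.swap) ⊆ Prod.swap ⁻¹' (tsupport φ) :=
      tsupport_comp_subset_preimage φ continuous_swap
    intro z hz
    have := hs (this hz)
    simpa using this
  have h1 := h.2.2 (φ ∘ Prod.swap) (hφ.comp (contDiff_snd.prodMk contDiff_fst)) hcs hts
  have hd : ∀ z : ℝ × ℝ, fderiv ℝ (φ ∘ Prod.swap) z.swap (0, 1) = fderiv ℝ φ z (1, 0) := by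
    intro z
    have hsw : HasFDerivAt (Prod.swap : ℝ × ℝ → ℝ × ℝ)
        ((ContinuousLinearMap.snd ℝ ℝ ℝ).prod (ContinuousLinearMap.fst ℝ ℝ ℝ)) z.swap :=
      (ContinuousLinearMap.hasFDerivAt
        ((ContinuousLinearMap.snd ℝ ℝ ℝ).prod (ContinuousLinearMap.fst ℝ ℝ ℝ)))
    have := ((hφ.differentiable (by simp)) (Prod.swap z.swap)).hasFDerivAt.comp z.swap hsw
    rw [this.fderiv]
    simp
  have e1 := hmp.setIntegral_preimage_emb hme
    (fun z => fderiv ℝ (φ ∘ Prod.swap) z (0, 1) • f z) U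
  have e2 := hmp.setIntegral_preimage_emb hme (fun z => (φ ∘ Prod.swap) z • g z) U
  simp only [hd] at e1
  rw [← e1, ← e2] at h1
  simpa only [Function.comp_apply, Prod.swap_swap] using h1

theorem HasWeakDirDeriv.ae_isPrimitiveOn_snd {U : Set (ℝ × ℝ)} (hUo : IsOpen U)
    {f g : ℝ × ℝ → ℝ} (h : HasWeakDirDeriv U ((0, 1) : ℝ × ℝ) f g) (hf : ContinuousOn f U)
    {t₁ t₂ r₁ r₂ : ℝ} (hU : Icc t₁ t₂ ×ˢ Icc r₁ r₂ ⊆ U) :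
    ∀ᵐ t, t ∈ Ioo t₁ t₂ → IsPrimitiveOn (fun r => f (t, r)) (fun r => g (t, r)) (Ioo r₁ r₂) :=
  (h.swap hUo).ae_isPrimitiveOn_fst (hf.comp continuous_swap.continuousOn fun _ hz => hz)
    fun _ hz => hU ⟨hz.2, hz.1⟩

/-! ### Circular averages -/

/-- Generalized polar coordinates: `Φ : A × (-π, π) → Z` carries the measure `w α ⊗ dθ` to `ζ`,
and `N` recovers the first coordinate. -/
structure IsPolar {A Z : Type} [MeasurableSpace A] [MeasurableSpace Z] (α : Measure A)
    (ζ : Measure Z) (w : A → ℝ) (Φ : A × ℝ → Z) (N : Z → A) : Prop where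
  mp : MeasurePreserving Φ ((α.withDensity fun a => ENNReal.ofReal (w a)).prod
    (volume.restrict (Ioo (-Real.pi) Real.pi))) ζ
  measurable_weight : Measurable w
  weight_pos : ∀ᵐ a ∂α, 0 < w a
  measurable_proj : Measurable N
  proj_apply : ∀ a, 0 < w a → ∀ θ, N (Φ (a, θ)) = a

/-- The average of `h` over the circle with label `a`. -/
noncomputable def circAvg {A Z : Type} (Φ : A × ℝ → Z) (h : Z → ℝ) (a : A) : ℝ :=
  (2 * Real.pi)⁻¹ * ∫ θ in Ioo (-Real.pi) Real.pi, h (Φ (a, θ))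

namespace IsPolar

variable {A Z : Type} [MeasurableSpace A] [MeasurableSpace Z] {α : Measure A}
  {ζ : Measure Z} {w : A → ℝ} {Φ : A × ℝ → Z} {N : Z → A}

lemma circAvg_comp_mul (hP : IsPolar α ζ w Φ N) {a : A} (ha : 0 < w a) (k : A → ℝ) (h : Z → ℝ) :
    circAvg Φ (fun z => k (N z) * h z) a = k a * circAvg Φ h a := by
  unfold circAvg
  simp only [hP.proj_apply a ha]
  rw [integral_const_mul]
  ring

lemma circAvg_comp (hP : IsPolar α ζ w Φ N) {a : A} (ha : 0 < w a) (k : A → ℝ) :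
    circAvg Φ (fun z => k (N z)) a = k a := by
  have hpi := Real.pi_pos
  unfold circAvg
  simp only [hP.proj_apply a ha]
  rw [setIntegral_const, smul_eq_mul, measureReal_def, Real.volume_Ioo,
    ENNReal.toReal_ofReal (by linarith)]
  field_simp
  ring

lemma integrable_circAvg [SFinite α] (hP : IsPolar α ζ w Φ N) {h : Z → ℝ} (hh : Integrable h ζ) :
    Integrable (fun a => w a * circAvg Φ h a) α ∧
      ∫ a, w a * circAvg Φ h a ∂α = (2 * Real.pi)⁻¹ * ∫ z, h z ∂ζ := by
  have hm : Measurable fun a => ENNReal.ofReal (w a) := hP.measurable_weight.ennreal_ofReal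
  have hlt : ∀ᵐ a ∂α, ENNReal.ofReal (w a) < ⊤ := Eventually.of_forall fun _ => ENNReal.ofReal_lt_top
  have h1 := hP.mp.integrable_comp_of_integrable hh
  have h2 := h1.integral_prod_left
  have h3 : ∫ z, h z ∂ζ = ∫ p, (h ∘ Φ) p ∂((α.withDensity fun a => ENNReal.ofReal (w a)).prod
      (volume.restrict (Ioo (-Real.pi) Real.pi))) := by
    rw [← hP.mp.map_eq, integral_map hP.mp.measurable.aemeasurable]
    · rfl
    · rw [hP.mp.map_eq]
      exact hh.aestronglyMeasurable
  have h4 : ∀ᵐ a ∂α, (ENNReal.ofReal (w a)).toReal •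
      ∫ θ, (h ∘ Φ) (a, θ) ∂(volume.restrict (Ioo (-Real.pi) Real.pi))
      = (2 * Real.pi) * (w a * circAvg Φ h a) := by
    filter_upwards [hP.weight_pos] with a ha
    have hpi := Real.pi_pos
    rw [ENNReal.toReal_ofReal ha.le, smul_eq_mul, circAvg]
    simp only [Function.comp_apply]
    field_simp
  constructor
  · rw [integrable_withDensity_iff_integrable_smul' hm hlt] at h2
    have := (h2.congr h4).const_mul (2 * Real.pi)⁻¹
    refine this.congr (Eventually.of_forall fun a => ?_)
    have hpi := Real.pi_pos
    field_simp
  · rw [h3, integral_prod _ h1, integral_withDensity_eq_integral_toReal_smul hm hlt]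
    rw [integral_congr_ae h4, integral_const_mul, ← mul_assoc, inv_mul_cancel₀, one_mul]
    have hpi := Real.pi_pos
    positivity

/-- Cutting off to a set of labels multiplies h by a function of the label, which can be pulled out
of the circular average. -/
lemma setIntegral_circAvg [SFinite α] (hP : IsPolar α ζ w Φ N) {h : Z → ℝ} {S : Set A} (hS : MeasurableSet S)
    (hh : IntegrableOn h (N ⁻¹' S) ζ) :
    IntegrableOn (fun a => w a * circAvg Φ h a) S α ∧
      ∫ a in S, w a * circAvg Φ h a ∂α = (2 * Real.pi)⁻¹ * ∫ z in N ⁻¹' S, h z ∂ζ := by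
  have hS' : MeasurableSet (N ⁻¹' S) := hP.measurable_proj hS
  have h1 := hP.integrable_circAvg ((integrable_indicator_iff hS').2 hh)
  have h2 : (fun a => w a * circAvg Φ ((N ⁻¹' S).indicator h) a)
      =ᵐ[α] S.indicator fun a => w a * circAvg Φ h a := by
    filter_upwards [hP.weight_pos] with a ha
    have : (N ⁻¹' S).indicator h = fun z => S.indicator 1 (N z) * h z := by
      ext z
      by_cases hz : N z ∈ S
      · rw [indicator_of_mem hz, indicator_of_mem (show z ∈ N ⁻¹' S from hz)]; simp
      · rw [indicator_of_notMem hz, indicator_of_notMem (show z ∉ N ⁻¹' S from hz)]; simp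
    rw [this, hP.circAvg_comp_mul ha (S.indicator 1) h]
    by_cases ha' : a ∈ S
    · simp [ha']
    · simp [ha']
  rw [integral_congr_ae h2, integrable_congr h2, integrable_indicator_iff hS,
    integral_indicator hS, integral_indicator hS'] at h1
  exact h1

end IsPolar

/-- Polar coordinates on the plane. -/
noncomputable def polarMap (p : ℝ × ℝ) : Plane := !₂[p.1 * Real.cos p.2, p.1 * Real.sin p.2]

/-- Polar coordinates in the space variable of space-time. -/
noncomputable def polarMapTime (p : (ℝ × ℝ) × ℝ) : ℝ × Plane := (p.1.1, polarMap (p.1.2, p.2))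

lemma plane_norm_sq (x : Plane) : ‖x‖ ^ 2 = x 0 ^ 2 + x 1 ^ 2 := by
  rw [EuclideanSpace.norm_sq_eq]
  simp

lemma norm_polarMap (p : ℝ × ℝ) : ‖polarMap p‖ = |p.1| := by
  rw [← abs_norm, ← sq_eq_sq_iff_abs_eq_abs, plane_norm_sq]
  simp only [polarMap]
  simp
  nlinarith [Real.sin_sq_add_cos_sq p.2]

lemma measurable_polarMap : Measurable polarMap := by
  have : Continuous polarMap := by
    unfold polarMap
    refine (PiLp.continuous_toLp 2 _).comp ?_
    refine continuous_pi fun i => ?_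
    fin_cases i <;> simp <;> fun_prop
  exact this.measurable

lemma isPolar_plane : IsPolar (volume.restrict (Ioi (0 : ℝ))) (volume : Measure Plane) id polarMap
    (fun x => ‖x‖) where
  measurable_weight := measurable_id
  weight_pos := (ae_restrict_iff' measurableSet_Ioi).2 (Eventually.of_forall fun _ h => h)
  measurable_proj := measurable_norm
  proj_apply a ha θ := by rw [norm_polarMap]; exact abs_of_pos ha
  mp := by
    refine ⟨measurable_polarMap, ?_⟩
    have hm : Measurable fun a : ℝ => ENNReal.ofReal (id a) := measurable_id.ennreal_ofReal
    let e : ℝ × ℝ → Plane := fun q => !₂[q.1, q.2]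
    have he : MeasurePreserving e volume volume := by
      have h1 : MeasurePreserving (MeasurableEquiv.finTwoArrow (α := ℝ)).symm volume volume :=
        (volume_preserving_finTwoArrow ℝ).symm
      have h2 := (PiLp.volume_preserving_toLp (Fin 2)).comp h1
      exact h2
    refine Measure.ext_of_lintegral _ fun φ hφ => ?_
    rw [lintegral_map hφ measurable_polarMap, ← he.lintegral_comp hφ,
      ← lintegral_comp_polarCoord_symm, prod_withDensity_left hm, Measure.prod_restrict]
    exact lintegral_withDensity_eq_lintegral_mul _ (by fun_prop) (hφ.comp measurable_polarMap)

lemma isPolar_spaceTime : IsPolar (volume.restrict (univ ×ˢ Ioi (0 : ℝ)) : Measure (ℝ × ℝ))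
    (volume : Measure (ℝ × Plane)) Prod.snd polarMapTime (fun z => (z.1, ‖z.2‖)) where
  measurable_weight := measurable_snd
  weight_pos := (ae_restrict_iff' (MeasurableSet.univ.prod measurableSet_Ioi)).2
    (Eventually.of_forall fun _ h => h.2)
  measurable_proj := by fun_prop
  proj_apply a ha θ := by
    simp only [polarMapTime]
    rw [norm_polarMap, abs_of_pos ha]
  mp := by
    have hm : Measurable fun a : ℝ => ENNReal.ofReal (id a) := measurable_id.ennreal_ofReal
    have h1 := (MeasurePreserving.id (volume : Measure ℝ)).prod isPolar_plane.mp
    have h2 : MeasurePreserving (MeasurableEquiv.prodAssoc : (ℝ × ℝ) × ℝ ≃ᵐ ℝ × ℝ × ℝ)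
        (((volume : Measure ℝ).prod ((volume.restrict (Ioi (0 : ℝ))).withDensity
          fun a => ENNReal.ofReal (id a))).prod (volume.restrict (Ioo (-Real.pi) Real.pi)))
        ((volume : Measure ℝ).prod (((volume.restrict (Ioi (0 : ℝ))).withDensity
          fun a => ENNReal.ofReal (id a)).prod (volume.restrict (Ioo (-Real.pi) Real.pi)))) :=
      measurePreserving_prodAssoc _ _ _
    have h3 := h1.comp h2
    rw [prod_withDensity_right hm] at h3
    have h4 : (volume.restrict (univ ×ˢ Ioi (0 : ℝ)) : Measure (ℝ × ℝ))
        = (volume : Measure ℝ).prod (volume.restrict (Ioi (0 : ℝ))) := by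
      rw [Measure.volume_eq_prod, ← Measure.prod_restrict, Measure.restrict_univ]
    rw [h4]
    exact h3

/-! ### Operations on test functions and weak derivatives -/

section TestFunctions

variable {X Y : Type} [NormedAddCommGroup X] [NormedAddCommGroup Y]

lemma hasCompactSupport_mul {φ : X → ℝ} (p : X → ℝ) (hc : HasCompactSupport φ) :
    HasCompactSupport (fun x => φ x * p x) ∧ tsupport (fun x => φ x * p x) ⊆ tsupport φ := by
  have hs : Function.support (fun x => φ x * p x) ⊆ tsupport φ :=
    fun z hz => subset_tsupport _ (left_ne_zero_of_mul hz)
  exact ⟨HasCompactSupport.of_support_subset_isCompact hc hs,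
    closure_minimal hs (isClosed_tsupport φ)⟩

variable [NormedSpace ℝ X] [NormedSpace ℝ Y]

lemma contDiff_mul_of_tsupport_subset {Ω : Set X} (hΩ : IsOpen Ω) {φ p : X → ℝ}
    (hφ : ContDiff ℝ ∞ φ) (hs : tsupport φ ⊆ Ω) (hp : ContDiffOn ℝ ∞ p Ω) :
    ContDiff ℝ ∞ (fun x => φ x * p x) := by
  rw [contDiff_iff_contDiffAt]
  intro x
  by_cases hx : x ∈ tsupport φ
  · exact hφ.contDiffAt.mul (hp.contDiffAt (hΩ.mem_nhds (hs hx)))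
  · refine (contDiffAt_const (c := (0 : ℝ))).congr_of_eventuallyEq ?_
    filter_upwards [(isClosed_tsupport φ).isOpen_compl.mem_nhds hx] with y hy
    rw [image_eq_zero_of_notMem_tsupport hy, zero_mul]

/-- Pullback of test functions along a proper map. -/
lemma testFunction_comp {V : Set Y} (hV : IsOpen V) {N : X → Y} (hN : Continuous N)
    (hNs : ContDiffOn ℝ ∞ N (N ⁻¹' V)) (hNc : ∀ K ⊆ V, IsCompact K → IsCompact (N ⁻¹' K))
    {χ : Y → ℝ} (hχ : ContDiff ℝ ∞ χ) (hc : HasCompactSupport χ) (hs : tsupport χ ⊆ V) :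
    ContDiff ℝ ∞ (fun x => χ (N x)) ∧ HasCompactSupport (fun x => χ (N x)) ∧
      tsupport (fun x => χ (N x)) ⊆ N ⁻¹' V := by
  have hsub : Function.support (fun x => χ (N x)) ⊆ N ⁻¹' tsupport χ :=
    fun x hx => subset_tsupport χ hx
  have hcl : IsClosed (N ⁻¹' tsupport χ) := (isClosed_tsupport χ).preimage hN
  refine ⟨?_, HasCompactSupport.of_support_subset_isCompact (hNc _ hs hc) hsub,
    (closure_minimal hsub hcl).trans (preimage_mono hs)⟩
  rw [contDiff_iff_contDiffAt]
  intro x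
  by_cases hx : N x ∈ tsupport χ
  · exact hχ.contDiffAt.comp x (hNs.contDiffAt ((hV.preimage hN).mem_nhds (hs hx)))
  · refine (contDiffAt_const (c := (0 : ℝ))).congr_of_eventuallyEq ?_
    filter_upwards [hcl.isOpen_compl.mem_nhds hx] with y hy
    exact image_eq_zero_of_notMem_tsupport hy

end TestFunctions

section WeakDeriv

variable {X F F' : Type} [NormedAddCommGroup X] [NormedSpace ℝ X] [MeasureSpace X]
  [NormedAddCommGroup F] [NormedSpace ℝ F] [NormedAddCommGroup F'] [NormedSpace ℝ F']

lemma HasWeakDirDeriv.congr {Ω : Set X} {v : X} {f g f' g' : X → F}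
    (h : HasWeakDirDeriv Ω v f g) (hΩ : MeasurableSet Ω) (hf : ∀ᵐ x, x ∈ Ω → f x = f' x)
    (hg : ∀ᵐ x, x ∈ Ω → g x = g' x) : HasWeakDirDeriv Ω v f' g' := by
  have hf' := (ae_restrict_iff' hΩ).2 hf
  have hg' := (ae_restrict_iff' hΩ).2 hg
  refine ⟨h.1.congr hf', h.2.1.congr hg', fun φ hφ hc hs => ?_⟩
  rw [← integral_congr_ae (hf'.mono fun x hx => congrArg (fderiv ℝ φ x v • ·) hx),
    ← integral_congr_ae (hg'.mono fun x hx => congrArg (φ x • ·) hx), h.2.2 φ hφ hc hs]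

variable [FiniteDimensional ℝ X] [BorelSpace X]

lemma HasWeakDirDeriv.clm_comp [CompleteSpace F] [CompleteSpace F'] {Ω : Set X} {v : X}
    {f g : X → F}
    (h : HasWeakDirDeriv Ω v f g) (L : F →L[ℝ] F') :
    HasWeakDirDeriv Ω v (fun x => L (f x)) (fun x => L (g x)) := by
  have hloc : ∀ {k : X → F}, LocallyIntegrableOn k Ω volume →
      LocallyIntegrableOn (fun x => L (k x)) Ω volume := fun hk x hx =>
    let ⟨t, ht, hi⟩ := hk x hx
    ⟨t, ht, L.integrable_comp hi⟩
  refine ⟨hloc h.1, hloc h.2.1, fun φ hφ hc hs => ?_⟩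
  have i1 := integrableOn_smul_of_tsupport_subset h.2.1 hφ.continuous hc hs
  have i2 := integrableOn_smul_of_tsupport_subset h.1 (φ := fun x => fderiv ℝ φ x v)
    ((hφ.continuous_fderiv (by simp)).clm_apply continuous_const)
    (hc.fderiv_apply ℝ v) ((tsupport_fderiv_apply_subset ℝ v).trans hs)
  have e := congrArg L (h.2.2 φ hφ hc hs)
  rw [map_neg, ← L.integral_comp_comm i1, ← L.integral_comp_comm i2] at e
  simpa only [map_smul] using e

lemma HasWeakDirDeriv.add {Ω : Set X} {v : X} {f g f' g' : X → F} (h : HasWeakDirDeriv Ω v f g)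
    (h' : HasWeakDirDeriv Ω v f' g') :
    HasWeakDirDeriv Ω v (fun x => f x + f' x) (fun x => g x + g' x) := by
  refine ⟨h.1.add h'.1, h.2.1.add h'.2.1, fun φ hφ hc hs => ?_⟩
  have hfd : ∀ {k : X → F}, LocallyIntegrableOn k Ω volume →
      IntegrableOn (fun x => fderiv ℝ φ x v • k x) Ω volume := fun hk =>
    integrableOn_smul_of_tsupport_subset hk (φ := fun x => fderiv ℝ φ x v)
      ((hφ.continuous_fderiv (by simp)).clm_apply continuous_const)
      (hc.fderiv_apply ℝ v) ((tsupport_fderiv_apply_subset ℝ v).trans hs)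
  simp only [smul_add]
  rw [integral_add (hfd h.1) (hfd h'.1), h.2.2 φ hφ hc hs, h'.2.2 φ hφ hc hs,
    integral_add (integrableOn_smul_of_tsupport_subset h.2.1 hφ.continuous hc hs)
      (integrableOn_smul_of_tsupport_subset h'.2.1 hφ.continuous hc hs), neg_add]

/-- Leibniz rule with a smooth factor. -/
lemma HasWeakDirDeriv.smooth_mul {Ω : Set X} (hΩ : IsOpen Ω) {v : X} {f g p : X → ℝ}
    (h : HasWeakDirDeriv Ω v f g) (hp : ContDiffOn ℝ ∞ p Ω) :
    HasWeakDirDeriv Ω v (fun x => p x * f x) (fun x => p x * g x + fderiv ℝ p x v * f x) := by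
  have hpc : ContinuousOn p Ω := hp.continuousOn
  have hdc : ContinuousOn (fun x => fderiv ℝ p x v) Ω :=
    (hp.continuousOn_fderiv_of_isOpen hΩ (by simp)).clm_apply continuousOn_const
  have l1 : LocallyIntegrableOn (fun x => p x * f x) Ω volume :=
    h.1.continuousOn_mul hpc hΩ.isLocallyClosed
  have l2 : LocallyIntegrableOn (fun x => p x * g x) Ω volume :=
    h.2.1.continuousOn_mul hpc hΩ.isLocallyClosed
  have l3 : LocallyIntegrableOn (fun x => fderiv ℝ p x v * f x) Ω volume :=
    h.1.continuousOn_mul hdc hΩ.isLocallyClosed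
  refine ⟨l1, l2.add l3, fun φ hφ hc hs => ?_⟩
  have hm := contDiff_mul_of_tsupport_subset hΩ hφ hs hp
  obtain ⟨hmc, hms⟩ := hasCompactSupport_mul p hc
  have e := h.2.2 _ hm hmc (hms.trans hs)
  have i1 := integrableOn_smul_of_tsupport_subset l2 hφ.continuous hc hs
  have i2 := integrableOn_smul_of_tsupport_subset l3 hφ.continuous hc hs
  have i3 := integrableOn_smul_of_tsupport_subset l1 (φ := fun x => fderiv ℝ φ x v)
    ((hφ.continuous_fderiv (by simp)).clm_apply continuous_const)
    (hc.fderiv_apply ℝ v) ((tsupport_fderiv_apply_subset ℝ v).trans hs)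
  have hd : ∀ x ∈ Ω, fderiv ℝ (fun x => φ x * p x) x v • f x
      = fderiv ℝ φ x v • (p x * f x) + φ x • (fderiv ℝ p x v * f x) := by
    intro x hx
    have h1 : HasFDerivAt (fun x => φ x * p x) _ x :=
      ((hφ.differentiable (by simp)) x).hasFDerivAt.mul
        ((hp.contDiffAt (hΩ.mem_nhds hx)).differentiableAt (by simp)).hasFDerivAt
    rw [h1.fderiv]
    simp only [add_apply, smul_apply, smul_eq_mul]
    ring
  rw [setIntegral_congr_fun hΩ.measurableSet hd, integral_add i3 i2] at e
  simp only [smul_add]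
  rw [integral_add i1 i2]
  have e2 : ∫ x in Ω, (φ x * p x) • g x = ∫ x in Ω, φ x • (p x * g x) := by
    simp only [smul_eq_mul, mul_assoc]
  rw [e2] at e
  linarith

end WeakDeriv

lemma IsPolar.locallyIntegrableOn_circAvg {A Z : Type} [MeasurableSpace A] [MeasurableSpace Z]
    [TopologicalSpace A] [T2Space A] [LocallyCompactSpace A] [OpensMeasurableSpace A]
    [TopologicalSpace Z]
    {μ : Measure A} [SFinite μ] {ζ : Measure Z} {w : A → ℝ} {Φ : A × ℝ → Z} {N : Z → A}
    {P D : Set A} (hP : IsPolar (μ.restrict P) ζ w Φ N) (hD : IsOpen D) (hDP : D ⊆ P)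
    (hw : ContinuousOn w D) (hw0 : ∀ a ∈ D, 0 < w a)
    (hNc : ∀ K ⊆ D, IsCompact K → IsCompact (N ⁻¹' K)) {h : Z → ℝ}
    (hh : LocallyIntegrableOn h (N ⁻¹' D) ζ) : LocallyIntegrableOn (circAvg Φ h) D μ := by
  rw [locallyIntegrableOn_iff hD.isLocallyClosed]
  intro K hK hKc
  have h1 := (hP.setIntegral_circAvg hKc.measurableSet
    (hh.integrableOn_compact_subset (preimage_mono hK) (hNc K hK hKc))).1
  rw [IntegrableOn, Measure.restrict_restrict_of_subset (hK.trans hDP)] at h1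
  -- On a compact subset of D the weight is continuous and nonvanishing, so it can be divided out.
  have h2 : IntegrableOn (fun a => (w a)⁻¹ * (w a * circAvg Φ h a)) K μ :=
    IntegrableOn.continuousOn_mul ((hw.mono hK).inv₀ fun a ha => (hw0 a (hK ha)).ne') h1 hKc
  refine h2.congr_fun (fun a ha => ?_) hKc.measurableSet
  have := (hw0 a (hK ha)).ne'
  simp only
  field_simp

/-! ### Weak time derivatives of radially symmetric fields -/

lemma contDiffOn_norm_plane : ContDiffOn ℝ ∞ (fun x : Plane => ‖x‖) {x | x ≠ 0} :=
  fun _ hx => (contDiffAt_norm ℝ hx).contDiffWithinAt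

lemma isCompact_preimage_norm {K : Set ℝ} (hK : IsCompact K) :
    IsCompact ((fun x : Plane => ‖x‖) ⁻¹' K) := by
  refine Metric.isCompact_of_isClosed_isBounded (hK.isClosed.preimage continuous_norm) ?_
  obtain ⟨C, hC⟩ := hK.isBounded.bddAbove
  exact (Metric.isBounded_closedBall (x := (0 : Plane)) (r := C)).subset fun x hx =>
    mem_closedBall_zero_iff.2 (hC hx)

lemma isCompact_preimage_time_norm {K : Set (ℝ × ℝ)} (hK : IsCompact K) :
    IsCompact ((fun z : ℝ × Plane => (z.1, ‖z.2‖)) ⁻¹' K) := by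
  refine IsCompact.of_isClosed_subset ((hK.image continuous_fst).prod
    (isCompact_preimage_norm (hK.image continuous_snd)))
    (hK.isClosed.preimage (by fun_prop)) fun z hz => ⟨⟨_, hz, rfl⟩, ⟨_, hz, rfl⟩⟩

/-- The test function is χ(t, |x|), used against the fields multiplied by 1/|x|. That factor cancels
the Jacobian r of polar coordinates, and it commutes with the time derivative because it does not
depend on t. -/
theorem HasWeakDirDeriv.of_radial_time {D : Set (ℝ × ℝ)} (hD : IsOpen D)
    (hpos : ∀ p ∈ D, 0 < p.2) {f : ℝ × ℝ → ℝ} {h : ℝ × Plane → ℝ}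
    (H : HasWeakDirDeriv ((fun z : ℝ × Plane => (z.1, ‖z.2‖)) ⁻¹' D) ((1, 0) : ℝ × Plane)
      (fun z => f (z.1, ‖z.2‖)) h) :
    HasWeakDirDeriv D ((1, 0) : ℝ × ℝ) f (circAvg polarMapTime h) := by
  set N : ℝ × Plane → ℝ × ℝ := fun z => (z.1, ‖z.2‖) with hN
  have hNcont : Continuous N := by fun_prop
  have hΩ : IsOpen (N ⁻¹' D) := hD.preimage hNcont
  have hne : ∀ z ∈ N ⁻¹' D, z.2 ≠ 0 := fun z hz => norm_pos_iff.1 (hpos _ hz)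
  have hDP : D ⊆ univ ×ˢ Ioi 0 := fun p hp => ⟨mem_univ _, hpos p hp⟩
  have hP := isPolar_spaceTime
  have hNs : ContDiffOn ℝ ∞ N (N ⁻¹' D) :=
    contDiffOn_fst.prodMk (contDiffOn_norm_plane.comp contDiffOn_snd fun z hz => hne z hz)
  have hloc : ∀ {k : ℝ × Plane → ℝ}, LocallyIntegrableOn k (N ⁻¹' D) volume →
      LocallyIntegrableOn (circAvg polarMapTime k) D volume := fun hk =>
    hP.locallyIntegrableOn_circAvg hD hDP continuousOn_snd hpos
      (fun K _ hKc => isCompact_preimage_time_norm hKc) hk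
  have hset : ∀ {k : ℝ × Plane → ℝ}, IntegrableOn k (N ⁻¹' D) volume →
      ∫ p in D, p.2 * circAvg polarMapTime k p = (2 * Real.pi)⁻¹ * ∫ z in N ⁻¹' D, k z := by
    intro k hk
    have := (hP.setIntegral_circAvg hD.measurableSet hk).2
    rwa [Measure.restrict_restrict_of_subset hDP] at this
  have hpinv : ContDiffOn ℝ ∞ (fun z : ℝ × Plane => ‖z.2‖⁻¹) (N ⁻¹' D) :=
    ContDiffOn.inv (contDiffOn_norm_plane.comp contDiffOn_snd fun z hz => hne z hz)
      fun z hz => norm_ne_zero_iff.2 (hne z hz)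
  have H2 := H.smooth_mul hΩ hpinv
  have hd0 : ∀ z ∈ N ⁻¹' D, fderiv ℝ (fun z : ℝ × Plane => ‖z.2‖⁻¹) z (1, 0) = 0 := by
    intro z hz
    have hdiff : DifferentiableAt ℝ (fun z : ℝ × Plane => ‖z.2‖⁻¹) z :=
      (hpinv.contDiffAt (hΩ.mem_nhds hz)).differentiableAt (by simp)
    rw [← hdiff.lineDeriv_eq_fderiv]
    simp [lineDeriv]
  refine ⟨(hloc H.1).congr ?_, hloc H.2.1, fun χ hχ hc hs => ?_⟩
  · filter_upwards [ae_restrict_mem hD.measurableSet] with p hp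
    exact hP.circAvg_comp (hpos p hp) f
  · obtain ⟨h1, h2, h3⟩ := testFunction_comp hD hNcont hNs
      (fun K _ hKc => isCompact_preimage_time_norm hKc) hχ hc hs
    have e := H2.2.2 _ h1 h2 h3
    have i1 := integrableOn_smul_of_tsupport_subset H2.1
      (φ := fun z => fderiv ℝ (fun z => χ (N z)) z (1, 0))
      ((h1.continuous_fderiv (by simp)).clm_apply continuous_const)
      (h2.fderiv_apply ℝ _) ((tsupport_fderiv_apply_subset ℝ _).trans h3)
    have i2 := integrableOn_smul_of_tsupport_subset H2.2.1 h1.continuous h2 h3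
    have hfd : ∀ z ∈ N ⁻¹' D, fderiv ℝ (fun z => χ (N z)) z (1, 0) • (‖z.2‖⁻¹ * f (N z))
        = (fun p : ℝ × ℝ => fderiv ℝ χ p (1, 0) * (p.2⁻¹ * f p)) (N z) := by
      intro z hz
      have hd1 : DifferentiableAt ℝ (fun z => χ (N z)) z := (h1.differentiable (by simp)) z
      have hd2 : DifferentiableAt ℝ χ (N z) := (hχ.differentiable (by simp)) _
      rw [← hd1.lineDeriv_eq_fderiv, smul_eq_mul]
      simp only
      rw [← hd2.lineDeriv_eq_fderiv]
      simp [lineDeriv, hN]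
    have hfd2 : ∀ z ∈ N ⁻¹' D, χ (N z) • (‖z.2‖⁻¹ * h z +
        fderiv ℝ (fun z : ℝ × Plane => ‖z.2‖⁻¹) z (1, 0) * f (N z))
        = (fun p : ℝ × ℝ => χ p * p.2⁻¹) (N z) * h z := by
      intro z hz
      rw [hd0 z hz, smul_eq_mul]
      simp only [hN]
      ring
    rw [setIntegral_congr_fun hΩ.measurableSet hfd, setIntegral_congr_fun hΩ.measurableSet hfd2] at e
    have j1 := hset (i1.congr_fun hfd hΩ.measurableSet)
    have j2 := hset (i2.congr_fun hfd2 hΩ.measurableSet)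
    have k1 : ∫ p in D, p.2 * circAvg polarMapTime
        (fun z => (fun p : ℝ × ℝ => fderiv ℝ χ p (1, 0) * (p.2⁻¹ * f p)) (N z)) p
        = ∫ p in D, fderiv ℝ χ p (1, 0) • f p := by
      refine setIntegral_congr_fun hD.measurableSet fun p hp => ?_
      have := (hpos p hp).ne'
      refine (congrArg (p.2 * ·) (hP.circAvg_comp (hpos p hp)
        (fun p : ℝ × ℝ => fderiv ℝ χ p (1, 0) * (p.2⁻¹ * f p)))).trans ?_
      simp only [smul_eq_mul]
      field_simp
    have k2 : ∫ p in D, p.2 * circAvg polarMapTime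
        (fun z => (fun p : ℝ × ℝ => χ p * p.2⁻¹) (N z) * h z) p
        = ∫ p in D, χ p • circAvg polarMapTime h p := by
      refine setIntegral_congr_fun hD.measurableSet fun p hp => ?_
      have := (hpos p hp).ne'
      refine (congrArg (p.2 * ·) (hP.circAvg_comp_mul (hpos p hp)
        (fun p : ℝ × ℝ => χ p * p.2⁻¹) h)).trans ?_
      simp only [smul_eq_mul]
      field_simp
    rw [k1] at j1
    rw [k2] at j2
    rw [j1, j2, e]
    ring

/-! ### Weak spatial derivatives of radially symmetric fields -/

/-- The coordinate directions of the plane. -/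
noncomputable def planeBasis (j : Fin 2) : Plane := EuclideanSpace.single j 1

lemma fderiv_norm_planeBasis {x : Plane} (hx : x ≠ 0) (j : Fin 2) :
    fderiv ℝ (fun y : Plane => ‖y‖) x (planeBasis j) = x j / ‖x‖ := by
  have hd : DifferentiableAt ℝ (fun y : Plane => ‖y‖) x :=
    (contDiffAt_norm ℝ hx (n := 1)).differentiableAt (by simp)
  have h1 : HasFDerivAt (fun y : Plane => ‖y‖ ^ 2) _ x := hd.hasFDerivAt.pow 2
  have h2 := (hasStrictFDerivAt_norm_sq x).hasFDerivAt.unique h1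
  have h3 := congrArg (fun L => L (planeBasis j)) h2
  have hn : ‖x‖ ≠ 0 := norm_ne_zero_iff.2 hx
  simp [planeBasis, EuclideanSpace.inner_single_right] at h3
  rw [eq_div_iff hn]
  simp only [planeBasis]
  linarith

lemma contDiff_coord (i : Fin 2) : ContDiff ℝ ∞ (fun y : Plane => y i) :=
  (EuclideanSpace.proj i : Plane →L[ℝ] ℝ).contDiff

/-- If the vector field `W` has the weak divergence `Z 0 + Z 1` in a punctured disk, then its
mean radial component `w` satisfies `(r w)' = r (Z 0 + Z 1)` for the circular averages. -/
theorem HasWeakDirDeriv.of_divergence {a : ℝ} {W Z : Fin 2 → Plane → ℝ} {w : Plane → ℝ}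
    (H : ∀ j, HasWeakDirDeriv ((fun x : Plane => ‖x‖) ⁻¹' Ioo 0 a) (planeBasis j) (W j) (Z j))
    (hw : ∀ x, 0 < ‖x‖ → w x = x 0 / ‖x‖ * W 0 x + x 1 / ‖x‖ * W 1 x) :
    HasWeakDirDeriv (Ioo 0 a) (1 : ℝ) (fun r => r * circAvg polarMap w r)
      (fun r => r * circAvg polarMap (fun x => Z 0 x + Z 1 x) r) := by
  set N : Plane → ℝ := fun x => ‖x‖ with hN
  have hD : IsOpen (Ioo 0 a) := isOpen_Ioo
  have hNcont : Continuous N := continuous_norm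
  have hΩ : IsOpen (N ⁻¹' Ioo 0 a) := hD.preimage hNcont
  have hne : ∀ x ∈ N ⁻¹' Ioo 0 a, x ≠ 0 := fun x hx => norm_pos_iff.1 hx.1
  have hpos : ∀ r ∈ Ioo 0 a, 0 < id r := fun r hr => hr.1
  have hDP : Ioo 0 a ⊆ Ioi 0 := fun p hp => hp.1
  have hP := isPolar_plane
  have hNs : ContDiffOn ℝ ∞ N (N ⁻¹' Ioo 0 a) := contDiffOn_norm_plane.mono hne
  have hlocr : ∀ {k : Plane → ℝ}, LocallyIntegrableOn k (N ⁻¹' Ioo 0 a) volume →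
      LocallyIntegrableOn (fun r => r * circAvg polarMap k r) (Ioo 0 a) volume := fun hk =>
    (hP.locallyIntegrableOn_circAvg hD hDP continuousOn_id hpos
      (fun K _ hKc => isCompact_preimage_norm hKc) hk).continuousOn_mul continuousOn_id
      hD.isLocallyClosed
  have hset : ∀ {k : Plane → ℝ}, IntegrableOn k (N ⁻¹' Ioo 0 a) volume →
      ∫ r in Ioo 0 a, r * circAvg polarMap k r = (2 * Real.pi)⁻¹ * ∫ x in N ⁻¹' Ioo 0 a, k x := by
    intro k hk
    have := (hP.setIntegral_circAvg hD.measurableSet hk).2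
    rwa [Measure.restrict_restrict_of_subset hDP] at this
  have hcoef : ∀ j, ContinuousOn (fun x : Plane => x j / ‖x‖) (N ⁻¹' Ioo 0 a) := fun j =>
    ((contDiff_coord j).continuous.continuousOn).div continuous_norm.continuousOn
      fun x hx => norm_ne_zero_iff.2 (hne x hx)
  have hwloc : LocallyIntegrableOn w (N ⁻¹' Ioo 0 a) volume := by
    refine (((H 0).1.continuousOn_mul (hcoef 0) hΩ.isLocallyClosed).add
      ((H 1).1.continuousOn_mul (hcoef 1) hΩ.isLocallyClosed)).congr ?_
    filter_upwards [ae_restrict_mem hΩ.measurableSet] with x hx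
    exact (hw x hx.1).symm
  have hZloc : LocallyIntegrableOn (fun x => Z 0 x + Z 1 x) (N ⁻¹' Ioo 0 a) volume :=
    (H 0).2.1.add (H 1).2.1
  refine ⟨hlocr hwloc, hlocr hZloc, fun χ hχ hc hs => ?_⟩
  obtain ⟨h1, h2, h3⟩ := testFunction_comp hD hNcont hNs
    (fun K _ hKc => isCompact_preimage_norm hKc) hχ hc hs
  have hfdi : ∀ j, IntegrableOn (fun x => fderiv ℝ (fun x => χ (N x)) x (planeBasis j) • W j x)
      (N ⁻¹' Ioo 0 a) volume := fun j =>
    integrableOn_smul_of_tsupport_subset (H j).1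
      (φ := fun x => fderiv ℝ (fun x => χ (N x)) x (planeBasis j))
      ((h1.continuous_fderiv (by simp)).clm_apply continuous_const)
      (h2.fderiv_apply ℝ _) ((tsupport_fderiv_apply_subset ℝ _).trans h3)
  have hZi : ∀ j, IntegrableOn (fun x => χ (N x) • Z j x) (N ⁻¹' Ioo 0 a) volume := fun j =>
    integrableOn_smul_of_tsupport_subset (H j).2.1 h1.continuous h2 h3
  have hfd : ∀ x ∈ N ⁻¹' Ioo 0 a, ∀ j, fderiv ℝ (fun x => χ (N x)) x (planeBasis j)
      = deriv χ (N x) * (x j / ‖x‖) := by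
    intro x hx j
    have hd1 : HasFDerivAt N _ x :=
      ((hNs.contDiffAt (hΩ.mem_nhds hx)).differentiableAt (by simp)).hasFDerivAt
    have hd2 : HasFDerivAt χ _ (N x) := ((hχ.differentiable (by simp)) (N x)).hasFDerivAt
    have hd3 : HasFDerivAt (fun x => χ (N x)) _ x := hd2.comp x hd1
    rw [hd3.fderiv]
    simp only [ContinuousLinearMap.comp_apply, hN]
    rw [fderiv_norm_planeBasis (hne x hx) j]
    simp [mul_comm]
  -- The gradient of χ(|x|) is χ'(|x|) x/|x|, so summing the two coordinate identities leaves only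
  -- the radial component w.
  have e0 := (H 0).2.2 _ h1 h2 h3
  have e1 := (H 1).2.2 _ h1 h2 h3
  have hsum : ∀ x ∈ N ⁻¹' Ioo 0 a, fderiv ℝ (fun x => χ (N x)) x (planeBasis 0) • W 0 x
      + fderiv ℝ (fun x => χ (N x)) x (planeBasis 1) • W 1 x = deriv χ (N x) * w x := by
    intro x hx
    rw [hfd x hx 0, hfd x hx 1, hw x hx.1]
    simp only [smul_eq_mul]
    ring
  have hsumZ : ∀ x ∈ N ⁻¹' Ioo 0 a, χ (N x) • Z 0 x + χ (N x) • Z 1 x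
      = χ (N x) * (Z 0 x + Z 1 x) := fun x _ => by simp only [smul_eq_mul]; ring
  have e : ∫ x in N ⁻¹' Ioo 0 a, deriv χ (N x) * w x
      = - ∫ x in N ⁻¹' Ioo 0 a, χ (N x) * (Z 0 x + Z 1 x) := by
    rw [← setIntegral_congr_fun hΩ.measurableSet hsum,
      ← setIntegral_congr_fun hΩ.measurableSet hsumZ, integral_add (hfdi 0) (hfdi 1),
      integral_add (hZi 0) (hZi 1), e0, e1]
    ring
  have j1 := hset (((hfdi 0).add (hfdi 1)).congr_fun hsum hΩ.measurableSet)
  have j2 := hset (((hZi 0).add (hZi 1)).congr_fun hsumZ hΩ.measurableSet)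
  have k1 : ∫ r in Ioo 0 a, r * circAvg polarMap (fun x => deriv χ (N x) * w x) r
      = ∫ r in Ioo 0 a, fderiv ℝ χ r 1 • (r * circAvg polarMap w r) := by
    refine setIntegral_congr_fun measurableSet_Ioo fun r hr => ?_
    refine (congrArg (r * ·) (hP.circAvg_comp_mul (hpos r hr) (deriv χ) w)).trans ?_
    rw [fderiv_apply_one, smul_eq_mul]
    ring
  have k2 : ∫ r in Ioo 0 a, r * circAvg polarMap (fun x => χ (N x) * (Z 0 x + Z 1 x)) r
      = ∫ r in Ioo 0 a, χ r • (r * circAvg polarMap (fun x => Z 0 x + Z 1 x) r) := by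
    refine setIntegral_congr_fun measurableSet_Ioo fun r hr => ?_
    refine (congrArg (r * ·) (hP.circAvg_comp_mul (hpos r hr) χ _)).trans ?_
    rw [smul_eq_mul]
    ring
  rw [k1] at j1
  rw [k2] at j2
  rw [j1, j2, e]
  ring

lemma preimage_norm_Ioo_subset_ball (a : ℝ) :
    (fun x : Plane => ‖x‖) ⁻¹' Ioo 0 a ⊆ Metric.ball 0 a :=
  fun _ hx => mem_ball_zero_iff.2 hx.2

/-- The trace of the gradient of a plane vector field. -/
noncomputable def traceCLM : (Plane →L[ℝ] Plane) →L[ℝ] ℝ :=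
  ((EuclideanSpace.proj 0 : Plane →L[ℝ] ℝ).comp
    (ContinuousLinearMap.apply ℝ Plane (planeBasis 0))) +
  ((EuclideanSpace.proj 1 : Plane →L[ℝ] ℝ).comp
    (ContinuousLinearMap.apply ℝ Plane (planeBasis 1)))

lemma traceCLM_apply (L : Plane →L[ℝ] Plane) :
    traceCLM L = L (planeBasis 0) 0 + L (planeBasis 1) 1 := by
  simp [traceCLM]

lemma circAvg_radial (f : ℝ → ℝ) {r : ℝ} (hr : 0 < r) :
    circAvg polarMap (fun x => f ‖x‖) r = f r := isPolar_plane.circAvg_comp (w := id) hr f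

/-- The divergence of a radial vector field. -/
theorem HasWeakGrad.radialField {a : ℝ} {f : ℝ → ℝ} {G : Plane → Plane →L[ℝ] Plane}
    (h : HasWeakGrad (Metric.ball 0 a) (radialField f) G) :
    HasWeakDirDeriv (Ioo 0 a) (1 : ℝ) (fun r => f r)
      (fun r => circAvg polarMap (fun x => traceCLM (G x)) r - f r / r) := by
  have H : ∀ j : Fin 2, HasWeakDirDeriv ((fun x : Plane => ‖x‖) ⁻¹' Ioo 0 a) (planeBasis j)
      (fun x => RadialMHD.radialField f x j) (fun x => G x (planeBasis j) j) := fun j =>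
    ((h (planeBasis j)).mono (preimage_norm_Ioo_subset_ball a)).clm_comp
      (EuclideanSpace.proj j : Plane →L[ℝ] ℝ)
  -- The radial component of the field is f(|x|), which gives (r f)' = r times the averaged
  -- divergence. The smooth factor 1/r then turns this into the formula for f'.
  have h1 := HasWeakDirDeriv.of_divergence (w := fun x => f ‖x‖) H (by
    intro x hx
    have := plane_norm_sq x
    simp only [RadialMHD.radialField, PiLp.smul_apply, smul_eq_mul]
    field_simp
    rw [this])
  have h2 : HasWeakDirDeriv (Ioo 0 a) (1 : ℝ) (fun r => r * f r)
      (fun r => r * circAvg polarMap (fun x => traceCLM (G x)) r) := by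
    refine h1.congr measurableSet_Ioo (Eventually.of_forall fun r hr => ?_)
      (Eventually.of_forall fun r hr => ?_)
    · exact congrArg (r * ·) (circAvg_radial f hr.1)
    · simp only [traceCLM_apply]
  have h3 := h2.smooth_mul isOpen_Ioo (p := fun r : ℝ => r⁻¹)
    (contDiffOn_id.inv fun r hr => hr.1.ne')
  refine h3.congr measurableSet_Ioo (Eventually.of_forall fun r hr => ?_)
      (Eventually.of_forall fun r hr => ?_)
  · have := hr.1.ne'
    field_simp
  · have := hr.1.ne'
    simp only [fderiv_apply_one]
    rw [deriv_inv]
    field_simp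
    ring

/-- The radial derivative of the circular averages of a scalar field. -/
theorem HasWeakGrad.circAvg {a : ℝ} {h : Plane → ℝ} {G : Plane → Plane →L[ℝ] ℝ}
    (hG : HasWeakGrad (Metric.ball 0 a) h G) :
    HasWeakDirDeriv (Ioo 0 a) (1 : ℝ) (circAvg polarMap h)
      (circAvg polarMap (fun x => ‖x‖⁻¹ * G x x)) := by
  set Ω : Set Plane := (fun x : Plane => ‖x‖) ⁻¹' Ioo 0 a with hΩdef
  have hΩ : IsOpen Ω := isOpen_Ioo.preimage continuous_norm
  have hne : ∀ x ∈ Ω, x ≠ 0 := fun x hx => norm_pos_iff.1 hx.1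
  -- The divergence lemma is applied to the field h x/|x|². Its radial component is h/|x|, which
  -- cancels the factor r; and since x/|x|² is divergence free away from the origin, its divergence
  -- is just ∇h · x/|x|².
  have hp : ∀ j : Fin 2, ContDiffOn ℝ ∞ (fun x : Plane => x j * (‖x‖ ^ 2)⁻¹) Ω := fun j =>
    (contDiff_coord j).contDiffOn.mul (ContDiffOn.inv (contDiff_norm_sq ℝ).contDiffOn
      fun x hx => pow_ne_zero 2 (norm_ne_zero_iff.2 (hne x hx)))
  have hfd : ∀ x ∈ Ω, ∀ j : Fin 2, fderiv ℝ (fun x : Plane => x j * (‖x‖ ^ 2)⁻¹) x (planeBasis j)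
      = (‖x‖ ^ 2)⁻¹ - 2 * x j ^ 2 * (‖x‖ ^ 4)⁻¹ := by
    intro x hx j
    have hn : ‖x‖ ≠ 0 := norm_ne_zero_iff.2 (hne x hx)
    have d1 : HasFDerivAt (fun y : Plane => y j) (EuclideanSpace.proj j : Plane →L[ℝ] ℝ) x :=
      (EuclideanSpace.proj j : Plane →L[ℝ] ℝ).hasFDerivAt
    have d2 : HasFDerivAt (fun y : Plane => ‖y‖ ^ 2) _ x :=
      (hasStrictFDerivAt_norm_sq x).hasFDerivAt
    have d3 : HasFDerivAt (fun y : Plane => (‖y‖ ^ 2)⁻¹) _ x :=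
      (hasDerivAt_inv (pow_ne_zero 2 hn)).comp_hasFDerivAt x d2
    have d4 : HasFDerivAt (fun y : Plane => y j * (‖y‖ ^ 2)⁻¹) _ x := d1.mul d3
    rw [d4.fderiv]
    simp [planeBasis, EuclideanSpace.inner_single_right]
    field_simp
    ring
  have H : ∀ j : Fin 2, HasWeakDirDeriv Ω (planeBasis j) (fun x => x j * (‖x‖ ^ 2)⁻¹ * h x)
      (fun x => x j * (‖x‖ ^ 2)⁻¹ * G x (planeBasis j)
        + fderiv ℝ (fun x : Plane => x j * (‖x‖ ^ 2)⁻¹) x (planeBasis j) * h x) := fun j =>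
    ((hG (planeBasis j)).mono (preimage_norm_Ioo_subset_ball a)).smooth_mul hΩ (hp j)
  have h1 := HasWeakDirDeriv.of_divergence (w := fun x => ‖x‖⁻¹ * h x) H (by
    intro x hx
    have := plane_norm_sq x
    field_simp
    rw [this]
    ring)
  have hP := isPolar_plane
  refine h1.congr measurableSet_Ioo (Eventually.of_forall fun r hr => ?_)
    (Eventually.of_forall fun r hr => ?_)
  · refine (congrArg (r * ·) (hP.circAvg_comp_mul (w := id) hr.1 (fun s => s⁻¹) h)).trans ?_
    have := hr.1.ne'
    field_simp
  · simp only
    rw [← hP.circAvg_comp_mul (w := id) hr.1 (fun s => s)]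
    simp only [RadialMHD.circAvg]
    congr 1
    refine integral_congr_ae (Eventually.of_forall fun θ => ?_)
    have hx : polarMap (r, θ) ∈ Ω := by
      simp only [hΩdef, mem_preimage, norm_polarMap, abs_of_pos hr.1]
      exact hr
    simp only
    rw [hfd _ hx 0, hfd _ hx 1]
    generalize polarMap (r, θ) = x at hx
    have hn : ‖x‖ ≠ 0 := norm_ne_zero_iff.2 (hne x hx)
    have hxG : G x x = x 0 * G x (planeBasis 0) + x 1 * G x (planeBasis 1) := by
      have : x = x 0 • planeBasis 0 + x 1 • planeBasis 1 := by
        ext i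
        fin_cases i <;> simp [planeBasis]
      conv_lhs => rw [this]
      rw [map_add, map_smul, map_smul, ← this]
      simp
    rw [hxG]
    have := plane_norm_sq x
    field_simp
    rw [this]
    ring

/-! ### Integrability with the weight `1 / |x|` -/

/-- In polar coordinates the integrand becomes y^(1-s), integrable at the origin exactly because s <
2. -/
lemma lintegral_norm_rpow_ball_lt_top {s : ℝ} (hs : s < 2) (A : ℝ) :
    ∫⁻ x in Metric.ball (0 : Plane) A, ENNReal.ofReal (‖x‖ ^ (-s)) < ⊤ := by
  have h1 : Integrable (fun x : Plane => (Iio A).indicator (fun y => y ^ (-s)) ‖x‖) volume := by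
    rw [integrable_fun_norm_addHaar volume (f := (Iio A).indicator fun y => y ^ (-s))]
    have hdim : Module.finrank ℝ Plane - 1 = 1 := by simp
    rw [hdim]
    have h2 : IntegrableOn (fun y : ℝ => y ^ (1 - s)) (Ioo 0 (max A 0)) := by
      rw [← intervalIntegrable_iff_integrableOn_Ioo_of_le (le_max_right _ _)]
      exact intervalIntegral.intervalIntegrable_rpow' (by linarith)
    have h3 : IntegrableOn (fun y : ℝ => (Iio A).indicator (fun y => y ^ (1 - s)) y) (Ioi 0) := by
      rw [integrableOn_indicator_iff measurableSet_Iio]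
      refine h2.mono_set fun y hy => ⟨hy.2, lt_of_lt_of_le hy.1 (le_max_left _ _)⟩
    refine h3.congr_fun (fun y hy => ?_) measurableSet_Ioi
    by_cases hyA : y ∈ Iio A
    · simp only [indicator_of_mem hyA, smul_eq_mul, pow_one]
      rw [sub_eq_add_neg, Real.rpow_add hy, Real.rpow_one]
    · simp [indicator_of_notMem hyA]
  have h2 := h1.integrableOn (s := Metric.ball (0 : Plane) A)
  have h3 : IntegrableOn (fun x : Plane => ‖x‖ ^ (-s)) (Metric.ball (0 : Plane) A) := by
    refine h2.congr_fun (fun x hx => ?_) measurableSet_ball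
    exact indicator_of_mem (show ‖x‖ ∈ Iio A from mem_ball_zero_iff.1 hx) _
  exact (hasFiniteIntegral_iff_ofReal (Eventually.of_forall fun x => by positivity)).1
    h3.hasFiniteIntegral

/-- Hölder's inequality for the weight `1 / |x|`. -/
lemma exists_lintegral_norm_inv_mul_le {F : Type} [NormedAddCommGroup F] {q : ℝ} (hq : 2 < q)
    (A : ℝ) : ∃ C : ℝ≥0∞, C < ⊤ ∧ ∀ a ≤ A, ∀ g : Plane → F,
      AEStronglyMeasurable g (volume.restrict (Metric.ball 0 a)) →
      ∫⁻ x in Metric.ball (0 : Plane) a, ENNReal.ofReal (‖x‖⁻¹) * ‖g x‖ₑ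
        ≤ C * eLpNorm g (ENNReal.ofReal q) (volume.restrict (Metric.ball 0 a)) := by
  have hq0 : 0 < q := by linarith
  -- The exponent dual to q. It is below 2 precisely because q > 2, which makes |x|⁻¹ an L^s
  -- function on disks.
  set s := q / (q - 1) with hs
  have hconj : s.HolderConjugate q := (Real.HolderConjugate.conjExponent (by linarith)).symm
  have hs0 : 0 < s := hconj.pos
  have hs2 : s < 2 := by
    rw [hs, div_lt_iff₀ (by linarith)]
    linarith
  have hfin := lintegral_norm_rpow_ball_lt_top hs2 A
  refine ⟨(∫⁻ x in Metric.ball (0 : Plane) A, ENNReal.ofReal (‖x‖ ^ (-s))) ^ (1 / s),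
    ENNReal.rpow_lt_top_of_nonneg (by positivity) hfin.ne, fun a ha g hg => ?_⟩
  have hm : AEMeasurable (fun x : Plane => ENNReal.ofReal (‖x‖⁻¹))
      (volume.restrict (Metric.ball 0 a)) := by fun_prop
  refine (ENNReal.lintegral_mul_le_Lp_mul_Lq _ hconj hm hg.enorm).trans ?_
  have hqt : (ENNReal.ofReal q).toReal = q := ENNReal.toReal_ofReal hq0.le
  rw [eLpNorm_eq_lintegral_rpow_enorm_toReal (by simpa using hq0) ENNReal.ofReal_ne_top, hqt]
  gcongr ?_ * _
  refine ENNReal.rpow_le_rpow ?_ (by positivity)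
  refine (lintegral_mono fun x => ?_).trans
    (lintegral_mono_set (Metric.ball_subset_ball ha))
  rw [ENNReal.ofReal_rpow_of_nonneg (by positivity) hs0.le, Real.rpow_neg (norm_nonneg _),
    Real.inv_rpow (norm_nonneg _)]

/-- By the triangle inequality for the extensions by zero, the norm is bounded near each time;
compactness of [0, T] makes the bound uniform. -/
lemma exists_forall_eLpNorm_le_of_inCLp {F : Type} [NormedAddCommGroup F] [NormedSpace ℝ F]
    {a : ℝ → ℝ} {T : ℝ} {p : ℝ≥0∞} (hp : 1 ≤ p) {f : ℝ → Plane → F} (hf : InCLp a T p f) :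
    ∃ M : ℝ≥0∞, M < ⊤ ∧ ∀ t ∈ Icc 0 T,
      eLpNorm (f t) p (volume.restrict (fluidDomain a t)) ≤ M := by
  have hmeas : ∀ t, MeasurableSet (fluidDomain a t) := fun t => measurableSet_ball
  have hml : ∀ t ∈ Icc 0 T, MemLp ((fluidDomain a t).indicator (f t)) p volume := fun t ht =>
    (memLp_indicator_iff_restrict (hmeas t)).2 (hf.1 t ht)
  refine isCompact_Icc.induction_on (p := fun S => ∃ M : ℝ≥0∞, M < ⊤ ∧ ∀ t ∈ S,
      eLpNorm (f t) p (volume.restrict (fluidDomain a t)) ≤ M) ⟨0, by simp, by simp⟩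
    (fun S S' h ⟨M, hM, hM'⟩ => ⟨M, hM, fun t ht => hM' t (h ht)⟩)
    (fun S S' ⟨M, hM, hM'⟩ ⟨N, hN, hN'⟩ => ⟨max M N, max_lt hM hN, fun t ht => ?_⟩)
    fun s hs => ?_
  · rcases ht with ht | ht
    · exact (hM' t ht).trans (le_max_left _ _)
    · exact (hN' t ht).trans (le_max_right _ _)
  · have h1 := (hf.2 s hs).eventually (gt_mem_nhds (show (0 : ℝ≥0∞) < 1 by simp))
    refine ⟨{t | t ∈ Icc 0 T ∧ eLpNorm ((fluidDomain a t).indicator (f t)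
      - (fluidDomain a s).indicator (f s)) p volume < 1}, ?_, 1 + eLpNorm
        ((fluidDomain a s).indicator (f s)) p volume, ENNReal.add_lt_top.2
          ⟨by simp, (hml s hs).2⟩, ?_⟩
    · filter_upwards [h1, self_mem_nhdsWithin] with t ht ht' using ⟨ht', ht⟩
    · rintro t ⟨ht, ht'⟩
      rw [← eLpNorm_indicator_eq_eLpNorm_restrict (hmeas t)]
      calc eLpNorm ((fluidDomain a t).indicator (f t)) p volume
          = eLpNorm (((fluidDomain a t).indicator (f t) - (fluidDomain a s).indicator (f s))
            + (fluidDomain a s).indicator (f s)) p volume := by rw [sub_add_cancel]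
        _ ≤ _ := eLpNorm_add_le ((hml t ht).1.sub (hml s hs).1) (hml s hs).1 hp
        _ ≤ _ := by gcongr

/-! ### Measure and integration on the moving space-time domain -/

lemma isOpen_spaceTime {a : ℝ → ℝ} {T : ℝ} (ha : ContinuousOn a (Ioo 0 T)) :
    IsOpen (spaceTime a T) := by
  have h1 : IsOpen ((Ioo 0 T) ×ˢ (univ : Set Plane)) := isOpen_Ioo.prod isOpen_univ
  have h2 : ContinuousOn (fun z : ℝ × Plane => a z.1 - ‖z.2‖) ((Ioo 0 T) ×ˢ univ) :=
    (ha.comp continuousOn_fst fun z hz => hz.1).sub (by fun_prop)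
  convert h2.isOpen_inter_preimage h1 isOpen_Ioi (t := Ioi 0) using 1
  ext z
  simp [spaceTime, fluidDomain]

lemma isOpen_radialSpaceTime {a : ℝ → ℝ} {T : ℝ} (ha : ContinuousOn a (Ioo 0 T)) :
    IsOpen (radialSpaceTime a T) := by
  have h1 : IsOpen ((Ioo 0 T) ×ˢ (Ioi (0 : ℝ))) := isOpen_Ioo.prod isOpen_Ioi
  have h2 : ContinuousOn (fun z : ℝ × ℝ => a z.1 - z.2) ((Ioo 0 T) ×ˢ Ioi 0) :=
    (ha.comp continuousOn_fst fun z hz => hz.1).sub (by fun_prop)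
  convert h2.isOpen_inter_preimage h1 isOpen_Ioi (t := Ioi 0) using 1
  ext z
  simp [radialSpaceTime]
  tauto

lemma lintegral_spaceTime {a : ℝ → ℝ} {T : ℝ} (ha : ContinuousOn a (Ioo 0 T))
    {k : ℝ × Plane → ℝ≥0∞} (hk : AEMeasurable k (volume.restrict (spaceTime a T))) :
    ∫⁻ z in spaceTime a T, k z = ∫⁻ t in Ioo 0 T, ∫⁻ x in fluidDomain a t, k (t, x) := by
  have hS := (isOpen_spaceTime ha).measurableSet
  rw [← lintegral_indicator hS, Measure.volume_eq_prod, lintegral_prod, ← lintegral_indicator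
    measurableSet_Ioo]
  · refine lintegral_congr fun t => ?_
    by_cases ht : t ∈ Ioo 0 T
    · rw [indicator_of_mem ht, ← lintegral_indicator (show MeasurableSet (fluidDomain a t) from
        measurableSet_ball)]
      refine lintegral_congr fun x => ?_
      by_cases hx : x ∈ fluidDomain a t
      · rw [indicator_of_mem hx, indicator_of_mem (show (t, x) ∈ spaceTime a T from ⟨ht, hx⟩)]
      · rw [indicator_of_notMem hx, indicator_of_notMem fun h => hx h.2]
    · rw [indicator_of_notMem ht]
      simp_rw [indicator_of_notMem (show (t, _) ∉ spaceTime a T from fun h => ht h.1)]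
      simp
  · exact (aemeasurable_indicator_iff hS).2 hk

lemma ae_aestronglyMeasurable_slice {F : Type} [NormedAddCommGroup F] {a : ℝ → ℝ} {T : ℝ}
    (ha : ContinuousOn a (Ioo 0 T)) {g : ℝ → Plane → F}
    (hg : AEStronglyMeasurable (fun z : ℝ × Plane => g z.1 z.2)
      (volume.restrict (spaceTime a T))) :
    ∀ᵐ t, t ∈ Ioo 0 T → AEStronglyMeasurable (g t) (volume.restrict (fluidDomain a t)) := by
  have hS := (isOpen_spaceTime ha).measurableSet
  have h1 := (aestronglyMeasurable_indicator_iff hS).2 hg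
  rw [Measure.volume_eq_prod] at h1
  filter_upwards [h1.prodMk_left] with t ht htT
  rw [← aestronglyMeasurable_indicator_iff (show MeasurableSet (fluidDomain a t) from
    measurableSet_ball)]
  refine AEStronglyMeasurable.congr ht (Eventually.of_forall fun x => ?_)
  simp only
  symm
  by_cases hx : x ∈ fluidDomain a t
  · rw [indicator_of_mem hx, indicator_of_mem (show (t, x) ∈ spaceTime a T from ⟨htT, hx⟩)]
  · rw [indicator_of_notMem hx, indicator_of_notMem fun h => hx h.2]

/-- Hölder's inequality on each slice, with a constant uniform in time since the radii are bounded.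
The weight 1/|x| upgrades integrability for r dr dt to integrability for dr dt, which is needed down
to the center. -/
lemma integrableOn_norm_inv_mul {F : Type} [NormedAddCommGroup F] {a : ℝ → ℝ} {T A q : ℝ}
    (hq : 2 < q) (ha : ContinuousOn a (Ioo 0 T)) (hA : ∀ t ∈ Ioo 0 T, a t ≤ A)
    {g : ℝ → Plane → F}
    (hg : AEStronglyMeasurable (fun z : ℝ × Plane => g z.1 z.2)
      (volume.restrict (spaceTime a T)))
    (hfin : ∫⁻ t in Ioo 0 T, eLpNorm (g t) (ENNReal.ofReal q)
      (volume.restrict (fluidDomain a t)) < ⊤) :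
    IntegrableOn (fun z : ℝ × Plane => ‖z.2‖⁻¹ * ‖g z.1 z.2‖) (spaceTime a T) := by
  obtain ⟨C, hC, hCle⟩ := exists_lintegral_norm_inv_mul_le (F := F) hq A
  have hmi : AEStronglyMeasurable (fun z : ℝ × Plane => ‖z.2‖⁻¹)
      (volume.restrict (spaceTime a T)) := by
    exact Measurable.aestronglyMeasurable (by fun_prop)
  refine ⟨hmi.mul hg.norm, ?_⟩
  rw [hasFiniteIntegral_iff_ofReal (Eventually.of_forall fun z => by positivity)]
  have he : ∀ z : ℝ × Plane, ENNReal.ofReal (‖z.2‖⁻¹ * ‖g z.1 z.2‖)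
      = ENNReal.ofReal (‖z.2‖⁻¹) * ‖g z.1 z.2‖ₑ := fun z => by
    rw [ENNReal.ofReal_mul (by positivity), ofReal_norm]
  simp only [he]
  rw [lintegral_spaceTime ha (by fun_prop)]
  calc _ ≤ ∫⁻ t in Ioo 0 T, C * eLpNorm (g t) (ENNReal.ofReal q)
        (volume.restrict (fluidDomain a t)) := by
        refine lintegral_mono_ae ((ae_restrict_iff' measurableSet_Ioo).2 ?_)
        filter_upwards [ae_aestronglyMeasurable_slice ha hg] with t ht htT
        exact hCle _ (hA t htT) _ (ht htT)
    _ = C * _ := lintegral_const_mul' _ _ hC.ne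
    _ < ⊤ := ENNReal.mul_lt_top hC hfin

lemma lintegral_eLpNorm_lt_top_of_inCLp {F : Type} [NormedAddCommGroup F] [NormedSpace ℝ F]
    {a : ℝ → ℝ} {T : ℝ} {p : ℝ≥0∞} (hp : 1 ≤ p) {f : ℝ → Plane → F} (hf : InCLp a T p f) :
    ∫⁻ t in Ioo 0 T, eLpNorm (f t) p (volume.restrict (fluidDomain a t)) < ⊤ := by
  obtain ⟨M, hM, hle⟩ := exists_forall_eLpNorm_le_of_inCLp hp hf
  refine (setLIntegral_mono measurable_const fun t ht => hle t (Ioo_subset_Icc_self ht)).trans_lt ?_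
  rw [setLIntegral_const]
  exact ENNReal.mul_lt_top hM (by simp)

lemma lintegral_eLpNorm_lt_top_of_inL2Lp {F : Type} [NormedAddCommGroup F] [NormedSpace ℝ F]
    {a : ℝ → ℝ} {T : ℝ} {p : ℝ≥0∞} {f : ℝ → Plane → F} (hf : InL2Lp a T p f) :
    ∫⁻ t in Ioo 0 T, eLpNorm (f t) p (volume.restrict (fluidDomain a t)) < ⊤ := by
  calc _ ≤ ∫⁻ t in Ioo 0 T, (1 + (eLpNorm (f t) p (volume.restrict (fluidDomain a t))) ^ 2) := by
        refine lintegral_mono fun t => ?_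
        rcases le_total (eLpNorm (f t) p (volume.restrict (fluidDomain a t))) 1 with h | h
        · exact h.trans le_self_add
        · exact (le_self_pow₀ h two_ne_zero).trans le_add_self
    _ = _ := lintegral_add_left measurable_const _
    _ < ⊤ := by
        refine ENNReal.add_lt_top.2 ⟨?_, hf.2⟩
        simp

/-- Integrability of circular averages in the radial coordinates. -/
lemma integrableOn_circAvg {D : Set (ℝ × ℝ)} (hD : MeasurableSet D) (hpos : ∀ p ∈ D, 0 < p.2)
    {h : ℝ × Plane → ℝ}
    (hh : IntegrableOn (fun z : ℝ × Plane => ‖z.2‖⁻¹ * h z)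
      ((fun z : ℝ × Plane => (z.1, ‖z.2‖)) ⁻¹' D)) :
    IntegrableOn (circAvg polarMapTime h) D := by
  have h1 := (isPolar_spaceTime.setIntegral_circAvg hD hh).1
  have hsub : D ⊆ univ ×ˢ Ioi 0 := fun p hp => ⟨mem_univ _, hpos p hp⟩
  rw [IntegrableOn, Measure.restrict_restrict_of_subset hsub] at h1
  refine IntegrableOn.congr_fun h1 (fun p hp => ?_) hD
  refine (congrArg (p.2 * ·) (isPolar_spaceTime.circAvg_comp_mul (hpos p hp)
    (fun p : ℝ × ℝ => p.2⁻¹) h)).trans ?_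
  have := (hpos p hp).ne'
  field_simp

/-- Without the weight 1/|x| the Jacobian r remains. This weaker form is the one applied to u_t. -/
lemma integrableOn_mul_circAvg {D : Set (ℝ × ℝ)} (hD : MeasurableSet D)
    (hpos : ∀ p ∈ D, 0 < p.2) {h : ℝ × Plane → ℝ}
    (hh : IntegrableOn h ((fun z : ℝ × Plane => (z.1, ‖z.2‖)) ⁻¹' D)) :
    IntegrableOn (fun p => p.2 * circAvg polarMapTime h p) D := by
  have h1 := (isPolar_spaceTime.setIntegral_circAvg hD hh).1
  have hsub : D ⊆ univ ×ˢ Ioi 0 := fun p hp => ⟨mem_univ _, hpos p hp⟩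
  rwa [IntegrableOn, Measure.restrict_restrict_of_subset hsub] at h1

/-! ### Slices of the radial space-time domain -/

section Slices

variable {a : ℝ → ℝ} {T : ℝ}

lemma ae_slice_of_ae_radialSpaceTime {p : ℝ × ℝ → Prop}
    (hp : ∀ᵐ z, z ∈ radialSpaceTime a T → p z) :
    ∀ᵐ t, t ∈ Ioo 0 T → ∀ᵐ r, r ∈ Ioo 0 (a t) → p (t, r) := by
  rw [Measure.volume_eq_prod] at hp
  filter_upwards [Measure.ae_ae_of_ae_prod hp] with t ht htT
  filter_upwards [ht] with r hr hra using hr ⟨htT, hra⟩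

lemma indicator_radialSpaceTime_apply (k : ℝ × ℝ → ℝ) (t : ℝ) :
    (fun r => (radialSpaceTime a T).indicator k (t, r)) = if t ∈ Ioo 0 T then
      (Ioo 0 (a t)).indicator (fun r => k (t, r)) else 0 := by
  ext r
  by_cases ht : t ∈ Ioo 0 T
  · rw [if_pos ht]
    by_cases hr : r ∈ Ioo 0 (a t)
    · rw [indicator_of_mem hr, indicator_of_mem (show (t, r) ∈ radialSpaceTime a T from ⟨ht, hr⟩)]
    · rw [indicator_of_notMem hr, indicator_of_notMem fun h => hr h.2]
  · rw [if_neg ht, indicator_of_notMem fun h => ht h.1]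
    rfl

lemma integrableOn_radialSpaceTime_slice (ha : ContinuousOn a (Ioo 0 T)) {k : ℝ × ℝ → ℝ}
    (hk : IntegrableOn k (radialSpaceTime a T)) :
    (∀ᵐ t, t ∈ Ioo 0 T → IntegrableOn (fun r => k (t, r)) (Ioo 0 (a t))) ∧
    IntegrableOn (fun t => ∫ r in Ioo 0 (a t), k (t, r)) (Ioo 0 T) ∧
    ∫ z in radialSpaceTime a T, k z = ∫ t in Ioo 0 T, ∫ r in Ioo 0 (a t), k (t, r) := by
  have hS := (isOpen_radialSpaceTime ha).measurableSet
  have h1 := (integrable_indicator_iff hS).2 hk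
  rw [Measure.volume_eq_prod] at h1
  have h3 : (fun t => ∫ r, (radialSpaceTime a T).indicator k (t, r))
      = (Ioo 0 T).indicator fun t => ∫ r in Ioo 0 (a t), k (t, r) := by
    ext t
    rw [indicator_radialSpaceTime_apply]
    by_cases ht : t ∈ Ioo 0 T
    · rw [if_pos ht, indicator_of_mem ht, integral_indicator measurableSet_Ioo]
    · rw [if_neg ht, indicator_of_notMem ht]
      simp
  refine ⟨?_, ?_, ?_⟩
  · filter_upwards [h1.prod_right_ae] with t ht htT
    rw [indicator_radialSpaceTime_apply, if_pos htT] at ht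
    exact (integrable_indicator_iff measurableSet_Ioo).1 ht
  · have := h1.integral_prod_left
    rw [h3] at this
    exact (integrable_indicator_iff measurableSet_Ioo).1 this
  · rw [← integral_indicator hS, Measure.volume_eq_prod, integral_prod _ h1, h3,
      integral_indicator measurableSet_Ioo]

/-- The restriction of a test function to a time slice is a test function there, so the identity
follows by integrating the slice identities in time. It lifts the divergence formulas for profiles
back to space-time, where they can be compared with the system. -/
lemma HasWeakDirDeriv.of_slices (ha : ContinuousOn a (Ioo 0 T)) {f g : ℝ × ℝ → ℝ}
    (hf : LocallyIntegrableOn f (radialSpaceTime a T) volume)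
    (hg : LocallyIntegrableOn g (radialSpaceTime a T) volume)
    (h : ∀ᵐ t, t ∈ Ioo 0 T → HasWeakDirDeriv (Ioo 0 (a t)) (1 : ℝ) (fun r => f (t, r))
      (fun r => g (t, r))) :
    HasWeakDirDeriv (radialSpaceTime a T) ((0, 1) : ℝ × ℝ) f g := by
  refine ⟨hf, hg, fun φ hφ hc hs => ?_⟩
  have i1 := integrableOn_smul_of_tsupport_subset hf (φ := fun x => fderiv ℝ φ x (0, 1))
    ((hφ.continuous_fderiv (by simp)).clm_apply continuous_const)
    (hc.fderiv_apply ℝ _) ((tsupport_fderiv_apply_subset ℝ _).trans hs)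
  have i2 := integrableOn_smul_of_tsupport_subset hg hφ.continuous hc hs
  rw [(integrableOn_radialSpaceTime_slice ha i1).2.2,
    (integrableOn_radialSpaceTime_slice ha i2).2.2, ← integral_neg]
  refine integral_congr_ae ((ae_restrict_iff' measurableSet_Ioo).2 ?_)
  filter_upwards [h] with t ht htT
  have hιc : Continuous fun r : ℝ => (t, r) := by fun_prop
  have hι : IsClosedEmbedding fun r : ℝ => (t, r) :=
    IsClosedEmbedding.of_continuous_injective_isClosedMap hιc (Prod.mk_right_injective t)
      (isClosedMap_prodMk_left t)
  have h1 := (ht htT).2.2 (fun r => φ (t, r)) (hφ.comp (contDiff_const.prodMk contDiff_id))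
    (hc.comp_isClosedEmbedding hι) (by
      intro r hr
      exact (hs (tsupport_comp_subset_preimage φ hιc hr)).2)
  rw [← h1]
  refine setIntegral_congr_fun measurableSet_Ioo fun r _ => ?_
  have hd : HasFDerivAt (fun r : ℝ => (t, r)) (ContinuousLinearMap.inr ℝ ℝ ℝ) r :=
    hasFDerivAt_prodMk_right t r
  have h2 : HasFDerivAt (fun r : ℝ => φ (t, r)) _ r :=
    ((hφ.differentiable (by simp)) (t, r)).hasFDerivAt.comp r hd
  simp only
  rw [h2.fderiv]
  simp

/-- Rational rectangles form a countable family, so almost-everywhere statements on each of them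
combine into statements about whole slices. -/
lemma exists_rect_subset_radialSpaceTime (ha : ContinuousOn a (Ioo 0 T)) {t x y : ℝ}
    (ht : t ∈ Ioo 0 T) (hx : x ∈ Ioo 0 (a t)) (hy : y ∈ Ioo 0 (a t)) :
    ∃ t₁ t₂ r₁ r₂ : ℚ, t ∈ Ioo (t₁ : ℝ) t₂ ∧ x ∈ Ioo (r₁ : ℝ) r₂ ∧ y ∈ Ioo (r₁ : ℝ) r₂ ∧
      Icc (t₁ : ℝ) t₂ ×ˢ Icc (r₁ : ℝ) r₂ ⊆ radialSpaceTime a T := by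
  obtain ⟨r₁, h1, h1'⟩ := exists_rat_btwn (lt_min hx.1 hy.1)
  obtain ⟨r₂, h2, h2'⟩ := exists_rat_btwn (max_lt hx.2 hy.2)
  have hct := (ha.continuousAt (Ioo_mem_nhds ht.1 ht.2)).eventually (lt_mem_nhds h2')
  obtain ⟨p, q, hpq, hpq'⟩ := mem_nhds_iff_exists_Ioo_subset.1
    (inter_mem hct (Ioo_mem_nhds ht.1 ht.2))
  obtain ⟨t₁, h3, h3'⟩ := exists_rat_btwn hpq.1
  obtain ⟨t₂, h4, h4'⟩ := exists_rat_btwn hpq.2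
  refine ⟨t₁, t₂, r₁, r₂, ⟨h3', h4⟩, ⟨h1'.trans_le (min_le_left _ _), (le_max_left _ _).trans_lt h2⟩,
    ⟨h1'.trans_le (min_le_right _ _), (le_max_right _ _).trans_lt h2⟩, ?_⟩
  rintro ⟨s, r⟩ ⟨hs, hr⟩
  have := hpq' ⟨h3.trans_le hs.1, hs.2.trans_lt h4'⟩
  exact ⟨this.2, h1.trans_le hr.1, hr.2.trans_lt this.1⟩

lemma HasWeakDirDeriv.ae_isPrimitiveOn_radial (ha : ContinuousOn a (Ioo 0 T)) {f g : ℝ × ℝ → ℝ}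
    (h : HasWeakDirDeriv (radialSpaceTime a T) ((0, 1) : ℝ × ℝ) f g)
    (hf : ContinuousOn f (radialSpaceTime a T)) :
    ∀ᵐ t, t ∈ Ioo 0 T → IsPrimitiveOn (fun r => f (t, r)) (fun r => g (t, r)) (Ioo 0 (a t)) := by
  have h1 : ∀ᵐ t, ∀ t₁ t₂ r₁ r₂ : ℚ, Icc (t₁ : ℝ) t₂ ×ˢ Icc (r₁ : ℝ) r₂ ⊆ radialSpaceTime a T →
      t ∈ Ioo (t₁ : ℝ) t₂ → IsPrimitiveOn (fun r => f (t, r)) (fun r => g (t, r))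
        (Ioo (r₁ : ℝ) r₂) := by
    simp only [ae_all_iff]
    intro t₁ t₂ r₁ r₂ hsub
    exact h.ae_isPrimitiveOn_snd (isOpen_radialSpaceTime ha) hf hsub
  filter_upwards [h1] with t ht htT x hx y hy
  obtain ⟨t₁, t₂, r₁, r₂, h1, h2, h3, h4⟩ := exists_rect_subset_radialSpaceTime ha htT hx hy
  exact ht t₁ t₂ r₁ r₂ h4 h1 x h2 y h3

end Slices

/-- Integrability of g up to the endpoints gives a representative that is continuous on the closed
interval. Applied to the divergence, it gives meaning to δ at the free boundary. -/
lemma HasWeakDirDeriv.exists_isPrimitiveOn_Icc {p q : ℝ} (hpq : p < q) {f g : ℝ → ℝ}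
    (h : HasWeakDirDeriv (Ioo p q) (1 : ℝ) f g) (hg : IntegrableOn g (Ioo p q)) :
    ∃ F, IsPrimitiveOn F g (Icc p q) ∧ ContinuousOn F (Icc p q) ∧
      ∀ᵐ x, x ∈ Ioo p q → f x = F x := by
  obtain ⟨F, hF, hfF⟩ := h.exists_isPrimitiveOn hpq
  obtain ⟨m, hm⟩ := exists_between hpq
  have hg' : IntervalIntegrable g volume p q := by
    rw [intervalIntegrable_iff_integrableOn_Ioo_of_le hpq.le]; exact hg
  have hi : ∀ x ∈ Icc p q, ∀ y ∈ Icc p q, IntervalIntegrable g volume x y := fun x hx y hy =>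
    hg'.mono_set (by rw [uIcc_of_le hpq.le]; exact ordConnected_Icc.uIcc_subset hx hy)
  have hm' : m ∈ Icc p q := ⟨hm.1.le, hm.2.le⟩
  have hp : IsPrimitiveOn (fun x => F m + ∫ s in m..x, g s) g (Icc p q) := by
    refine fun x hx y hy => ⟨hi x hx y hy, ?_⟩
    rw [← intervalIntegral.integral_interval_sub_left (hi m hm' y hy) (hi m hm' x hx)]
    ring
  refine ⟨_, hp, ?_, ?_⟩
  · have := hp.continuousOn ordConnected_Icc (left_mem_Icc.2 hpq.le) (right_mem_Icc.2 hpq.le)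
    rwa [uIcc_of_le hpq.le] at this
  · filter_upwards [hfF] with x hx hx'
    rw [hx hx', (hF m hm x hx').2]
    ring

/-- A primitive of a function which agrees almost everywhere with a continuous one is
continuously differentiable. -/
lemma IsPrimitiveOn.hasDerivAt_of_continuousOn {p q : ℝ} {f g : ℝ → ℝ}
    (h : IsPrimitiveOn f g (Ioo p q)) (hg : ContinuousOn g (Ioo p q)) {x : ℝ}
    (hx : x ∈ Ioo p q) : HasDerivAt f (g x) x := by
  have h1 : HasDerivAt (fun y => ∫ s in x..y, g s) (g x) x :=
    intervalIntegral.integral_hasDerivAt_right (by simp)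
      (hg.stronglyMeasurableAtFilter isOpen_Ioo x hx) (hg.continuousAt (isOpen_Ioo.mem_nhds hx))
  refine (h1.add_const (f x)).congr_of_eventuallyEq ?_
  filter_upwards [isOpen_Ioo.mem_nhds hx] with y hy
  rw [(h x hx y hy).2]
  ring

/-- The free surface condition uses a one-sided derivative of u at r = a(t). If the interior
derivative has a limit there, the two agree, so the condition becomes a statement about the
continuous divergence δ. -/
lemma HasDerivWithinAt.eq_of_tendsto_left {f f' : ℝ → ℝ} {A d : ℝ} (hA : 0 < A)
    (hf : ∀ r ∈ Ioo 0 A, HasDerivAt f (f' r) r) (hf' : ContinuousOn f' (Ioc 0 A))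
    (hd : HasDerivWithinAt f d (Icc 0 A) A) : d = f' A := by
  have hAm : A ∈ Ioc 0 A := ⟨hA, le_rfl⟩
  have h1 : HasDerivWithinAt f (f' A) (Iic A) A := by
    refine hasDerivWithinAt_Iic_of_tendsto_deriv (s := Ioo 0 A)
      (fun r hr => (hf r hr).differentiableAt.differentiableWithinAt)
      (hd.continuousWithinAt.mono Ioo_subset_Icc_self) (Ioo_mem_nhdsLT hA) ?_
    have h2 : Tendsto f' (𝓝[<] A) (𝓝 (f' A)) := by
      refine ((hf' A hAm).mono_left ?_)
      rw [← nhdsWithin_Ioo_eq_nhdsLT hA]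
      exact nhdsWithin_mono _ Ioo_subset_Ioc_self
    refine h2.congr' ?_
    filter_upwards [Ioo_mem_nhdsLT hA] with r hr using (hf r hr).deriv.symm
  have h3 := h1.mono (s := Icc 0 A) fun r hr => hr.2
  have hu : UniqueDiffWithinAt ℝ (Icc 0 A) A := uniqueDiffOn_Icc hA A (right_mem_Icc.2 hA.le)
  rw [← hd.derivWithin hu, h3.derivWithin hu]

/-! ### Radial flows -/

/-- The equations of the radial system on the interval `(0, A)` at a fixed time. The functions
`ρt, ut, Pt, Bt` are the time derivatives, `δ` is the divergence of the velocity. -/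
structure RadialSlice (κ γ A : ℝ) (ρ u P B ρt ut Pt Bt δ δ' : ℝ → ℝ) : Prop where
  div_primitive : IsPrimitiveOn δ δ' (Icc 0 A)
  div_integrable : IntegrableOn δ' (Ioo 0 A)
  div_cont : ContinuousOn δ (Icc 0 A)
  velocity_deriv : ∀ r ∈ Ioo 0 A, HasDerivAt u (δ r - u r / r) r
  density : ∃ ρr, IsPrimitiveOn ρ ρr (Ioo 0 A)
  mass : ∃ wr, IsPrimitiveOn (fun r => ρ r * u r) wr (Ioo 0 A) ∧
    ∀ᵐ r, r ∈ Ioo 0 A → ρt r + wr r + ρ r * u r / r = 0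
  momentum_pressure : ∃ Pr Br, IsPrimitiveOn P Pr (Ioo 0 A) ∧ IsPrimitiveOn B Br (Ioo 0 A) ∧
    ∀ᵐ r, r ∈ Ioo 0 A →
      ρ r * (ut r + u r * (δ r - u r / r)) + Pr r = κ * δ' r - B r * (Br r + B r / r) ∧
      Pt r + u r * Pr r + γ * P r * δ r = 0
  induction : ∃ qr, IsPrimitiveOn (fun r => u r * B r) qr (Ioo 0 A) ∧
    ∀ᵐ r, r ∈ Ioo 0 A → Bt r + qr r = 0
  free_surface : κ * δ A = B A ^ 2 / 2 + P A
  density_integrable : IntegrableOn ρt (Ioo 0 A)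
  pressure_integrable : IntegrableOn Pt (Ioo 0 A)
  magnetic_integrable : IntegrableOn Bt (Ioo 0 A)

/-- `f_t` is the time derivative of `f` on almost every horizontal line segment in the domain. -/
def IsTimePrimitive (a : ℝ → ℝ) (T : ℝ) (f : ℝ → ℝ → ℝ) (ft : ℝ × ℝ → ℝ) : Prop :=
  ∀ t₁ t₂ r₁ r₂ : ℝ, Icc t₁ t₂ ×ˢ Icc r₁ r₂ ⊆ radialSpaceTime a T →
    ∀ᵐ r, r ∈ Ioo r₁ r₂ → IsPrimitiveOn (fun t => f t r) (fun t => ft (t, r)) (Ioo t₁ t₂)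

/-- Solutions of the free boundary problem in the form used below: the equations hold on almost
every slice, and the derivatives are integrable up to the boundary. -/
structure RadialFlow (κ γ T : ℝ) (a : ℝ → ℝ) (ρ u P B : ℝ → ℝ → ℝ)
    (ρt ut Pt Bt d d' : ℝ × ℝ → ℝ) : Prop where
  radius_pos : ∀ t ∈ Icc 0 T, 0 < a t
  radius_deriv : ∀ t ∈ Icc 0 T, HasDerivWithinAt a (u t (a t)) (Icc 0 T) t
  cont_density : IsContinuousProfile a T ρ
  cont_velocity : IsContinuousProfile a T u
  cont_pressure : IsContinuousProfile a T P
  cont_magnetic : IsContinuousProfile a T B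
  center : ∀ t ∈ Icc 0 T, u t 0 = 0 ∧ B t 0 = 0
  density_time : IsTimePrimitive a T ρ ρt
  velocity_time : IsTimePrimitive a T u ut
  pressure_time : IsTimePrimitive a T P Pt
  magnetic_time : IsTimePrimitive a T B Bt
  density_integrable : IntegrableOn ρt (radialSpaceTime a T)
  pressure_integrable : IntegrableOn Pt (radialSpaceTime a T)
  magnetic_integrable : IntegrableOn Bt (radialSpaceTime a T)
  velocity_integrable : IntegrableOn (fun z => z.2 * ut z) (radialSpaceTime a T)
  div_integrable : IntegrableOn d (radialSpaceTime a T)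
  div_deriv_integrable : IntegrableOn d' (radialSpaceTime a T)
  slice : ∀ᵐ t, t ∈ Ioo 0 T → ∃ δ, RadialSlice κ γ (a t) (ρ t) (u t) (P t) (B t)
    (fun r => ρt (t, r)) (fun r => ut (t, r)) (fun r => Pt (t, r)) (fun r => Bt (t, r)) δ
    (fun r => d' (t, r)) ∧ ∀ᵐ r, r ∈ Ioo 0 (a t) → d (t, r) = δ r

/-! ### Strong solutions are radial flows -/

section FromFields

variable {a : ℝ → ℝ} {T : ℝ}

lemma preimage_radialSpaceTime_subset (a : ℝ → ℝ) (T : ℝ) :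
    (fun z : ℝ × Plane => (z.1, ‖z.2‖)) ⁻¹' radialSpaceTime a T ⊆ spaceTime a T :=
  fun _ hz => ⟨hz.1, mem_ball_zero_iff.2 hz.2.2⟩

lemma pos_of_mem_radialSpaceTime {p : ℝ × ℝ} (hp : p ∈ radialSpaceTime a T) : 0 < p.2 := hp.2.1

/-- The factor 2 in the bound is only for uniformity with vector fields, where two components are
added. -/
lemma HasWeakTimeDeriv.scalar_profile (ha : ContinuousOn a (Ioo 0 T)) {f : ℝ → ℝ → ℝ}
    {g : ℝ → Plane → ℝ} (h : HasWeakTimeDeriv a T (fun t => scalarField (f t)) g) :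
    ∃ k : ℝ × Plane → ℝ, HasWeakDirDeriv (radialSpaceTime a T) ((1, 0) : ℝ × ℝ)
      (fun z => f z.1 z.2) (circAvg polarMapTime k) ∧
      AEStronglyMeasurable k (volume.restrict (spaceTime a T)) ∧ ∀ z, |k z| ≤ 2 * ‖g z.1 z.2‖ := by
  refine ⟨fun z => g z.1 z.2, ?_, h.2.1.aestronglyMeasurable, fun z => ?_⟩
  · exact HasWeakDirDeriv.of_radial_time (isOpen_radialSpaceTime ha)
      (fun p hp => pos_of_mem_radialSpaceTime hp)
      (HasWeakDirDeriv.mono h (preimage_radialSpaceTime_subset a T))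
  · rw [Real.norm_eq_abs]
    linarith [abs_nonneg (g z.1 z.2)]

/-- The profile is the component of V along the frame e. Since e does not depend on time and is
smooth off the origin, taking this component commutes with the weak time derivative, which reduces
the claim to a radial scalar. -/
lemma HasWeakTimeDeriv.vector_profile (ha : ContinuousOn a (Ioo 0 T)) {f : ℝ → ℝ → ℝ}
    {V g : ℝ → Plane → Plane} {e : Fin 2 → Plane → ℝ}
    (he : ∀ j, ContDiffOn ℝ ∞ (e j) {x | x ≠ 0}) (hem : ∀ j, Measurable (e j))
    (hb : ∀ j x, |e j x| ≤ 1)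
    (hV : ∀ t x, x ≠ 0 → e 0 x * V t x 0 + e 1 x * V t x 1 = f t ‖x‖)
    (h : HasWeakTimeDeriv a T V g) :
    ∃ k : ℝ × Plane → ℝ, HasWeakDirDeriv (radialSpaceTime a T) ((1, 0) : ℝ × ℝ)
      (fun z => f z.1 z.2) (circAvg polarMapTime k) ∧
      AEStronglyMeasurable k (volume.restrict (spaceTime a T)) ∧ ∀ z, |k z| ≤ 2 * ‖g z.1 z.2‖ := by
  have hgm : AEStronglyMeasurable (fun z : ℝ × Plane => g z.1 z.2)
    (volume.restrict (spaceTime a T)) := h.2.1.aestronglyMeasurable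
  set D := radialSpaceTime a T with hD
  have hDo : IsOpen D := isOpen_radialSpaceTime ha
  have hNo : IsOpen ((fun z : ℝ × Plane => (z.1, ‖z.2‖)) ⁻¹' D) :=
    hDo.preimage (by fun_prop)
  have hmaps : ∀ z ∈ (fun z : ℝ × Plane => (z.1, ‖z.2‖)) ⁻¹' D, z.2 ≠ 0 := fun z hz =>
    norm_pos_iff.1 (pos_of_mem_radialSpaceTime (a := a) (T := T) hz)
  have h1 := HasWeakDirDeriv.mono h (preimage_radialSpaceTime_subset a T)
  have hj : ∀ j, HasWeakDirDeriv ((fun z : ℝ × Plane => (z.1, ‖z.2‖)) ⁻¹' D)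
      ((1, 0) : ℝ × Plane) (fun z => e j z.2 * V z.1 z.2 j) (fun z => e j z.2 * g z.1 z.2 j) := by
    intro j
    have h2 := h1.clm_comp (EuclideanSpace.proj j : Plane →L[ℝ] ℝ)
    have h3 := h2.smooth_mul hNo (p := fun z => e j z.2)
      ((he j).comp contDiff_snd.contDiffOn hmaps)
    refine h3.congr hNo.measurableSet (Eventually.of_forall fun z _ => rfl)
      (Eventually.of_forall fun z hz => ?_)
    have hd : HasFDerivAt (fun z : ℝ × Plane => e j z.2) _ z :=
      ((((he j).contDiffAt (isOpen_ne.mem_nhds (hmaps z hz))).differentiableAt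
        (by simp)).hasFDerivAt).comp z (hasFDerivAt_snd (𝕜 := ℝ) (p := z))
    rw [hd.fderiv]
    simp
  refine ⟨fun z => e 0 z.2 * g z.1 z.2 0 + e 1 z.2 * g z.1 z.2 1, ?_, ?_, fun z => ?_⟩
  · refine HasWeakDirDeriv.of_radial_time hDo (fun p hp => pos_of_mem_radialSpaceTime hp) ?_
    exact ((hj 0).add (hj 1)).congr hNo.measurableSet
      (Eventually.of_forall fun z hz => hV _ _ (hmaps z hz)) (Eventually.of_forall fun z _ => rfl)
  · have hc : ∀ j : Fin 2, AEStronglyMeasurable (fun z : ℝ × Plane => g z.1 z.2 j)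
        (volume.restrict (spaceTime a T)) := fun j =>
      (EuclideanSpace.proj j : Plane →L[ℝ] ℝ).continuous.comp_aestronglyMeasurable hgm
    have hc' : ∀ j : Fin 2, AEStronglyMeasurable (fun z : ℝ × Plane => e j z.2)
        (volume.restrict (spaceTime a T)) := fun j =>
      ((hem j).comp measurable_snd).aestronglyMeasurable
    exact ((hc' 0).mul (hc 0)).add ((hc' 1).mul (hc 1))
  · have hc : ∀ j : Fin 2, |e j z.2 * g z.1 z.2 j| ≤ ‖g z.1 z.2‖ := fun j => by
      rw [abs_mul]
      calc _ ≤ 1 * ‖g z.1 z.2 j‖ := by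
            rw [Real.norm_eq_abs]
            exact mul_le_mul_of_nonneg_right (hb j _) (abs_nonneg _)
        _ ≤ _ := by rw [one_mul]; exact PiLp.norm_apply_le _ j
    calc _ ≤ |e 0 z.2 * g z.1 z.2 0| + |e 1 z.2 * g z.1 z.2 1| := abs_add_le _ _
      _ ≤ _ := by linarith [hc 0, hc 1]

lemma contDiffOn_coord_div_norm (j : Fin 2) :
    ContDiffOn ℝ ∞ (fun x : Plane => x j / ‖x‖) {x | x ≠ 0} :=
  (contDiff_coord j).contDiffOn.div contDiffOn_norm_plane fun _ hx => norm_ne_zero_iff.2 hx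

lemma abs_coord_div_norm_le (j : Fin 2) (x : Plane) : |x j / ‖x‖| ≤ 1 := by
  rw [abs_div, abs_norm]
  exact div_le_one_of_le₀ (PiLp.norm_apply_le x j) (norm_nonneg _)

lemma measurable_coord_div_norm (j : Fin 2) : Measurable fun x : Plane => x j / ‖x‖ := by
  fun_prop

lemma HasWeakTimeDeriv.radial_profile (ha : ContinuousOn a (Ioo 0 T)) {f : ℝ → ℝ → ℝ}
    {g : ℝ → Plane → Plane} (h : HasWeakTimeDeriv a T (fun t => radialField (f t)) g) :
    ∃ k : ℝ × Plane → ℝ, HasWeakDirDeriv (radialSpaceTime a T) ((1, 0) : ℝ × ℝ)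
      (fun z => f z.1 z.2) (circAvg polarMapTime k) ∧
      AEStronglyMeasurable k (volume.restrict (spaceTime a T)) ∧ ∀ z, |k z| ≤ 2 * ‖g z.1 z.2‖ := by
  refine HasWeakTimeDeriv.vector_profile ha (e := fun j x => x j / ‖x‖) contDiffOn_coord_div_norm
    measurable_coord_div_norm abs_coord_div_norm_le (fun t x hx => ?_) h
  have h0 := norm_ne_zero_iff.2 hx
  have := plane_norm_sq x
  simp only [radialField, PiLp.smul_apply, smul_eq_mul]
  field_simp
  rw [this]
  ring

lemma HasWeakTimeDeriv.azimuthal_profile (ha : ContinuousOn a (Ioo 0 T)) {f : ℝ → ℝ → ℝ}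
    {g : ℝ → Plane → Plane} (h : HasWeakTimeDeriv a T (fun t => azimuthalField (f t)) g) :
    ∃ k : ℝ × Plane → ℝ, HasWeakDirDeriv (radialSpaceTime a T) ((1, 0) : ℝ × ℝ)
      (fun z => f z.1 z.2) (circAvg polarMapTime k) ∧
      AEStronglyMeasurable k (volume.restrict (spaceTime a T)) ∧ ∀ z, |k z| ≤ 2 * ‖g z.1 z.2‖ := by
  refine HasWeakTimeDeriv.vector_profile ha
    (e := ![fun x => -(x 1 / ‖x‖), fun x => x 0 / ‖x‖]) ?_ ?_ ?_ (fun t x hx => ?_) h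
  · intro j
    fin_cases j
    · exact (contDiffOn_coord_div_norm 1).neg
    · exact contDiffOn_coord_div_norm 0
  · intro j
    fin_cases j
    · exact (measurable_coord_div_norm 1).neg
    · exact measurable_coord_div_norm 0
  · intro j x
    fin_cases j
    · exact (abs_neg _).trans_le (abs_coord_div_norm_le 1 x)
    · exact abs_coord_div_norm_le 0 x
  · have h0 := norm_ne_zero_iff.2 hx
    have := plane_norm_sq x
    simp [azimuthalField]
    field_simp
    rw [this]
    ring

lemma integrableOn_circAvg_of_bound {F : Type} [NormedAddCommGroup F] {A q c : ℝ} (hq : 2 < q)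
    (ha : ContinuousOn a (Ioo 0 T)) (hA : ∀ t ∈ Ioo 0 T, a t ≤ A) {g : ℝ → Plane → F}
    (hg : AEStronglyMeasurable (fun z : ℝ × Plane => g z.1 z.2)
      (volume.restrict (spaceTime a T)))
    (hfin : ∫⁻ t in Ioo 0 T, eLpNorm (g t) (ENNReal.ofReal q)
      (volume.restrict (fluidDomain a t)) < ⊤) {k : ℝ × Plane → ℝ}
    (hk : AEStronglyMeasurable k (volume.restrict (spaceTime a T)))
    (hkg : ∀ z, |k z| ≤ c * ‖g z.1 z.2‖) :
    IntegrableOn (circAvg polarMapTime k) (radialSpaceTime a T) := by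
  refine integrableOn_circAvg (isOpen_radialSpaceTime ha).measurableSet
    (fun p hp => pos_of_mem_radialSpaceTime hp) (IntegrableOn.mono_set ?_
      (preimage_radialSpaceTime_subset a T))
  have hmi : AEStronglyMeasurable (fun z : ℝ × Plane => ‖z.2‖⁻¹)
      (volume.restrict (spaceTime a T)) := Measurable.aestronglyMeasurable (by fun_prop)
  refine Integrable.mono' ((integrableOn_norm_inv_mul hq ha hA hg hfin).const_mul c) (hmi.mul hk)
    (Eventually.of_forall fun z => ?_)
  rw [norm_mul, Real.norm_eq_abs (k z), norm_inv, norm_norm]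
  calc _ ≤ ‖z.2‖⁻¹ * (c * ‖g z.1 z.2‖) := mul_le_mul_of_nonneg_left (hkg z) (by positivity)
    _ = _ := by ring

/-- The disks lie in one bounded disk and the time interval is bounded, so L² in time with values in
L^p is contained in L¹ of space-time. -/
lemma integrableOn_spaceTime_of_inL2Lp {F : Type} [NormedAddCommGroup F] [NormedSpace ℝ F]
    {A : ℝ} {p : ℝ≥0∞} (hp : 1 ≤ p) (ha : ContinuousOn a (Ioo 0 T))
    (hA : ∀ t ∈ Ioo 0 T, a t ≤ A) {g : ℝ → Plane → F} (hg : InL2Lp a T p g) :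
    IntegrableOn (fun z : ℝ × Plane => g z.1 z.2) (spaceTime a T) := by
  refine ⟨hg.1, ?_⟩
  rw [HasFiniteIntegral, lintegral_spaceTime ha hg.1.enorm]
  set M : ℝ≥0∞ := volume (Metric.ball (0 : Plane) A) ^ (1 / (1 : ℝ≥0∞).toReal - 1 / p.toReal)
    with hM
  have he : 0 ≤ 1 / (1 : ℝ≥0∞).toReal - 1 / p.toReal := by
    rcases eq_or_ne p ⊤ with rfl | hpt
    · simp
    · have : 1 ≤ p.toReal := by
        rw [← ENNReal.toReal_one]
        exact ENNReal.toReal_mono hpt hp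
      rw [ENNReal.toReal_one, sub_nonneg, div_le_div_iff₀ (by linarith) one_pos]
      linarith
  have hMt : M < ⊤ := ENNReal.rpow_lt_top_of_nonneg he measure_ball_lt_top.ne
  calc _ ≤ ∫⁻ t in Ioo 0 T, M * eLpNorm (g t) p (volume.restrict (fluidDomain a t)) := by
        refine lintegral_mono_ae ((ae_restrict_iff' measurableSet_Ioo).2 ?_)
        filter_upwards [ae_aestronglyMeasurable_slice ha hg.1] with t ht htT
        have h1 := eLpNorm_le_eLpNorm_mul_rpow_measure_univ hp (ht htT)
        rw [eLpNorm_one_eq_lintegral_enorm, mul_comm] at h1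
        refine h1.trans ?_
        gcongr
        rw [Measure.restrict_apply_univ]
        refine ENNReal.rpow_le_rpow (measure_mono (Metric.ball_subset_ball (hA t htT))) he
    _ = M * _ := lintegral_const_mul' _ _ hMt.ne
    _ < ⊤ := ENNReal.mul_lt_top hMt (lintegral_eLpNorm_lt_top_of_inL2Lp hg)

lemma continuousOn_profile_radialSpaceTime {f : ℝ → ℝ → ℝ} (hf : IsContinuousProfile a T f) :
    ContinuousOn (fun z : ℝ × ℝ => f z.1 z.2) (radialSpaceTime a T) :=
  hf.mono fun _ hz => ⟨Ioo_subset_Icc_self hz.1, Ioo_subset_Icc_self hz.2⟩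

lemma IsContinuousProfile.slice {f : ℝ → ℝ → ℝ} (hf : IsContinuousProfile a T f) {t : ℝ}
    (ht : t ∈ Icc 0 T) : ContinuousOn (f t) (Icc 0 (a t)) :=
  ContinuousOn.comp (f := fun r => (t, r)) hf (by fun_prop) fun _ hr => ⟨ht, hr⟩

/-- The divergence of the velocity and its radial derivative. -/
lemma exists_divergence {A q : ℝ} (hq : 2 < q) (ha : ContinuousOn a (Ioo 0 T))
    (hA : ∀ t ∈ Ioo 0 T, a t ≤ A) {u : ℝ → ℝ → ℝ}
    (hu : InL2W2 a T (ENNReal.ofReal q) (fun t => radialField (u t))) :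
    ∃ d d' : ℝ × ℝ → ℝ, IntegrableOn d (radialSpaceTime a T) ∧
      IntegrableOn d' (radialSpaceTime a T) ∧
      (∀ᵐ t, t ∈ Ioo 0 T → HasWeakDirDeriv (Ioo 0 (a t)) (1 : ℝ) (u t)
        (fun r => d (t, r) - u t r / r)) ∧
      (∀ᵐ t, t ∈ Ioo 0 T → HasWeakDirDeriv (Ioo 0 (a t)) (1 : ℝ) (fun r => d (t, r))
        (fun r => d' (t, r))) := by
  obtain ⟨-, G, hG, hGi, H, hH, hHi⟩ := hu
  rw [ae_restrict_iff' measurableSet_Ioo] at hG hH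
  -- With G and H the first and second weak derivatives of the velocity field, d averages the
  -- divergence tr G over circles and d' averages its derivative in the direction x/|x|.
  refine ⟨circAvg polarMapTime fun z => traceCLM (G z.1 z.2),
    circAvg polarMapTime fun z => ‖z.2‖⁻¹ * traceCLM (H z.1 z.2 z.2), ?_, ?_, ?_, ?_⟩
  · exact integrableOn_circAvg_of_bound hq ha hA hGi.1 (lintegral_eLpNorm_lt_top_of_inL2Lp hGi)
      (traceCLM.continuous.comp_aestronglyMeasurable hGi.1) fun z => traceCLM.le_opNorm _
  · refine integrableOn_circAvg_of_bound (c := ‖traceCLM‖) hq ha hA hHi.1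
      (lintegral_eLpNorm_lt_top_of_inL2Lp hHi) ?_ fun z => ?_
    · refine (Measurable.aestronglyMeasurable (by fun_prop)).mul
        (traceCLM.continuous.comp_aestronglyMeasurable ?_)
      have h1 : AEStronglyMeasurable (fun z : ℝ × Plane => z.2)
        (volume.restrict (spaceTime a T)) := continuous_snd.aestronglyMeasurable
      exact (isBoundedBilinearMap_apply.continuous).comp_aestronglyMeasurable (hHi.1.prodMk h1)
    · rw [abs_mul, abs_inv, abs_norm]
      have h1 : |traceCLM (H z.1 z.2 z.2)| ≤ ‖traceCLM‖ * (‖H z.1 z.2‖ * ‖z.2‖) :=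
        (traceCLM.le_opNorm _).trans
          (mul_le_mul_of_nonneg_left ((H z.1 z.2).le_opNorm _) (norm_nonneg _))
      calc _ ≤ ‖z.2‖⁻¹ * (‖traceCLM‖ * (‖H z.1 z.2‖ * ‖z.2‖)) :=
            mul_le_mul_of_nonneg_left h1 (by positivity)
        _ = (‖z.2‖⁻¹ * ‖z.2‖) * (‖traceCLM‖ * ‖H z.1 z.2‖) := by ring
        _ ≤ 1 * (‖traceCLM‖ * ‖H z.1 z.2‖) :=
            mul_le_mul_of_nonneg_right (inv_mul_le_one) (by positivity)
        _ = _ := one_mul _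
  · filter_upwards [hG] with t ht htT
    exact (ht htT).radialField
  · filter_upwards [hH] with t ht htT
    have h1 : HasWeakGrad (Metric.ball 0 (a t)) (fun x => traceCLM (G t x))
        (fun x => traceCLM.comp (H t x)) := fun v => (ht htT v).clm_comp traceCLM
    exact h1.circAvg

end FromFields

/-- Each derivative in the radial system equals, by uniqueness of weak derivatives, a circular
average of a derivative of a planar field, and inherits its integrability. Absolute continuity on
lines then brings the system to almost every time slice. -/
lemma IsStrongSolution.exists_radialFlow {μ lam γ q a₀ : ℝ} {ρ₀ u₀ P₀ B₀ : ℝ → ℝ} {T : ℝ}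
    {a : ℝ → ℝ} {ρ u P B : ℝ → ℝ → ℝ} (hq : 2 < q)
    (h : IsStrongSolution μ lam γ q a₀ ρ₀ u₀ P₀ B₀ T a ρ u P B) :
    ∃ ρt ut Pt Bt d d', RadialFlow (2 * μ + lam) γ T a ρ u P B ρt ut Pt Bt d d' := by
  have haI : ContinuousOn a (Icc 0 T) := fun t ht => (h.radius_deriv t ht).continuousWithinAt
  have ha : ContinuousOn a (Ioo 0 T) := haI.mono Ioo_subset_Icc_self
  obtain ⟨A, hA'⟩ := isCompact_Icc.bddAbove_image haI
  have hA : ∀ t ∈ Ioo 0 T, a t ≤ A := fun t ht => hA' (mem_image_of_mem a (Ioo_subset_Icc_self ht))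
  have hq1 : 1 ≤ ENNReal.ofReal q := by
    rw [← ENNReal.ofReal_one]
    exact ENNReal.ofReal_le_ofReal (by linarith)
  have hDo := isOpen_radialSpaceTime ha
  have hDm := hDo.measurableSet
  obtain ⟨ρt, wr, ut, ur, dr, Pt, Pr, Bt, Br, br, hρt, hwr, hut, hur, hdr, hPt, hPr, hBt, hBr, hbr,
    heq⟩ := h.system
  rw [ae_restrict_iff' hDm] at heq
  obtain ⟨d, d', hdi, hdi', hd, hd'⟩ := exists_divergence hq ha hA h.velocity_W2
  have huc := continuousOn_profile_radialSpaceTime h.cont_velocity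
  have hurc : ContinuousOn (fun z : ℝ × ℝ => u z.1 z.2 / z.2) (radialSpaceTime a T) :=
    huc.div continuousOn_snd fun z hz => (pos_of_mem_radialSpaceTime hz).ne'
  have e1 : ∀ᵐ z, z ∈ radialSpaceTime a T → ur z = d z - u z.1 z.2 / z.2 := by
    refine hur.ae_unique hDo (HasWeakDirDeriv.of_slices ha (huc.locallyIntegrableOn hDm)
      (hdi.locallyIntegrableOn.sub (hurc.locallyIntegrableOn hDm)) hd)
      (Eventually.of_forall fun _ _ => rfl)
  have e2 : ∀ᵐ z, z ∈ radialSpaceTime a T → dr z = d' z := by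
    refine hdr.ae_unique hDo (HasWeakDirDeriv.of_slices ha hdi.locallyIntegrableOn
      hdi'.locallyIntegrableOn hd') ?_
    filter_upwards [e1] with z hz hz'
    rw [hz hz']
    ring
  have iρ : IntegrableOn ρt (radialSpaceTime a T) := by
    obtain ⟨g, hg, hgi⟩ := h.density_time
    obtain ⟨k, hk, hkm, hkb⟩ := HasWeakTimeDeriv.scalar_profile ha hg
    exact (integrableOn_circAvg_of_bound hq ha hA hg.2.1.aestronglyMeasurable
      (lintegral_eLpNorm_lt_top_of_inCLp hq1 hgi) hkm hkb).congr_fun_ae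
        ((ae_restrict_iff' hDm).2 (hk.ae_unique hDo hρt (Eventually.of_forall fun _ _ => rfl)))
  have iP : IntegrableOn Pt (radialSpaceTime a T) := by
    obtain ⟨g, hg, hgi⟩ := h.pressure_time
    obtain ⟨k, hk, hkm, hkb⟩ := HasWeakTimeDeriv.scalar_profile ha hg
    exact (integrableOn_circAvg_of_bound hq ha hA hg.2.1.aestronglyMeasurable
      (lintegral_eLpNorm_lt_top_of_inCLp hq1 hgi) hkm hkb).congr_fun_ae
        ((ae_restrict_iff' hDm).2 (hk.ae_unique hDo hPt (Eventually.of_forall fun _ _ => rfl)))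
  have iB : IntegrableOn Bt (radialSpaceTime a T) := by
    obtain ⟨g, hg, hgi⟩ := h.magnetic_time
    obtain ⟨k, hk, hkm, hkb⟩ := HasWeakTimeDeriv.azimuthal_profile ha hg
    exact (integrableOn_circAvg_of_bound hq ha hA hg.2.1.aestronglyMeasurable
      (lintegral_eLpNorm_lt_top_of_inCLp hq1 hgi) hkm hkb).congr_fun_ae
        ((ae_restrict_iff' hDm).2 (hk.ae_unique hDo hBt (Eventually.of_forall fun _ _ => rfl)))
  -- The time derivative of the velocity is used only through its L² bound in space, too weak for
  -- the weight 1/|x|; hence the factor r stays.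
  have iu : IntegrableOn (fun z => z.2 * ut z) (radialSpaceTime a T) := by
    obtain ⟨g, hg, hgi, -⟩ := h.velocity_time
    obtain ⟨k, hk, hkm, hkb⟩ := HasWeakTimeDeriv.radial_profile ha hg
    have h1 : IntegrableOn k (spaceTime a T) :=
      Integrable.mono' ((integrableOn_spaceTime_of_inL2Lp (by norm_num) ha hA hgi.1).norm.const_mul 2)
        hkm (Eventually.of_forall hkb)
    refine (integrableOn_mul_circAvg hDm (fun p hp => pos_of_mem_radialSpaceTime hp)
      (h1.mono_set (preimage_radialSpaceTime_subset a T))).congr_fun_ae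
        ((ae_restrict_iff' hDm).2 ?_)
    filter_upwards [hk.ae_unique hDo hut (Eventually.of_forall fun _ _ => rfl)] with z hz hz'
    rw [hz hz']
  have hprim : ∀ {f : ℝ → ℝ → ℝ} {ft : ℝ × ℝ → ℝ}, IsContinuousProfile a T f →
      HasWeakDirDeriv (radialSpaceTime a T) ((1, 0) : ℝ × ℝ) (fun z => f z.1 z.2) ft →
      IsTimePrimitive a T f ft := fun hf hft t₁ t₂ r₁ r₂ hsub =>
    hft.ae_isPrimitiveOn_fst (continuousOn_profile_radialSpaceTime hf) hsub
  refine ⟨ρt, ut, Pt, Bt, d, d', h.radius_pos, h.radius_deriv, h.cont_density, h.cont_velocity,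
    h.cont_pressure, h.cont_magnetic, h.center, hprim h.cont_density hρt,
    hprim h.cont_velocity hut, hprim h.cont_pressure hPt, hprim h.cont_magnetic hBt, iρ, iP, iB, iu,
    hdi, hdi', ?_⟩
  have hρc := continuousOn_profile_radialSpaceTime h.cont_density
  have hPc := continuousOn_profile_radialSpaceTime h.cont_pressure
  have hBc := continuousOn_profile_radialSpaceTime h.cont_magnetic
  filter_upwards [hwr.ae_isPrimitiveOn_radial ha (hρc.mul huc), hPr.ae_isPrimitiveOn_radial ha hPc,
    hBr.ae_isPrimitiveOn_radial ha hBc, hbr.ae_isPrimitiveOn_radial ha (huc.mul hBc), hd, hd',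
    ae_slice_of_ae_radialSpaceTime heq, ae_slice_of_ae_radialSpaceTime e1,
    ae_slice_of_ae_radialSpaceTime e2, (integrableOn_radialSpaceTime_slice ha iρ).1,
    (integrableOn_radialSpaceTime_slice ha iP).1, (integrableOn_radialSpaceTime_slice ha iB).1,
    (integrableOn_radialSpaceTime_slice ha hdi').1]
    with t pw pP pB pb wd wd' qe q1 q2 jρ jP jB jd' htT
  have htI := Ioo_subset_Icc_self htT
  have hat := h.radius_pos t htI
  obtain ⟨δ, hδ, hδc, hdδ⟩ := (wd' htT).exists_isPrimitiveOn_Icc hat (jd' htT)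
  have hus := h.cont_velocity.slice htI
  have hup := (wd htT).isPrimitiveOn (hus.mono Ioo_subset_Icc_self)
  have hup' : IsPrimitiveOn (u t) (fun r => δ r - u t r / r) (Ioo 0 (a t)) := by
    refine hup.congr_ae ?_
    filter_upwards [hdδ] with r hr hr'
    rw [hr hr']
  have hgc : ContinuousOn (fun r => δ r - u t r / r) (Ioc 0 (a t)) :=
    (hδc.mono Ioc_subset_Icc_self).sub ((hus.mono Ioc_subset_Icc_self).div continuousOn_id
      fun r hr => hr.1.ne')
  have hud : ∀ r ∈ Ioo 0 (a t), HasDerivAt (u t) (δ r - u t r / r) r := fun r hr =>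
    hup'.hasDerivAt_of_continuousOn (hgc.mono Ioo_subset_Ioc_self) hr
  refine ⟨δ, ⟨hδ, jd' htT, hδc, hud, ?_, ⟨_, pw htT, ?_⟩, ⟨_, _, pP htT, pB htT, ?_⟩,
    ⟨_, pb htT, ?_⟩, ?_, jρ htT, jP htT, jB htT⟩, hdδ⟩
  -- The system provides only the derivative of ρu. That ρ itself has a radial derivative on the
  -- slice comes from the W^{1,q} regularity.
  · obtain ⟨-, G, hG, -⟩ := h.density_W1
    have h1 : HasWeakDirDeriv (Ioo 0 (a t)) (1 : ℝ) (ρ t) _ :=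
      (HasWeakGrad.circAvg (hG t htI)).congr measurableSet_Ioo
        (Eventually.of_forall fun r hr => circAvg_radial (ρ t) hr.1)
        (Eventually.of_forall fun _ _ => rfl)
    exact ⟨_, h1.isPrimitiveOn ((h.cont_density.slice htI).mono Ioo_subset_Icc_self)⟩
  · filter_upwards [qe htT] with r hr hr' using (hr hr').1
  · filter_upwards [qe htT, q1 htT, q2 htT, hdδ] with r hr h1 h2 h3 hr'
    obtain ⟨-, hm, hp, -⟩ := hr hr'
    have h1' : ur (t, r) = d (t, r) - u t r / r := h1 hr'
    rw [h1', h2 hr', h3 hr'] at hm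
    rw [h1', h3 hr'] at hp
    refine ⟨hm, ?_⟩
    rw [← hp]
    ring
  · filter_upwards [qe htT] with r hr hr' using (hr hr').2.2.2
  · obtain ⟨v, hv, hv'⟩ := h.free_surface t htI
    have := HasDerivWithinAt.eq_of_tendsto_left hat hud hgc hv
    rw [this] at hv'
    linarith

/-! ### The transport theorem -/

/-- On a sufficiently fine partition every increment of K is dominated by one of W, and the
increments of W telescope to at most ε. In the transport theorem W collects the local errors. -/
lemma eq_of_forall_abs_sub_le {K : ℝ → ℝ} {s t : ℝ} (hst : s ≤ t)
    (h : ∀ ε > 0, ∃ W : ℝ → ℝ, W t - W s ≤ ε ∧ ∃ δ > 0, ∀ x ∈ Icc s t, ∀ y ∈ Icc s t, x ≤ y →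
      y - x < δ → |K y - K x| ≤ W y - W x) : K t = K s := by
  refine eq_of_abs_sub_le_all fun ε hε => ?_
  obtain ⟨W, hW, δ, hδ, hK⟩ := h ε hε
  obtain ⟨n, hn⟩ := exists_nat_gt ((t - s) / δ)
  have hn0 : (0 : ℝ) < n + 1 := by positivity
  set x : ℕ → ℝ := fun i => s + i * ((t - s) / (n + 1)) with hx
  have hh : 0 ≤ (t - s) / (n + 1) := div_nonneg (by linarith) hn0.le
  have hx0 : x 0 = s := by simp [hx]
  have hxn : x (n + 1) = t := by
    simp only [hx]
    push_cast
    field_simp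
    ring
  have hstep : ∀ i, x (i + 1) - x i = (t - s) / (n + 1) := fun i => by
    simp only [hx]
    push_cast
    ring
  have hmono : Monotone x := monotone_nat_of_le_succ fun i => by linarith [hstep i]
  have hmem : ∀ i ≤ n + 1, x i ∈ Icc s t := fun i hi =>
    ⟨hx0 ▸ hmono (Nat.zero_le i), hxn ▸ hmono hi⟩
  have hlt : (t - s) / (n + 1) < δ := by
    rw [div_lt_iff₀ hn0]
    rw [div_lt_iff₀ hδ] at hn
    nlinarith
  have h1 : K t - K s = ∑ i ∈ Finset.range (n + 1), (K (x (i + 1)) - K (x i)) := by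
    rw [Finset.sum_range_sub (fun i => K (x i)), hx0, hxn]
  have h2 : W t - W s = ∑ i ∈ Finset.range (n + 1), (W (x (i + 1)) - W (x i)) := by
    rw [Finset.sum_range_sub (fun i => W (x i)), hx0, hxn]
  calc |K t - K s| ≤ ∑ i ∈ Finset.range (n + 1), |K (x (i + 1)) - K (x i)| := by
        rw [h1]
        exact Finset.abs_sum_le_sum_abs _ _
    _ ≤ ∑ i ∈ Finset.range (n + 1), (W (x (i + 1)) - W (x i)) := by
        refine Finset.sum_le_sum fun i hi => ?_
        have hi' := Finset.mem_range.1 hi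
        exact hK _ (hmem i hi'.le) _ (hmem (i + 1) hi') (hmono (Nat.le_succ i))
          ((hstep i).trans_lt hlt)
    _ ≤ ε := h2 ▸ hW

section Transport

variable {a : ℝ → ℝ} {T : ℝ}

/-- The closure of the radial space-time domain. -/
def closedRadialSpaceTime (a : ℝ → ℝ) (T : ℝ) : Set (ℝ × ℝ) :=
  {z | z.1 ∈ Icc 0 T ∧ z.2 ∈ Icc 0 (a z.1)}

/-- Rescaling the radius by a(t) presents the set as a continuous image of a rectangle. -/
lemma isCompact_closedRadialSpaceTime (ha : ContinuousOn a (Icc 0 T))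
    (ha0 : ∀ t ∈ Icc 0 T, 0 < a t) : IsCompact (closedRadialSpaceTime a T) := by
  have h1 : IsCompact (Icc 0 T ×ˢ Icc (0 : ℝ) 1) := isCompact_Icc.prod isCompact_Icc
  have h2 : ContinuousOn (fun z : ℝ × ℝ => (z.1, z.2 * a z.1)) (Icc 0 T ×ˢ Icc (0 : ℝ) 1) :=
    continuousOn_fst.prodMk (continuousOn_snd.mul (ha.comp continuousOn_fst fun z hz => hz.1))
  convert h1.image_of_continuousOn h2 using 1
  ext ⟨t, r⟩
  simp only [closedRadialSpaceTime, mem_ofPred_eq, mem_image, mem_prod, Prod.mk.injEq, Prod.exists]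
  constructor
  · rintro ⟨ht, hr⟩
    have := ha0 t ht
    exact ⟨t, r / a t, ⟨ht, div_nonneg hr.1 this.le, div_le_one_of_le₀ hr.2 this.le⟩, rfl,
      div_mul_cancel₀ _ this.ne'⟩
  · rintro ⟨t, s, ⟨ht, hs⟩, rfl, rfl⟩
    have := ha0 t ht
    exact ⟨ht, mul_nonneg hs.1 this.le, mul_le_of_le_one_left this.le hs.2⟩

lemma IsContinuousProfile.comp_path {f : ℝ → ℝ → ℝ} (hf : IsContinuousProfile a T f) {R : ℝ → ℝ}
    (hR : ContinuousOn R (Icc 0 T)) (hRa : ∀ t ∈ Icc 0 T, R t ∈ Icc 0 (a t)) :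
    ContinuousOn (fun t => f t (R t)) (Icc 0 T) :=
  ContinuousOn.comp (f := fun t => (t, R t)) hf (continuousOn_id.prodMk hR)
    fun t ht => ⟨ht, hRa t ht⟩

/-- The transport theorem on a rectangle. -/
lemma IsTimePrimitive.integral_sub {f : ℝ → ℝ → ℝ} {ft : ℝ × ℝ → ℝ}
    (hf : IsContinuousProfile a T f) (hft : IsTimePrimitive a T f ft)
    (hi : IntegrableOn ft (radialSpaceTime a T)) {t₁ t₂ β : ℝ} (h₁ : 0 ≤ t₁) (h₁₂ : t₁ < t₂)
    (h₂ : t₂ ≤ T) (hβ : 0 < β) (hβa : ∀ t ∈ Icc t₁ t₂, β ≤ a t) :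
    ∫ t in t₁..t₂, ∫ r in (0 : ℝ)..β, ft (t, r)
      = (∫ r in (0 : ℝ)..β, f t₂ r) - ∫ r in (0 : ℝ)..β, f t₁ r := by
  have hsub : Ioo t₁ t₂ ×ˢ Ioo 0 β ⊆ radialSpaceTime a T := fun z hz =>
    ⟨⟨h₁.trans_lt hz.1.1, hz.1.2.trans_le h₂⟩, hz.2.1,
      hz.2.2.trans_le (hβa _ (Ioo_subset_Icc_self hz.1))⟩
  have hmem : ∀ t ∈ Icc t₁ t₂, t ∈ Icc 0 T := fun t ht => ⟨h₁.trans ht.1, ht.2.trans h₂⟩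
  have hi' := hi.mono_set hsub
  rw [IntegrableOn, Measure.volume_eq_prod, ← Measure.prod_restrict] at hi'
  have h1 : ∀ᵐ r, ∀ x₁ x₂ y₁ y₂ : ℚ, Icc (x₁ : ℝ) x₂ ×ˢ Icc (y₁ : ℝ) y₂ ⊆ radialSpaceTime a T →
      r ∈ Ioo (y₁ : ℝ) y₂ → IsPrimitiveOn (fun t => f t r) (fun t => ft (t, r))
        (Ioo (x₁ : ℝ) x₂) := by
    simp only [ae_all_iff]
    intro x₁ x₂ y₁ y₂ h
    exact hft x₁ x₂ y₁ y₂ h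
  have h2 : ∀ᵐ r, r ∈ Ioo 0 β → ∫ t in t₁..t₂, ft (t, r) = f t₂ r - f t₁ r := by
    have h3 := hi'.swap.prod_right_ae
    rw [ae_restrict_iff' measurableSet_Ioo] at h3
    filter_upwards [h1, h3] with r hr hr3 hr'
    have hp : IsPrimitiveOn (fun t => f t r) (fun t => ft (t, r)) (Ioo t₁ t₂) := by
      intro x hx y hy
      obtain ⟨x₁, k1, k1'⟩ := exists_rat_btwn (lt_min hx.1 hy.1)
      obtain ⟨x₂, k2, k2'⟩ := exists_rat_btwn (max_lt hx.2 hy.2)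
      obtain ⟨y₁, k3, k3'⟩ := exists_rat_btwn hr'.1
      obtain ⟨y₂, k4, k4'⟩ := exists_rat_btwn hr'.2
      refine hr x₁ x₂ y₁ y₂ ((Set.prod_mono (Icc_subset_Ioo k1 k2') (Icc_subset_Ioo k3 k4')).trans
        hsub) ⟨k3', k4⟩ x
        ⟨k1'.trans_le (min_le_left _ _), (le_max_left _ _).trans_lt k2⟩ y
        ⟨k1'.trans_le (min_le_right _ _), (le_max_right _ _).trans_lt k2⟩
    refine (hp.Icc_of_Ioo h₁₂ ?_ (hr3 hr') t₁ (left_mem_Icc.2 h₁₂.le) t₂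
      (right_mem_Icc.2 h₁₂.le)).2
    exact ContinuousOn.comp (f := fun t => (t, r)) hf (by fun_prop) fun t ht =>
      ⟨hmem t ht, hr'.1.le, hr'.2.le.trans (hβa t ht)⟩
  have hsl : ∀ t ∈ Icc t₁ t₂, IntervalIntegrable (f t) volume 0 β := fun t ht =>
    ((hf.slice (hmem t ht)).mono (Icc_subset_Icc_right (hβa t ht))).intervalIntegrable_of_Icc hβ.le
  rw [← intervalIntegral.integral_sub (hsl _ (right_mem_Icc.2 h₁₂.le))
    (hsl _ (left_mem_Icc.2 h₁₂.le))]
  simp only [intervalIntegral.integral_of_le h₁₂.le, intervalIntegral.integral_of_le hβ.le,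
    integral_Ioc_eq_integral_Ioo] at h2 ⊢
  rw [integral_integral_swap (f := fun t r => ft (t, r)) hi']
  exact setIntegral_congr_ae measurableSet_Ioo h2

/-- The transport theorem for a moving interval `(0, R(t))`. -/
theorem IsTimePrimitive.isPrimitiveOn_integral (ha : ContinuousOn a (Icc 0 T))
    (ha0 : ∀ t ∈ Icc 0 T, 0 < a t) {f : ℝ → ℝ → ℝ} {ft : ℝ × ℝ → ℝ}
    (hf : IsContinuousProfile a T f) (hft : IsTimePrimitive a T f ft)
    (hi : IntegrableOn ft (radialSpaceTime a T)) {R R' : ℝ → ℝ}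
    (hR : ∀ t ∈ Icc 0 T, HasDerivWithinAt R (R' t) (Icc 0 T) t) (hR' : ContinuousOn R' (Icc 0 T))
    (hRa : ∀ t ∈ Icc 0 T, R t ∈ Icc 0 (a t)) :
    IsPrimitiveOn (fun t => ∫ r in (0 : ℝ)..R t, f t r)
      (fun t => f t (R t) * R' t + ∫ r in (0 : ℝ)..R t, ft (t, r)) (Icc 0 T) := by
  have hao := ha.mono (Ioo_subset_Icc_self (a := (0 : ℝ)) (b := T))
  have hRc : ContinuousOn R (Icc 0 T) := fun t ht => (hR t ht).continuousWithinAt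
  have hc1 : ContinuousOn (fun t => f t (R t) * R' t) (Icc 0 T) := (hf.comp_path hRc hRa).mul hR'
  -- the measurable strips
  have hS : ∀ η : ℝ, MeasurableSet {z | z ∈ radialSpaceTime a T ∧ R z.1 - η < z.2 ∧ z.2 < R z.1} := by
    intro η
    have h1 : ContinuousOn (fun z : ℝ × ℝ => R z.1 - z.2) (radialSpaceTime a T) :=
      (hRc.comp continuousOn_fst fun z hz => Ioo_subset_Icc_self hz.1).sub continuousOn_snd
    have h2 := (h1.isOpen_inter_preimage (isOpen_radialSpaceTime hao)
      (isOpen_Ioo (a := 0) (b := η))).measurableSet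
    convert h2 using 1
    ext z
    simp only [mem_ofPred_eq, mem_inter_iff, mem_preimage, mem_Ioo]
    constructor
    · rintro ⟨h, h', h''⟩
      exact ⟨h, by linarith, by linarith⟩
    · rintro ⟨h, h', h''⟩
      exact ⟨h, by linarith, by linarith⟩
  set S : ℝ → Set (ℝ × ℝ) := fun η =>
    {z | z ∈ radialSpaceTime a T ∧ R z.1 - η < z.2 ∧ z.2 < R z.1} with hSdef
  have hSi : ∀ η, IntegrableOn ((S η).indicator fun z => |ft z|) (radialSpaceTime a T) :=
    fun η => (Integrable.abs hi).indicator (hS η)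
  set M : ℝ → ℝ → ℝ := fun η t => ∫ r in Ioo 0 (a t), (S η).indicator (fun z => |ft z|) (t, r)
    with hM
  have hMi : ∀ η, IntegrableOn (M η) (Ioo 0 T) := fun η =>
    (integrableOn_radialSpaceTime_slice hao (hSi η)).2.1
  have hM0 : ∀ η t, 0 ≤ M η t := fun η t =>
    integral_nonneg fun r => indicator_nonneg (fun z _ => abs_nonneg (ft z)) _
  -- The strips of width η below the curve r = R(t) shrink to the empty set, so |f_t| has small
  -- integral over them by dominated convergence. This replaces a pointwise bound on f_t, which is
  -- not available.
  have hMlim : Tendsto (fun n : ℕ => ∫ t in Ioo 0 T, M (1 / ((n : ℝ) + 1)) t) atTop (𝓝 0) := by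
    simp_rw [hM, ← (integrableOn_radialSpaceTime_slice hao (hSi _)).2.2]
    have h0 : (0 : ℝ) = ∫ z in radialSpaceTime a T, (fun _ => (0 : ℝ)) z := by simp
    rw [h0]
    refine tendsto_integral_of_dominated_convergence (fun z => |ft z|)
      (fun n => (hSi _).aestronglyMeasurable) (Integrable.abs hi)
      (fun n => Eventually.of_forall fun z => ?_) (Eventually.of_forall fun z => ?_)
    · rw [Real.norm_eq_abs, abs_of_nonneg (indicator_nonneg (fun z _ => abs_nonneg (ft z)) _)]
      exact indicator_le_self' (fun _ _ => abs_nonneg _) z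
    · refine tendsto_const_nhds.congr' ?_
      rcases lt_or_ge z.2 (R z.1) with hz | hz
      · have := (tendsto_one_div_add_atTop_nhds_zero_nat (𝕜 := ℝ)).eventually
          (gt_mem_nhds (sub_pos.2 hz))
        filter_upwards [this] with n hn
        rw [indicator_of_notMem]
        rintro ⟨-, h1, -⟩
        linarith
      · filter_upwards with n
        rw [indicator_of_notMem]
        rintro ⟨-, -, h1⟩
        linarith
  -- integrability of the inner integral
  set N : ℝ → ℝ := fun t => ∫ r in (0 : ℝ)..R t, ft (t, r) with hN
  have hNi : IntegrableOn N (Ioo 0 T) := by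
    have hSR : MeasurableSet {z | z ∈ radialSpaceTime a T ∧ z.2 < R z.1} := by
      have h1 : ContinuousOn (fun z : ℝ × ℝ => R z.1 - z.2) (radialSpaceTime a T) :=
        (hRc.comp continuousOn_fst fun z hz => Ioo_subset_Icc_self hz.1).sub continuousOn_snd
      have h2 := (h1.isOpen_inter_preimage (isOpen_radialSpaceTime hao)
        (isOpen_Ioi (a := 0))).measurableSet
      convert h2 using 1
      ext z
      simp [sub_pos]
    have h1 := (integrableOn_radialSpaceTime_slice hao (Integrable.indicator hi hSR)).2.1
    refine h1.congr_fun (fun t ht => ?_) measurableSet_Ioo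
    have hRt := hRa t (Ioo_subset_Icc_self ht)
    simp only [hN]
    rw [intervalIntegral.integral_of_le hRt.1, integral_Ioc_eq_integral_Ioo,
      ← inter_eq_self_of_subset_right (Ioo_subset_Ioo_right hRt.2 : Ioo 0 (R t) ⊆ Ioo 0 (a t)),
      ← setIntegral_indicator measurableSet_Ioo]
    refine setIntegral_congr_fun measurableSet_Ioo fun r hr => ?_
    by_cases h : r < R t
    · rw [indicator_of_mem (show r ∈ Ioo 0 (R t) from ⟨hr.1, h⟩),
        indicator_of_mem (show (t, r) ∈ {z | z ∈ radialSpaceTime a T ∧ z.2 < R z.1} from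
          ⟨⟨ht, hr⟩, h⟩)]
    · rw [indicator_of_notMem (fun h' : r ∈ Ioo 0 (R t) => h h'.2),
        indicator_of_notMem (fun h' : (t, r) ∈ {z | z ∈ radialSpaceTime a T ∧ z.2 < R z.1} =>
          h h'.2)]
  have hii : ∀ {g : ℝ → ℝ}, IntegrableOn g (Ioo 0 T) → ∀ x ∈ Icc 0 T, ∀ y ∈ Icc 0 T,
      IntervalIntegrable g volume x y := by
    intro g hg x hx y hy
    rw [intervalIntegrable_iff]
    refine ((integrableOn_Icc_iff_integrableOn_Ioo).2 hg).mono_set ?_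
    exact uIoc_subset_uIcc.trans (ordConnected_Icc.uIcc_subset hx hy)
  have hc1i : ∀ x ∈ Icc 0 T, ∀ y ∈ Icc 0 T,
      IntervalIntegrable (fun t => f t (R t) * R' t) volume x y := fun x hx y hy =>
    (hc1.mono (ordConnected_Icc.uIcc_subset hx hy)).intervalIntegrable
  set J : ℝ → ℝ := fun t => f t (R t) * R' t + N t with hJ
  have hJi : ∀ x ∈ Icc 0 T, ∀ y ∈ Icc 0 T, IntervalIntegrable J volume x y := fun x hx y hy =>
    (hc1i x hx y hy).add (hii hNi x hx y hy)
  suffices hmain : ∀ x ∈ Icc 0 T, ∀ y ∈ Icc 0 T, x ≤ y →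
      (∫ r in (0 : ℝ)..R y, f y r) - ∫ s in x..y, J s = ∫ r in (0 : ℝ)..R x, f x r by
    refine fun x hx y hy => ⟨hJi x hx y hy, ?_⟩
    rcases le_total x y with hxy | hxy
    · linarith [hmain x hx y hy hxy]
    · rw [intervalIntegral.integral_symm]
      linarith [hmain y hy x hx hxy]
  intro x hx y hy hxy
  have hT0 : 0 ≤ T := hx.1.trans hx.2
  set K : ℝ → ℝ := fun z => (∫ r in (0 : ℝ)..R z, f z r) - ∫ s in x..z, J s with hK
  suffices hKK : K y = K x by simpa [hK] using hKK
  refine eq_of_forall_abs_sub_le hxy fun ε hε => ?_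
  obtain ⟨L, hL⟩ := isCompact_Icc.exists_bound_of_continuousOn hR'
  have hL0 : 0 ≤ L := (norm_nonneg _).trans (hL x hx)
  have hLip : ∀ s ∈ Icc 0 T, ∀ t ∈ Icc 0 T, |R t - R s| ≤ L * |t - s| := fun s hs t ht =>
    (convex_Icc 0 T).norm_image_sub_le_of_norm_hasDerivWithin_le hR hL hs ht
  obtain ⟨n, hn⟩ := ((hMlim.eventually (gt_mem_nhds (half_pos hε)))).exists
  set η : ℝ := 1 / ((n : ℝ) + 1) with hη
  have hη0 : 0 < η := by positivity
  -- The tolerance for the oscillation of f. Three error terms of size κ L (q - p) add up to at most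
  -- ε/2 over the whole interval; the strips take the other half of ε.
  set κ : ℝ := ε / (6 * (L + 1) * (T + 1)) with hκ
  have hκ0 : 0 < κ := by positivity
  have hκε : 3 * κ * L * T ≤ ε / 2 := by
    have h1 : κ * (6 * (L + 1) * (T + 1)) = ε := by
      rw [hκ]
      field_simp
    have h2 : L * T ≤ (L + 1) * (T + 1) := by nlinarith
    nlinarith
  have huc := (isCompact_closedRadialSpaceTime ha ha0).uniformContinuousOn_of_continuous hf
  obtain ⟨δ₀, hδ₀, hunif⟩ := Metric.uniformContinuousOn_iff.1 huc κ hκ0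
  -- The linear part pays for the oscillation of f near the curve, the integral for the strip. The
  -- step size keeps both q - p and L (q - p) below the continuity modulus, and L (q - p) below the
  -- strip width.
  refine ⟨fun z => 3 * κ * L * z + ∫ s in x..z, M η s, ?_, min δ₀ η / (L + 1),
    div_pos (lt_min hδ₀ hη0) (by positivity), ?_⟩
  · have h1 : ∫ s in x..y, M η s ≤ ∫ s in Ioo 0 T, M η s := by
      rw [intervalIntegral.integral_of_le hxy, integral_Ioc_eq_integral_Ioo]
      exact setIntegral_mono_set (hMi η) (Eventually.of_forall fun t => hM0 η t)
        (Ioo_subset_Ioo hx.1 hy.2).eventuallyLE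
    have h2 : 3 * κ * L * (y - x) ≤ 3 * κ * L * T :=
      mul_le_mul_of_nonneg_left (by linarith [hx.1, hy.2]) (by positivity)
    simp only [intervalIntegral.integral_same]
    linarith
  intro p hp q hq hpq hqp
  have hp' : p ∈ Icc 0 T := ⟨hx.1.trans hp.1, hp.2.trans hy.2⟩
  have hq' : q ∈ Icc 0 T := ⟨hx.1.trans hq.1, hq.2.trans hy.2⟩
  rcases hpq.eq_or_lt with rfl | hpq'
  · simp
  have hmem : ∀ t ∈ Icc p q, t ∈ Icc 0 T := fun t ht => ⟨hp'.1.trans ht.1, ht.2.trans hq'.2⟩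
  rw [lt_div_iff₀ (by positivity)] at hqp
  have hq1 : q - p < δ₀ := by nlinarith [min_le_left δ₀ η, sub_nonneg.2 hpq]
  have hq2 : L * (q - p) < δ₀ := by nlinarith [min_le_left δ₀ η, sub_nonneg.2 hpq]
  have hq3 : L * (q - p) < η := by nlinarith [min_le_right δ₀ η, sub_nonneg.2 hpq]
  -- With β the minimum of R on [p, q], the rectangle [p, q] × [0, β] lies below the curve, where
  -- the fixed-domain theorem applies. What remains is within L (q - p) of the curve.
  obtain ⟨τ, hτ, hτmin⟩ := isCompact_Icc.exists_isMinOn (nonempty_Icc.2 hpq)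
    (hRc.mono fun t ht => hmem t ht)
  set β := R τ with hβ
  have hβ0 : 0 ≤ β := (hRa τ (hmem τ hτ)).1
  have hβR : ∀ t ∈ Icc p q, β ≤ R t := fun t ht => hτmin ht
  have hβa : ∀ t ∈ Icc p q, β ≤ a t := fun t ht => (hβR t ht).trans (hRa t (hmem t ht)).2
  have hRβ : ∀ t ∈ Icc p q, ∀ s ∈ Icc p q, |R t - R s| ≤ L * (q - p) := fun t ht s hs => by
    refine (hLip s (hmem s hs) t (hmem t ht)).trans (mul_le_mul_of_nonneg_left ?_ hL0)
    rw [abs_le]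
    constructor <;> linarith [ht.1, ht.2, hs.1, hs.2]
  have hpm : p ∈ Icc p q := left_mem_Icc.2 hpq
  have hqm : q ∈ Icc p q := right_mem_Icc.2 hpq
  set c := f p (R p) with hc
  have hosc : ∀ t ∈ Icc p q, ∀ r ∈ Icc β (R t), |f t r - c| ≤ κ := by
    intro t ht r hr
    have h1 : (t, r) ∈ {z : ℝ × ℝ | z.1 ∈ Icc 0 T ∧ z.2 ∈ Icc 0 (a z.1)} :=
      ⟨hmem t ht, hβ0.trans hr.1, hr.2.trans (hRa t (hmem t ht)).2⟩
    have h2 : (p, R p) ∈ {z : ℝ × ℝ | z.1 ∈ Icc 0 T ∧ z.2 ∈ Icc 0 (a z.1)} := ⟨hp', hRa p hp'⟩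
    refine (hunif _ h1 _ h2 ?_).le
    rw [Prod.dist_eq, max_lt_iff, Real.dist_eq, Real.dist_eq]
    constructor
    · rw [abs_of_nonneg (by linarith [ht.1])]
      linarith [ht.2]
    · have h3 := abs_le.1 (hRβ t ht p hpm)
      have h4 := abs_le.1 (hRβ τ hτ p hpm)
      refine lt_of_le_of_lt (abs_le.2 ⟨?_, ?_⟩) hq2
      · linarith [hr.1]
      · linarith [hr.2]
  have hint : ∀ t ∈ Icc p q, ∀ x₁ ∈ Icc 0 (a t), ∀ x₂ ∈ Icc 0 (a t),
      IntervalIntegrable (f t) volume x₁ x₂ := fun t ht x₁ h₁ x₂ h₂ =>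
    ((hf.slice (hmem t ht)).mono (ordConnected_Icc.uIcc_subset h₁ h₂)).intervalIntegrable
  have h0m : ∀ t ∈ Icc p q, (0 : ℝ) ∈ Icc 0 (a t) := fun t ht => ⟨le_rfl, (ha0 t (hmem t ht)).le⟩
  have hβm : ∀ t ∈ Icc p q, β ∈ Icc 0 (a t) := fun t ht => ⟨hβ0, hβa t ht⟩
  have hsplit : ∀ t ∈ Icc p q, ∫ r in (0 : ℝ)..R t, f t r
      = (∫ r in (0 : ℝ)..β, f t r) + (∫ r in β..R t, (f t r - c)) + c * (R t - β) := by
    intro t ht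
    rw [intervalIntegral.integral_sub (hint t ht _ (hβm t ht) _ (hRa t (hmem t ht))) (by simp),
      ← intervalIntegral.integral_add_adjacent_intervals (hint t ht _ (h0m t ht) _ (hβm t ht))
        (hint t ht _ (hβm t ht) _ (hRa t (hmem t ht)))]
    simp only [intervalIntegral.integral_const, smul_eq_mul]
    ring
  have hsmall : ∀ t ∈ Icc p q, |∫ r in β..R t, (f t r - c)| ≤ κ * (L * (q - p)) := by
    intro t ht
    have h1 : ∀ r ∈ uIoc β (R t), ‖f t r - c‖ ≤ κ := fun r hr => by
      rw [uIoc_of_le (hβR t ht)] at hr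
      exact hosc t ht r (Ioc_subset_Icc_self hr)
    exact (intervalIntegral.norm_integral_le_of_norm_le_const h1).trans
      (mul_le_mul_of_nonneg_left (hRβ t ht τ hτ) hκ0.le)
  have hpath : |∫ t in p..q, (f t (R t) * R' t - c * R' t)| ≤ κ * L * (q - p) := by
    have h1 : ∀ t ∈ uIoc p q, ‖f t (R t) * R' t - c * R' t‖ ≤ κ * L := fun t ht => by
      rw [uIoc_of_le hpq] at ht
      have ht' := Ioc_subset_Icc_self ht
      rw [← sub_mul, norm_mul]
      exact mul_le_mul (hosc t ht' _ ⟨hβR t ht', le_rfl⟩) (hL t (hmem t ht')) (norm_nonneg _) hκ0.le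
    have h2 := intervalIntegral.norm_integral_le_of_norm_le_const h1
    rwa [abs_of_nonneg (sub_nonneg.2 hpq)] at h2
  have hR'i : IntervalIntegrable R' volume p q :=
    (hR'.mono (ordConnected_Icc.uIcc_subset hp' hq')).intervalIntegrable
  have hRint : ∫ t in p..q, R' t = R q - R p := by
    refine intervalIntegral.integral_eq_sub_of_hasDerivAt_of_le hpq (hRc.mono fun t ht => hmem t ht)
      (fun t ht => (hR t (hmem t (Ioo_subset_Icc_self ht))).hasDerivAt
        (Icc_mem_nhds (hp'.1.trans_lt ht.1) (ht.2.trans_le hq'.2))) hR'i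
  have hrect : (∫ r in (0 : ℝ)..β, f q r) - (∫ r in (0 : ℝ)..β, f p r)
      = ∫ t in p..q, ∫ r in (0 : ℝ)..β, ft (t, r) := by
    rcases hβ0.eq_or_lt with h | h
    · rw [← h]
      simp
    · exact (hft.integral_sub hf hi hp'.1 hpq' hq'.2 h hβa).symm
  have hsl := (integrableOn_radialSpaceTime_slice hao hi).1
  have hslS := (integrableOn_radialSpaceTime_slice hao (hSi η)).1
  have hNβ : ∀ᵐ t, t ∈ Ioo p q → (∫ r in (0 : ℝ)..β, ft (t, r)) = N t - ∫ r in β..R t, ft (t, r) ∧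
      |∫ r in β..R t, ft (t, r)| ≤ M η t := by
    filter_upwards [hsl, hslS] with t ht htS htpq
    have ht' := Ioo_subset_Icc_self htpq
    have htT : t ∈ Ioo 0 T := ⟨hp'.1.trans_lt htpq.1, htpq.2.trans_le hq'.2⟩
    have hI : ∀ x₁ ∈ Icc 0 (a t), ∀ x₂ ∈ Icc 0 (a t),
        IntervalIntegrable (fun r => ft (t, r)) volume x₁ x₂ := by
      intro x₁ h₁ x₂ h₂
      rw [intervalIntegrable_iff]
      refine ((integrableOn_Icc_iff_integrableOn_Ioo).2 (ht htT)).mono_set ?_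
      exact uIoc_subset_uIcc.trans (ordConnected_Icc.uIcc_subset h₁ h₂)
    refine ⟨?_, ?_⟩
    · simp only [hN]
      rw [← intervalIntegral.integral_add_adjacent_intervals (hI _ (h0m t ht') _ (hβm t ht'))
        (hI _ (hβm t ht') _ (hRa t (hmem t ht')))]
      ring
    · rw [← Real.norm_eq_abs]
      refine (intervalIntegral.norm_integral_le_integral_norm (hβR t ht')).trans ?_
      rw [intervalIntegral.integral_of_le (hβR t ht'), integral_Ioc_eq_integral_Ioo]
      have hsub : Ioo β (R t) ⊆ Ioo 0 (a t) := Ioo_subset_Ioo hβ0 (hRa t (hmem t ht')).2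
      calc ∫ r in Ioo β (R t), ‖ft (t, r)‖
          = ∫ r in Ioo β (R t), (S η).indicator (fun z => |ft z|) (t, r) := by
            refine setIntegral_congr_fun measurableSet_Ioo fun r hr => ?_
            have h1 := abs_le.1 (hRβ t ht' τ hτ)
            have h2 : (t, r) ∈ S η := by
              refine ⟨⟨htT, hsub hr⟩, ?_, hr.2⟩
              have := hr.1
              simp only
              linarith
            rw [indicator_of_mem h2]
            rfl
        _ ≤ _ := setIntegral_mono_set (htS htT)
            (Eventually.of_forall fun r => indicator_nonneg (fun z _ => abs_nonneg (ft z)) _)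
            hsub.eventuallyLE
  have hNsub : |(∫ t in p..q, N t) - ∫ t in p..q, ∫ r in (0 : ℝ)..β, ft (t, r)|
      ≤ ∫ t in p..q, M η t := by
    have hβi : IntervalIntegrable (fun t => ∫ r in (0 : ℝ)..β, ft (t, r)) volume p q := by
      rw [intervalIntegrable_iff_integrableOn_Ioo_of_le hpq]
      have hsub : Ioo p q ×ˢ Ioo 0 β ⊆ radialSpaceTime a T := fun z hz =>
        ⟨⟨hp'.1.trans_lt hz.1.1, hz.1.2.trans_le hq'.2⟩, hz.2.1,
          hz.2.2.trans_le (hβa _ (Ioo_subset_Icc_self hz.1))⟩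
      have h1 := hi.mono_set hsub
      rw [IntegrableOn, Measure.volume_eq_prod, ← Measure.prod_restrict] at h1
      simp only [intervalIntegral.integral_of_le hβ0, integral_Ioc_eq_integral_Ioo]
      exact h1.integral_prod_left
    rw [← intervalIntegral.integral_sub (hii hNi p hp' q hq') hβi]
    rw [← Real.norm_eq_abs]
    refine intervalIntegral.norm_integral_le_of_norm_le hpq ?_ (hii (hMi η) p hp' q hq')
    have hne : ∀ᵐ t : ℝ, t ≠ q := by simp [ae_iff]
    filter_upwards [hNβ, hne] with t ht hne ht'
    obtain ⟨h1, h2⟩ := ht ⟨ht'.1, lt_of_le_of_ne ht'.2 hne⟩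
    rw [h1, sub_sub_cancel]
    exact h2
  -- Freezing f at the value c near the curve, the main terms c (R q - R p) from the integral and
  -- from the boundary flux cancel, and so do the rectangle terms. Only the four small errors
  -- estimated above remain.
  have hKq : K q - K p = (∫ r in β..R q, (f q r - c)) - (∫ r in β..R p, (f p r - c))
      - (∫ t in p..q, (f t (R t) * R' t - c * R' t))
      - ((∫ t in p..q, N t) - ∫ t in p..q, ∫ r in (0 : ℝ)..β, ft (t, r)) := by
    have h1 : ∫ s in x..q, J s = (∫ s in x..p, J s) + ∫ s in p..q, J s :=
      (intervalIntegral.integral_add_adjacent_intervals (hJi x hx p hp') (hJi p hp' q hq')).symm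
    have h2 : ∫ s in p..q, J s = (∫ s in p..q, f s (R s) * R' s) + ∫ s in p..q, N s :=
      intervalIntegral.integral_add (hc1i p hp' q hq') (hii hNi p hp' q hq')
    have h3 : ∫ t in p..q, (f t (R t) * R' t - c * R' t)
        = (∫ s in p..q, f s (R s) * R' s) - c * (R q - R p) := by
      rw [intervalIntegral.integral_sub (hc1i p hp' q hq') (hR'i.const_mul c),
        intervalIntegral.integral_const_mul, hRint]
    simp only [hK]
    rw [hsplit q hqm, hsplit p hpm, h1, h2, h3, ← hrect]
    ring
  have hMq : ∫ s in x..q, M η s = (∫ s in x..p, M η s) + ∫ s in p..q, M η s :=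
    (intervalIntegral.integral_add_adjacent_intervals (hii (hMi η) x hx p hp')
      (hii (hMi η) p hp' q hq')).symm
  rw [hKq]
  simp only [hMq]
  have b1 := abs_le.1 (hsmall q hqm)
  have b2 := abs_le.1 (hsmall p hpm)
  have b3 := abs_le.1 hpath
  have b4 := abs_le.1 hNsub
  rw [abs_le]
  constructor <;> linarith

end Transport

/-! ### Particle paths -/

/-- Averages of a continuous vector field, which are Lipschitz in space. -/
lemma exists_lipschitz_approx {v : ℝ → ℝ → ℝ} (hv : Continuous fun z : ℝ × ℝ => v z.1 z.2) {M : ℝ}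
    (hM : ∀ t x, |v t x| ≤ M) {h : ℝ} (hh : 0 < h) :
    ∃ w : ℝ → ℝ → ℝ, (∀ x, Continuous fun t => w t x) ∧
      (∃ K : ℝ≥0, ∀ t, LipschitzWith K (w t)) ∧
      ∀ t x, ∃ ξ ∈ Icc x (x + h), w t x = v t ξ := by
  have hc : ∀ t, Continuous (v t) := fun t => hv.comp (by fun_prop : Continuous fun x => (t, x))
  have hi : ∀ t x y, IntervalIntegrable (v t) volume x y := fun t x y => (hc t).intervalIntegrable _ _
  have hM0 : 0 ≤ M := (abs_nonneg _).trans (hM 0 0)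
  set V : ℝ → ℝ → ℝ := fun t x => ∫ y in (0 : ℝ)..x, v t y with hV
  have hVd : ∀ t x, HasDerivAt (V t) (v t x) x := fun t x =>
    intervalIntegral.integral_hasDerivAt_right (hi t 0 x)
      ((hc t).stronglyMeasurableAtFilter _ _) (hc t).continuousAt
  have hVl : ∀ t x y, |V t x - V t y| ≤ M * |x - y| := by
    intro t x y
    simp only [hV]
    rw [intervalIntegral.integral_interval_sub_left (hi t _ _) (hi t _ _)]
    exact intervalIntegral.norm_integral_le_of_norm_le_const (f := v t) fun z _ => hM t z
  have hVc : ∀ x, Continuous fun t => V t x := fun x =>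
    intervalIntegral.continuous_parametric_intervalIntegral_of_continuous' (f := v) hv 0 x
  refine ⟨fun t x => h⁻¹ * (V t (x + h) - V t x), fun x => ?_, ⟨(h⁻¹ * (2 * M)).toNNReal,
    fun t => ?_⟩, fun t x => ?_⟩
  · exact continuous_const.mul ((hVc _).sub (hVc _))
  · refine LipschitzWith.of_dist_le_mul fun x y => ?_
    rw [Real.dist_eq, Real.dist_eq, ← mul_sub, abs_mul, abs_of_pos (inv_pos.2 hh)]
    have h1 := abs_le.1 (hVl t (x + h) (y + h))
    have h2 := abs_le.1 (hVl t x y)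
    rw [add_sub_add_right_eq_sub] at h1
    have h3 : |V t (x + h) - V t x - (V t (y + h) - V t y)| ≤ 2 * M * |x - y| := by
      rw [abs_le]
      constructor <;> linarith [h1.1, h1.2, h2.1, h2.2]
    calc _ ≤ h⁻¹ * (2 * M * |x - y|) := mul_le_mul_of_nonneg_left h3 (by positivity)
      _ = _ := by
        rw [Real.coe_toNNReal _ (by positivity)]
        ring
  · obtain ⟨ξ, hξ, hξ'⟩ := exists_hasDerivAt_eq_slope (V t) (v t) (show x < x + h by linarith)
      (fun z _ => (hVd t z).continuousAt.continuousWithinAt) (fun z _ => hVd t z)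
    refine ⟨ξ, Ioo_subset_Icc_self hξ, ?_⟩
    rw [hξ', add_sub_cancel_left]
    field_simp

/-- Peano's theorem for bounded vector fields on the line. -/
theorem exists_hasDerivWithinAt_of_continuous {v : ℝ → ℝ → ℝ}
    (hv : Continuous fun z : ℝ × ℝ => v z.1 z.2) {M : ℝ} (hM : ∀ t x, |v t x| ≤ M) {T : ℝ}
    (hT : 0 ≤ T) (x₀ : ℝ) :
    ∃ R : ℝ → ℝ, R 0 = x₀ ∧ ∀ t ∈ Icc 0 T, HasDerivWithinAt R (v t (R t)) (Icc 0 T) t := by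
  have hM0 : 0 ≤ M := (abs_nonneg _).trans (hM 0 0)
  have h0T : (0 : ℝ) ∈ Icc 0 T := ⟨le_rfl, hT⟩
  -- The fields are averaged over spatial windows of length 1/(n+1). They are Lipschitz in space, so
  -- Picard-Lindelöf applies, and their common bound M makes all solutions M-Lipschitz in time.
  choose w hwc hwl hwv using fun n : ℕ =>
    exists_lipschitz_approx hv hM (show (0 : ℝ) < 1 / ((n : ℝ) + 1) by positivity)
  have hwM : ∀ n t x, |w n t x| ≤ M := fun n t x => by
    obtain ⟨ξ, -, hξ⟩ := hwv n t x
    rw [hξ]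
    exact hM t ξ
  have hsol : ∀ n, ∃ R : ℝ → ℝ, R 0 = x₀ ∧
      ∀ t ∈ Icc 0 T, HasDerivWithinAt R (w n t (R t)) (Icc 0 T) t := by
    intro n
    obtain ⟨K, hK⟩ := hwl n
    have hPL : IsPicardLindelof (w n) (⟨0, h0T⟩ : Icc 0 T) x₀ (M * T).toNNReal 0
        M.toNNReal K :=
      { lipschitzOnWith := fun t _ => (hK t).lipschitzOnWith
        continuousOn := fun x _ => (hwc n x).continuousOn
        norm_le := fun t _ x _ => (hwM n t x).trans (Real.le_coe_toNNReal M)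
        mul_max_le := by
          rw [Real.coe_toNNReal _ hM0, Real.coe_toNNReal _ (mul_nonneg hM0 hT)]
          simp [hT] }
    exact hPL.exists_eq_forall_mem_Icc_hasDerivWithinAt₀
  choose R hR0 hRd using hsol
  have hRl : ∀ n, ∀ s ∈ Icc 0 T, ∀ t ∈ Icc 0 T, |R n t - R n s| ≤ M * |t - s| :=
    fun n s hs t ht => (convex_Icc 0 T).norm_image_sub_le_of_norm_hasDerivWithin_le (hRd n)
      (fun x _ => hwM n x _) hs ht
  have hRc : ∀ n, ContinuousOn (R n) (Icc 0 T) := fun n t ht => (hRd n t ht).continuousWithinAt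
  -- compactness
  set A : Set (BoundedContinuousFunction (Icc 0 T) ℝ) :=
    {F | (∀ s, F s ∈ Icc (x₀ - M * T) (x₀ + M * T)) ∧ ∀ s t, dist (F s) (F t) ≤ M * dist s t}
    with hA
  have hAc : IsCompact (closure A) := by
    refine BoundedContinuousFunction.arzela_ascoli (Icc (x₀ - M * T) (x₀ + M * T)) isCompact_Icc A
      (fun f x hf => hf.1 x) ?_
    have : ∀ F : A, LipschitzWith M.toNNReal (F : Icc 0 T → ℝ) := fun F =>
      LipschitzWith.of_dist_le_mul fun s t => by
        rw [Real.coe_toNNReal _ hM0]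
        exact F.2.2 s t
    exact (LipschitzWith.uniformEquicontinuous _ _ this).equicontinuous
  set G : ℕ → BoundedContinuousFunction (Icc 0 T) ℝ := fun n =>
    BoundedContinuousFunction.mkOfCompact ⟨(Icc 0 T).domRestrict (R n), (hRc n).domRestrict⟩ with hG
  have hGA : ∀ n, G n ∈ closure A := by
    refine fun n => subset_closure ⟨fun s => ?_, fun s t => ?_⟩
    · have h1 := hRl n 0 h0T s s.2
      rw [hR0, sub_zero, abs_of_nonneg s.2.1] at h1
      have h2 := abs_le.1 (h1.trans (mul_le_mul_of_nonneg_left s.2.2 hM0))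
      change R n s ∈ _
      constructor <;> linarith [h2.1, h2.2]
    · rw [dist_comm, dist_comm s t]
      exact hRl n s s.2 t t.2
  obtain ⟨F, -, φ, hφ, hF⟩ := hAc.tendsto_subseq hGA
  set Q : ℝ → ℝ := fun t => F (projIcc 0 T hT t) with hQ
  have hQc : Continuous Q := F.continuous.comp continuous_projIcc
  have hlim : ∀ t ∈ Icc 0 T, Tendsto (fun n => R (φ n) t) atTop (𝓝 (Q t)) := by
    intro t ht
    have h1 := (BoundedContinuousFunction.tendsto_iff_tendstoUniformly.1 hF).tendsto_at
      (projIcc 0 T hT t)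
    refine h1.congr fun n => ?_
    simp [hG, projIcc_of_mem hT ht]
  have hvQ : Continuous fun t => v t (Q t) := hv.comp (continuous_id.prodMk hQc)
  have hint : ∀ t ∈ Icc 0 T, Q t = x₀ + ∫ s in (0 : ℝ)..t, v s (Q s) := by
    intro t ht
    have hsub : Icc 0 t ⊆ Icc 0 T := Icc_subset_Icc_right ht.2
    have hwcont : ∀ n, ContinuousOn (fun s => w n s (R n s)) (Icc 0 T) := by
      intro n
      obtain ⟨K, hK⟩ := hwl n
      have : Continuous fun z : ℝ × ℝ => w n z.1 z.2 :=
        continuous_prod_of_continuous_lipschitzWith' _ K hK (hwc n)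
      exact this.comp_continuousOn (continuousOn_id.prodMk (hRc n))
    have h1 : ∀ n, R n t = x₀ + ∫ s in (0 : ℝ)..t, w n s (R n s) := by
      intro n
      rw [intervalIntegral.integral_eq_sub_of_hasDerivAt_of_le ht.1 ((hRc n).mono hsub)
        (fun s hs => (hRd n s (hsub (Ioo_subset_Icc_self hs))).hasDerivAt
          (Icc_mem_nhds hs.1 (hs.2.trans_le ht.2)))
        (((hwcont n).mono hsub).intervalIntegrable_of_Icc ht.1), hR0]
      ring
    have h2 : Tendsto (fun n => x₀ + ∫ s in (0 : ℝ)..t, w (φ n) s (R (φ n) s)) atTop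
        (𝓝 (x₀ + ∫ s in (0 : ℝ)..t, v s (Q s))) := by
      refine tendsto_const_nhds.add ?_
      refine intervalIntegral.tendsto_integral_filter_of_dominated_convergence (fun _ => M)
        (Eventually.of_forall fun n => ?_) (Eventually.of_forall fun n =>
          Eventually.of_forall fun s _ => hwM _ _ _) (by simp)
        (Eventually.of_forall fun s hs => ?_)
      · rw [uIoc_of_le ht.1]
        exact (((hwcont (φ n)).mono hsub).mono Ioc_subset_Icc_self).aestronglyMeasurable
          measurableSet_Ioc
      · rw [uIoc_of_le ht.1] at hs
        have hsT := hsub (Ioc_subset_Icc_self hs)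
        choose ξ hξ hξ' using fun n => hwv (φ n) s (R (φ n) s)
        simp_rw [hξ']
        -- By the mean value property the averaged field equals v at a point ξ within 1/(n+1) of the
        -- approximate solution. This gives pointwise convergence of the integrands, and domination
        -- by M does the rest.
        have h3 : Tendsto ξ atTop (𝓝 (Q s)) := by
          refine tendsto_of_tendsto_of_tendsto_of_le_of_le (hlim s hsT) (h := fun n =>
            R (φ n) s + 1 / ((φ n : ℝ) + 1)) ?_ (fun n => (hξ n).1) (fun n => (hξ n).2)
          simpa using (hlim s hsT).add
            ((tendsto_one_div_add_atTop_nhds_zero_nat (𝕜 := ℝ)).comp hφ.tendsto_atTop)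
        exact ((hv.comp (by fun_prop : Continuous fun x : ℝ => (s, x))).tendsto (Q s)).comp h3
    refine tendsto_nhds_unique (hlim t ht) (h2.congr fun n => (h1 (φ n)).symm)
  have hd : ∀ t, HasDerivAt (fun t => x₀ + ∫ s in (0 : ℝ)..t, v s (Q s)) (v t (Q t)) t := fun t =>
    (intervalIntegral.integral_hasDerivAt_right (hvQ.intervalIntegrable _ _)
      (hvQ.stronglyMeasurableAtFilter _ _) hvQ.continuousAt).const_add x₀
  refine ⟨Q, ?_, fun t ht => ?_⟩
  · simpa using hint 0 h0T
  · exact (hd t).hasDerivWithinAt.congr hint (hint t ht)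

/-- Compare with the barrier ε(1 + t). Where g touches it, g is positive, so its slope is zero and
below the slope ε of the barrier; then let ε tend to zero. -/
lemma nonpos_of_hasDerivWithinAt {g g' : ℝ → ℝ} {T : ℝ}
    (hg : ∀ t ∈ Icc 0 T, HasDerivWithinAt g (g' t) (Icc 0 T) t) (h0 : g 0 ≤ 0)
    (hg' : ∀ t ∈ Icc 0 T, 0 < g t → g' t = 0) : ∀ t ∈ Icc 0 T, g t ≤ 0 := by
  intro t ht
  have key : ∀ ε > 0, g t ≤ ε * (1 + t) := by
    intro ε hε
    refine image_le_of_deriv_right_lt_deriv_boundary' (f' := g') (B := fun s => ε * (1 + s))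
      (B' := fun _ => ε) (fun s hs => (hg s hs).continuousWithinAt) (fun s hs => ?_) (by simp; linarith)
      (by fun_prop) (fun s _ => ?_) (fun s hs he => ?_) ht
    · exact (hg s (Ico_subset_Icc_self hs)).mono_of_mem_nhdsWithin (Icc_mem_nhdsGE_of_mem hs)
    · have := (((hasDerivAt_id s).const_add 1).const_mul ε).hasDerivWithinAt (s := Ici s)
      simpa using this
    · rw [hg' s (Ico_subset_Icc_self hs)]
      · exact hε
      · rw [he]
        have := hs.1
        positivity
  by_contra! hlt
  have h1 : 0 < 1 + t := by linarith [ht.1]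
  have := key (g t / (2 * (1 + t))) (by positivity)
  have h2 : g t / (2 * (1 + t)) * (1 + t) = g t / 2 := by field_simp
  linarith

/-- The path of a particle. -/
lemma exists_particle_path {a : ℝ → ℝ} {T : ℝ} (hT : 0 ≤ T) {u : ℝ → ℝ → ℝ}
    (ha0 : ∀ t ∈ Icc 0 T, 0 < a t)
    (ha : ∀ t ∈ Icc 0 T, HasDerivWithinAt a (u t (a t)) (Icc 0 T) t)
    (hu : IsContinuousProfile a T u) (hu0 : ∀ t ∈ Icc 0 T, u t 0 = 0) {r₀ : ℝ}
    (hr₀ : r₀ ∈ Icc 0 (a 0)) :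
    ∃ R : ℝ → ℝ, R 0 = r₀ ∧ (∀ t ∈ Icc 0 T, HasDerivWithinAt R (u t (R t)) (Icc 0 T) t) ∧
      ∀ t ∈ Icc 0 T, R t ∈ Icc 0 (a t) := by
  have hac : ContinuousOn a (Icc 0 T) := fun t ht => (ha t ht).continuousWithinAt
  -- Clamping time to [0, T] and the radius to [0, a(t)] extends the velocity to a bounded
  -- continuous field on the plane. Beyond the free boundary the extension moves with speed a', and
  -- below the center it vanishes, so solutions cannot leave the domain.
  set τ : ℝ → ℝ := fun t => projIcc 0 T hT t with hτ
  have hτc : Continuous τ := continuous_subtype_val.comp continuous_projIcc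
  have hτm : ∀ t, τ t ∈ Icc 0 T := fun t => (projIcc 0 T hT t).2
  have hτe : ∀ t ∈ Icc 0 T, τ t = t := fun t ht => by simp [hτ, projIcc_of_mem hT ht]
  have haτ : Continuous fun t => a (τ t) := hac.comp_continuous hτc hτm
  set k : ℝ → ℝ → ℝ := fun t x => max 0 (min x (a (τ t))) with hk
  have hkm : ∀ t x, k t x ∈ Icc 0 (a (τ t)) := fun t x =>
    ⟨le_max_left _ _, max_le (ha0 _ (hτm t)).le (min_le_right _ _)⟩
  set v : ℝ → ℝ → ℝ := fun t x => u (τ t) (k t x) with hv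
  have hvc : Continuous fun z : ℝ × ℝ => v z.1 z.2 := by
    refine ContinuousOn.comp_continuous (f := fun z : ℝ × ℝ => (τ z.1, k z.1 z.2)) hu ?_
      fun z => ⟨hτm _, hkm _ _⟩
    exact (hτc.comp continuous_fst).prodMk
      (continuous_const.max (continuous_snd.min (haτ.comp continuous_fst)))
  obtain ⟨M, hM⟩ := (isCompact_closedRadialSpaceTime hac ha0).exists_bound_of_continuousOn hu
  obtain ⟨R, hR0, hR⟩ := exists_hasDerivWithinAt_of_continuous hvc (M := M)
    (fun t x => hM (τ t, k t x) ⟨hτm t, hkm t x⟩) hT r₀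
  have hRa : ∀ t ∈ Icc 0 T, R t - a t ≤ 0 := by
    refine nonpos_of_hasDerivWithinAt (fun t ht => (hR t ht).sub (ha t ht))
      (by rw [hR0]; linarith [hr₀.2]) fun t ht hpos => ?_
    have : k t (R t) = a t := by
      simp only [hk, hτe t ht]
      rw [min_eq_right (by linarith), max_eq_right (ha0 t ht).le]
    simp only [hv, this, hτe t ht, sub_self]
  have hRn : ∀ t ∈ Icc 0 T, -R t ≤ 0 := by
    refine nonpos_of_hasDerivWithinAt (fun t ht => (hR t ht).neg)
      (by rw [hR0]; linarith [hr₀.1]) fun t ht hpos => ?_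
    have : k t (R t) = 0 := by
      simp only [hk]
      exact max_eq_left ((min_le_left _ _).trans (by linarith))
    simp only [hv, this, hτe t ht, hu0 t ht, neg_zero]
  have hmem : ∀ t ∈ Icc 0 T, R t ∈ Icc 0 (a t) := fun t ht =>
    ⟨by linarith [hRn t ht], by linarith [hRa t ht]⟩
  refine ⟨R, hR0, fun t ht => ?_, hmem⟩
  have : v t (R t) = u t (R t) := by
    simp only [hv, hk, hτe t ht]
    rw [min_eq_left (hmem t ht).2, max_eq_right (hmem t ht).1]
  exact this ▸ hR t ht

/-! ### Calculus of profiles -/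

section Profiles

variable {a : ℝ → ℝ} {T : ℝ}

lemma IsContinuousProfile.mul {f g : ℝ → ℝ → ℝ} (hf : IsContinuousProfile a T f)
    (hg : IsContinuousProfile a T g) : IsContinuousProfile a T (fun t r => f t r * g t r) :=
  ContinuousOn.mul hf hg

lemma IsContinuousProfile.add {f g : ℝ → ℝ → ℝ} (hf : IsContinuousProfile a T f)
    (hg : IsContinuousProfile a T g) : IsContinuousProfile a T (fun t r => f t r + g t r) :=
  ContinuousOn.add hf hg

lemma IsContinuousProfile.comp {f : ℝ → ℝ → ℝ} (hf : IsContinuousProfile a T f) {ψ : ℝ → ℝ}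
    (hψ : Continuous ψ) : IsContinuousProfile a T (fun t r => ψ (f t r)) :=
  hψ.comp_continuousOn hf

lemma isContinuousProfile_radius : IsContinuousProfile a T (fun _ r => r) := continuousOn_snd

lemma IsTimePrimitive.comp {f : ℝ → ℝ → ℝ} {ft : ℝ × ℝ → ℝ} (hf : IsTimePrimitive a T f ft)
    {ψ ψ' : ℝ → ℝ} (hψ : ∀ s, HasDerivAt ψ (ψ' s) s) (hψ' : Continuous ψ') :
    IsTimePrimitive a T (fun t r => ψ (f t r)) (fun z => ψ' (f z.1 z.2) * ft z) := by
  intro t₁ t₂ r₁ r₂ h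
  filter_upwards [hf t₁ t₂ r₁ r₂ h] with r hr hr'
  exact (hr hr').comp hψ hψ'

lemma IsTimePrimitive.mul {f g : ℝ → ℝ → ℝ} {ft gt : ℝ × ℝ → ℝ} (hf : IsTimePrimitive a T f ft)
    (hg : IsTimePrimitive a T g gt) :
    IsTimePrimitive a T (fun t r => f t r * g t r)
      (fun z => ft z * g z.1 z.2 + f z.1 z.2 * gt z) := by
  intro t₁ t₂ r₁ r₂ h
  filter_upwards [hf t₁ t₂ r₁ r₂ h, hg t₁ t₂ r₁ r₂ h] with r hr hr2 hr'
  exact (hr hr').mul (hr2 hr')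

lemma IsTimePrimitive.add {f g : ℝ → ℝ → ℝ} {ft gt : ℝ × ℝ → ℝ} (hf : IsTimePrimitive a T f ft)
    (hg : IsTimePrimitive a T g gt) :
    IsTimePrimitive a T (fun t r => f t r + g t r) (fun z => ft z + gt z) := by
  intro t₁ t₂ r₁ r₂ h
  filter_upwards [hf t₁ t₂ r₁ r₂ h, hg t₁ t₂ r₁ r₂ h] with r hr hr2 hr'
  exact (hr hr').add (hr2 hr')

lemma IsTimePrimitive.radius_mul {f : ℝ → ℝ → ℝ} {ft : ℝ × ℝ → ℝ} (hf : IsTimePrimitive a T f ft) :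
    IsTimePrimitive a T (fun t r => r * f t r) (fun z => z.2 * ft z) := by
  intro t₁ t₂ r₁ r₂ h
  filter_upwards [hf t₁ t₂ r₁ r₂ h] with r hr hr'
  exact (hr hr').const_mul r

lemma IsTimePrimitive.const_mul {f : ℝ → ℝ → ℝ} {ft : ℝ × ℝ → ℝ} (hf : IsTimePrimitive a T f ft)
    (c : ℝ) : IsTimePrimitive a T (fun t r => c * f t r) (fun z => c * ft z) := by
  intro t₁ t₂ r₁ r₂ h
  filter_upwards [hf t₁ t₂ r₁ r₂ h] with r hr hr'
  exact (hr hr').const_mul c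

lemma IsContinuousProfile.integrableOn_mul (ha : ContinuousOn a (Icc 0 T))
    (ha0 : ∀ t ∈ Icc 0 T, 0 < a t) {k : ℝ → ℝ → ℝ} (hk : IsContinuousProfile a T k)
    {g : ℝ × ℝ → ℝ} (hg : IntegrableOn g (radialSpaceTime a T)) :
    IntegrableOn (fun z => k z.1 z.2 * g z) (radialSpaceTime a T) := by
  obtain ⟨M, hM⟩ := (isCompact_closedRadialSpaceTime ha ha0).exists_bound_of_continuousOn hk
  have hDm := (isOpen_radialSpaceTime (ha.mono Ioo_subset_Icc_self)).measurableSet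
  have hkc := continuousOn_profile_radialSpaceTime hk
  refine Integrable.bdd_mul (c := M) hg (hkc.aestronglyMeasurable hDm) ?_
  rw [ae_restrict_iff' hDm]
  exact Eventually.of_forall fun z hz =>
    hM z ⟨Ioo_subset_Icc_self hz.1, Ioo_subset_Icc_self hz.2⟩

end Profiles

/-- Gronwall's inequality for absolutely continuous functions. -/
lemma IsPrimitiveOn.nonpos_of_le_mul {T : ℝ} (hT : 0 < T) {Y Y' k : ℝ → ℝ}
    (hY : IsPrimitiveOn Y Y' (Icc 0 T)) (h0 : Y 0 ≤ 0) (hk : IntegrableOn k (Ioo 0 T))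
    (hle : ∀ᵐ t, t ∈ Ioo 0 T → Y' t ≤ k t * Y t) : ∀ t ∈ Icc 0 T, Y t ≤ 0 := by
  have hYc : ContinuousOn Y (Icc 0 T) := by
    have := hY.continuousOn ordConnected_Icc (left_mem_Icc.2 hT.le) (right_mem_Icc.2 hT.le)
    rwa [uIcc_of_le hT.le] at this
  have hi : ∀ x ∈ Icc 0 T, ∀ y ∈ Icc 0 T, IntervalIntegrable k volume x y := by
    intro x hx y hy
    rw [intervalIntegrable_iff]
    exact ((integrableOn_Icc_iff_integrableOn_Ioo).2 hk).mono_set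
      (uIoc_subset_uIcc.trans (ordConnected_Icc.uIcc_subset hx hy))
  have h0m : (0 : ℝ) ∈ Icc 0 T := left_mem_Icc.2 hT.le
  set K : ℝ → ℝ := fun t => ∫ s in (0 : ℝ)..t, k s with hK
  have hKp : IsPrimitiveOn K k (Icc 0 T) := fun x hx y hy => ⟨hi x hx y hy,
    (intervalIntegral.integral_interval_sub_left (hi 0 h0m y hy) (hi 0 h0m x hx)).symm⟩
  have hKc : ContinuousOn K (Icc 0 T) := by
    have := hKp.continuousOn ordConnected_Icc h0m (right_mem_Icc.2 hT.le)
    rwa [uIcc_of_le hT.le] at this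
  -- The integrating factor exp(-K), where K is a primitive of k, makes Z = Y exp(-K) nonincreasing.
  -- The product rule is available on the open interval; continuity adds the endpoints.
  have hZ := (hY.mono Ioo_subset_Icc_self).mul ((hKp.mono Ioo_subset_Icc_self).comp
    (ψ := fun s => Real.exp (-s)) (ψ' := fun s => -Real.exp (-s)) (fun s => by
      simpa using (hasDerivAt_neg s).exp) (by fun_prop))
  set Z : ℝ → ℝ := fun t => Y t * Real.exp (-K t) with hZdef
  have hZc : ContinuousOn Z (Icc 0 T) := hYc.mul (Real.continuous_exp.comp_continuousOn hKc.neg)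
  have hmono : ∀ x ∈ Ioo 0 T, ∀ y ∈ Ioo 0 T, x ≤ y → Z y ≤ Z x := by
    intro x hx y hy hxy
    obtain ⟨h1, h2⟩ := hZ x hx y hy
    have h3 : ∫ s in x..y, (Y' s * Real.exp (-K s) + Y s * (-Real.exp (-K s) * k s)) ≤ 0 := by
      rw [intervalIntegral.integral_of_le hxy]
      refine integral_nonpos_of_ae ((ae_restrict_iff' measurableSet_Ioc).2 ?_)
      filter_upwards [hle] with s hs hs'
      have h4 := hs ⟨hx.1.trans hs'.1, hs'.2.trans_lt hy.2⟩
      have h5 := Real.exp_pos (-K s)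
      simp only [Pi.zero_apply]
      nlinarith
    linarith
  have hZ0 : ∀ t ∈ Ioc 0 T, Z t ≤ 0 := by
    have h1 : ∀ t ∈ Ioo 0 T, Z t ≤ 0 := by
      intro t ht
      have h2 : Tendsto Z (𝓝[>] 0) (𝓝 (Z 0)) := by
        have := (hZc 0 h0m).mono_left (nhdsWithin_mono _ (Ioc_subset_Icc_self))
        rwa [nhdsWithin_Ioc_eq_nhdsGT hT] at this
      have h3 : Z 0 ≤ 0 := by
        simp only [hZdef]
        exact mul_nonpos_of_nonpos_of_nonneg h0 (Real.exp_pos _).le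
      refine (ge_of_tendsto h2 ?_).trans h3
      filter_upwards [Ioo_mem_nhdsGT ht.1] with s hs
      exact hmono s ⟨hs.1, hs.2.trans ht.2⟩ t ht hs.2.le
    intro t ht
    rcases ht.2.lt_or_eq with h | h
    · exact h1 t ⟨ht.1, h⟩
    · rw [h]
      have h2 : Tendsto Z (𝓝[<] T) (𝓝 (Z T)) := by
        have := (hZc T (right_mem_Icc.2 hT.le)).mono_left (nhdsWithin_mono _ (Ico_subset_Icc_self))
        rwa [nhdsWithin_Ico_eq_nhdsLT hT] at this
      refine le_of_tendsto h2 ?_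
      filter_upwards [Ioo_mem_nhdsLT hT] with s hs using h1 s hs
  intro t ht
  rcases ht.1.eq_or_lt with h | h
  · rwa [← h]
  · have := hZ0 t ⟨h, ht.2⟩
    by_contra! hlt
    exact absurd this (not_le.2 (mul_pos hlt (Real.exp_pos _)))

/-- For every base point s one has |δ(r)| ≤ |δ(s)| + ∫|δ'|; averaging over s in (0, A) gives the
bound. This is the one-dimensional Sobolev embedding of W^{1,1}. -/
lemma IsPrimitiveOn.abs_le {A : ℝ} (hA : 0 < A) {δ δ' : ℝ → ℝ} (h : IsPrimitiveOn δ δ' (Icc 0 A))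
    (hδ : ContinuousOn δ (Icc 0 A)) (hδ' : IntegrableOn δ' (Ioo 0 A)) {r : ℝ} (hr : r ∈ Icc 0 A) :
    |δ r| ≤ A⁻¹ * (∫ s in Ioo 0 A, |δ s|) + ∫ s in Ioo 0 A, |δ' s| := by
  set N := ∫ s in Ioo 0 A, |δ' s| with hN
  have hb : ∀ s ∈ Icc 0 A, |δ r| - N ≤ |δ s| := by
    intro s hs
    have h1 : |δ r - δ s| ≤ N := by
      rw [← (h s hs r hr).2, ← Real.norm_eq_abs]
      refine (intervalIntegral.norm_integral_le_integral_norm_uIoc).trans ?_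
      rw [hN, ← integral_Icc_eq_integral_Ioo]
      exact setIntegral_mono_set ((integrableOn_Icc_iff_integrableOn_Ioo).2 hδ').abs
        (Eventually.of_forall fun _ => abs_nonneg _)
        (uIoc_subset_uIcc.trans (ordConnected_Icc.uIcc_subset hs hr)).eventuallyLE
    linarith [abs_sub_abs_le_abs_sub (δ r) (δ s)]
  have hi : IntegrableOn (fun s => |δ s|) (Ioo 0 A) :=
    (hδ.abs.integrableOn_Icc).mono_set Ioo_subset_Icc_self
  have h2 : A * (|δ r| - N) ≤ ∫ s in Ioo 0 A, |δ s| := by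
    have h3 := setIntegral_mono_on (integrableOn_const (by simp)) hi measurableSet_Ioo
      (fun s hs => hb s (Ioo_subset_Icc_self hs))
    simpa [hA.le] using h3
  have h4 : |δ r| - N ≤ A⁻¹ * ∫ s in Ioo 0 A, |δ s| := by
    rw [inv_mul_eq_div, le_div_iff₀ hA]
    linarith
  linarith

/-! ### Bounds for the divergence and persistence of signs -/

section Flow

variable {κ γ T : ℝ} {a : ℝ → ℝ} {ρ u P B : ℝ → ℝ → ℝ} {ρt ut Pt Bt d d' : ℝ × ℝ → ℝ}

lemma RadialFlow.continuousOn_radius (F : RadialFlow κ γ T a ρ u P B ρt ut Pt Bt d d') :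
    ContinuousOn a (Icc 0 T) := fun t ht => (F.radius_deriv t ht).continuousWithinAt

/-- The divergence is bounded in space by an integrable function of time. -/
lemma RadialFlow.exists_div_bound (hT : 0 < T)
    (F : RadialFlow κ γ T a ρ u P B ρt ut Pt Bt d d') :
    ∃ m : ℝ → ℝ, IntegrableOn m (Ioo 0 T) ∧ ∀ᵐ t, t ∈ Ioo 0 T → ∃ δ δ', RadialSlice κ γ (a t) (ρ t)
      (u t) (P t) (B t) (fun r => ρt (t, r)) (fun r => ut (t, r)) (fun r => Pt (t, r))
      (fun r => Bt (t, r)) δ δ' ∧ ∀ r ∈ Icc 0 (a t), |δ r| ≤ m t := by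
  have hac := F.continuousOn_radius
  have hao := hac.mono (Ioo_subset_Icc_self (a := (0 : ℝ)) (b := T))
  -- The smallest radius is attained and positive, so the factor 1/a(t) in the supremum bound can be
  -- replaced by a constant.
  obtain ⟨τ, hτ, hmin⟩ := isCompact_Icc.exists_isMinOn (nonempty_Icc.2 hT.le) hac
  have hτ0 := F.radius_pos τ hτ
  refine ⟨fun t => (a τ)⁻¹ * (∫ r in Ioo 0 (a t), |d (t, r)|) + ∫ r in Ioo 0 (a t), |d' (t, r)|,
    ((integrableOn_radialSpaceTime_slice hao (Integrable.abs F.div_integrable)).2.1.const_mul _).add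
      (integrableOn_radialSpaceTime_slice hao (Integrable.abs F.div_deriv_integrable)).2.1, ?_⟩
  filter_upwards [F.slice] with t ht htT
  obtain ⟨δ, hS, hδ⟩ := ht htT
  have htI := Ioo_subset_Icc_self htT
  refine ⟨δ, _, hS, fun r hr => ?_⟩
  refine (hS.div_primitive.abs_le (F.radius_pos t htI) hS.div_cont hS.div_integrable hr).trans ?_
  have h1 : ∫ s in Ioo 0 (a t), |d (t, s)| = ∫ s in Ioo 0 (a t), |δ s| :=
    setIntegral_congr_ae measurableSet_Ioo (by
      filter_upwards [hδ] with s hs hs'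
      rw [hs hs'])
  rw [h1]
  have h2 : (a t)⁻¹ ≤ (a τ)⁻¹ := inv_anti₀ hτ0 (hmin htI)
  have h3 : 0 ≤ ∫ s in Ioo 0 (a t), |δ s| := integral_nonneg fun _ => abs_nonneg _
  nlinarith

/-- The transport equation `f_t + u f_r + g f δ = 0` on the interval `(0, A)` at a fixed time,
`δ` being the divergence of the velocity. -/
structure IsTransported (A g : ℝ) (f ft u δ : ℝ → ℝ) : Prop where
  div_cont : ContinuousOn δ (Icc 0 A)
  velocity_deriv : ∀ r ∈ Ioo 0 A, HasDerivAt u (δ r - u r / r) r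
  equation : ∃ fr, IsPrimitiveOn f fr (Ioo 0 A) ∧
    ∀ᵐ r, r ∈ Ioo 0 A → ft r + u r * fr r + g * f r * δ r = 0
  integrable : IntegrableOn ft (Ioo 0 A)

lemma IsTransported.neg {A g : ℝ} {f ft u δ : ℝ → ℝ} (h : IsTransported A g f ft u δ) :
    IsTransported A g (fun r => -1 * f r) (fun r => -1 * ft r) u δ := by
  obtain ⟨fr, hfr, he⟩ := h.equation
  refine ⟨h.div_cont, h.velocity_deriv, ⟨_, hfr.const_mul (-1), ?_⟩, h.integrable.const_mul _⟩
  filter_upwards [he] with r hr hr'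
  linear_combination -hr hr'

/-- The product rule splits the derivative of ρu, and the part ρ u_r joins ρu/r to form ρδ. -/
lemma RadialSlice.transport_density {A : ℝ} {ρ u P B ρt ut Pt Bt δ δ' : ℝ → ℝ}
    (S : RadialSlice κ γ A ρ u P B ρt ut Pt Bt δ δ') : IsTransported A 1 ρ ρt u δ := by
  obtain ⟨ρr, hρ⟩ := S.density
  obtain ⟨wr, hw, he⟩ := S.mass
  refine ⟨S.div_cont, S.velocity_deriv, ⟨ρr, hρ, ?_⟩, S.density_integrable⟩
  have huc : ContinuousOn u (Ioo 0 A) := fun r hr =>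
    (S.velocity_deriv r hr).continuousAt.continuousWithinAt
  have hu : IsPrimitiveOn u (fun r => δ r - u r / r) (Ioo 0 A) :=
    IsPrimitiveOn.of_hasDerivAt S.velocity_deriv ((S.div_cont.mono Ioo_subset_Icc_self).sub
      (huc.div continuousOn_id fun r hr => hr.1.ne'))
  filter_upwards [he, hw.ae_unique (hρ.mul hu)] with r h1 h2 hr
  have h3 := h1 hr
  rw [h2 hr] at h3
  linear_combination h3

lemma RadialSlice.transport_pressure {A : ℝ} {ρ u P B ρt ut Pt Bt δ δ' : ℝ → ℝ}
    (S : RadialSlice κ γ A ρ u P B ρt ut Pt Bt δ δ') : IsTransported A γ P Pt u δ := by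
  obtain ⟨Pr, Br, hP, -, he⟩ := S.momentum_pressure
  refine ⟨S.div_cont, S.velocity_deriv, ⟨Pr, hP, ?_⟩, S.pressure_integrable⟩
  filter_upwards [he] with r h1 hr using (h1 hr).2

/-- The square of the negative part. -/
noncomputable def negSq (s : ℝ) : ℝ := min s 0 ^ 2

/-- Unlike the negative part itself, its square is C¹, which is what the chain rule
`IsPrimitiveOn.comp` requires. -/
lemma hasDerivAt_negSq (s : ℝ) : HasDerivAt negSq (2 * min s 0) s := by
  rcases lt_trichotomy s 0 with h | rfl | h
  · have h1 : HasDerivAt (fun x : ℝ => x ^ 2) (2 * min s 0) s := by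
      have := hasDerivAt_pow 2 s
      rw [min_eq_left h.le]
      simpa using this
    refine h1.congr_of_eventuallyEq ?_
    filter_upwards [gt_mem_nhds h] with x hx
    rw [negSq, min_eq_left hx.le]
  · rw [min_self, mul_zero, hasDerivAt_iff_isLittleO_nhds_zero]
    refine Asymptotics.IsBigO.trans_isLittleO (g := fun h : ℝ => h ^ 2)
      (Asymptotics.IsBigO.of_bound 1 (Eventually.of_forall fun h => ?_)) ?_
    · simp only [negSq, zero_add, min_self, smul_zero, sub_zero, one_mul, norm_pow]
      rw [zero_pow two_ne_zero, sub_zero, norm_pow]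
      refine pow_le_pow_left₀ (norm_nonneg _) ?_ 2
      rw [Real.norm_eq_abs, Real.norm_eq_abs]
      rcases le_total h 0 with hh | hh
      · rw [min_eq_left hh]
      · rw [min_eq_right hh, abs_zero]
        exact abs_nonneg _
    · exact Asymptotics.isLittleO_pow_id one_lt_two
  · have h1 : HasDerivAt (fun _ : ℝ => (0 : ℝ)) (2 * min s 0) s := by
      rw [min_eq_right h.le, mul_zero]
      exact hasDerivAt_const _ _
    refine h1.congr_of_eventuallyEq ?_
    filter_upwards [lt_mem_nhds h] with x hx
    rw [negSq, min_eq_right hx.le]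
    simp

lemma negSq_nonneg (s : ℝ) : 0 ≤ negSq s := sq_nonneg _

lemma negSq_of_nonneg {s : ℝ} (hs : 0 ≤ s) : negSq s = 0 := by simp [negSq, min_eq_right hs]

lemma negSq_pos {s : ℝ} (hs : s < 0) : 0 < negSq s := by
  rw [negSq, min_eq_left hs.le]
  exact sq_pos_of_neg hs

lemma continuous_negSq : Continuous negSq := by
  unfold negSq
  fun_prop

/-- Euler's identity for a function homogeneous of degree two. It turns the term g f δ of the
transport equation into 2g times `negSq`. -/
lemma mul_min_zero (s : ℝ) : s * (2 * min s 0) = 2 * negSq s := by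
  unfold negSq
  rcases le_total s 0 with h | h
  · rw [min_eq_left h]
    ring
  · rw [min_eq_right h]
    ring

/-- The square N of the negative part solves N_t + u N_r + 2 g N δ = 0. Multiplying by r and
integrating r u N_r by parts, using (ru)_r = rδ, cancels the boundary term at R. The left-hand side
is the time derivative of ∫ r N dr when R moves with the fluid. -/
lemma IsTransported.integral_negSq {A g R : ℝ} {f ft u δ : ℝ → ℝ} (h : IsTransported A g f ft u δ)
    (hf : ContinuousOn f (Icc 0 A)) (hu : ContinuousOn u (Icc 0 A)) (hA : 0 < A)
    (hR : R ∈ Icc 0 A) :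
    R * negSq (f R) * u R + ∫ r in (0 : ℝ)..R, r * ((2 * min (f r) 0) * ft r)
      = (1 - 2 * g) * ∫ r in (0 : ℝ)..R, r * negSq (f r) * δ r := by
  obtain ⟨fr, hfr, he⟩ := h.equation
  have hN := hfr.comp hasDerivAt_negSq (by fun_prop)
  have hNc : ContinuousOn (fun r => negSq (f r)) (Icc 0 A) := continuous_negSq.comp_continuousOn hf
  have hru : IsPrimitiveOn (fun r => r * u r) (fun r => r * δ r) (Ioo 0 A) := by
    refine IsPrimitiveOn.of_hasDerivAt (fun r hr => ?_)
      (continuousOn_id.mul (h.div_cont.mono Ioo_subset_Icc_self))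
    have := (hasDerivAt_id r).mul (h.velocity_deriv r hr)
    refine this.congr_deriv ?_
    have := hr.1.ne'
    simp only [id]
    field_simp
    ring
  have h1 := hN.mul hru
  have hi1 : IntegrableOn (fun r => r * ((2 * min (f r) 0) * ft r)) (Ioo 0 A) := by
    have hc : ContinuousOn (fun r => r * (2 * min (f r) 0)) (Icc 0 A) :=
      continuousOn_id.mul ((by fun_prop : Continuous fun s : ℝ => 2 * min s 0).comp_continuousOn hf)
    have := (((integrableOn_Icc_iff_integrableOn_Ioo).2 h.integrable).continuousOn_mul hc
      isCompact_Icc).mono_set Ioo_subset_Icc_self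
    refine this.congr_fun (fun r _ => ?_) measurableSet_Ioo
    ring
  have hc2 : ContinuousOn (fun r => r * negSq (f r) * δ r) (Icc 0 A) :=
    (continuousOn_id.mul hNc).mul h.div_cont
  have hi2 : IntegrableOn (fun r => r * negSq (f r) * δ r) (Ioo 0 A) :=
    hc2.integrableOn_Icc.mono_set Ioo_subset_Icc_self
  have h2 : IsPrimitiveOn (fun r => negSq (f r) * (r * u r))
      (fun r => (1 - 2 * g) * (r * negSq (f r) * δ r) - r * ((2 * min (f r) 0) * ft r))
      (Ioo 0 A) := by
    refine h1.congr_ae ?_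
    filter_upwards [he] with r hr hr'
    linear_combination (2 * min (f r) 0 * r) * hr hr' - (g * r * δ r) * mul_min_zero (f r)
  have h3 := h2.Icc_of_Ioo hA (hNc.mul (continuousOn_id.mul hu))
    ((hi2.const_mul _).sub hi1)
  have h0m : (0 : ℝ) ∈ Icc 0 A := left_mem_Icc.2 hA.le
  have h4 := (h3 0 h0m R hR).2
  have hii : ∀ {k : ℝ → ℝ}, IntegrableOn k (Ioo 0 A) → IntervalIntegrable k volume 0 R := by
    intro k hk
    rw [intervalIntegrable_iff_integrableOn_Ioo_of_le hR.1]
    exact hk.mono_set (Ioo_subset_Ioo_right hR.2)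
  rw [intervalIntegral.integral_sub ((hii hi2).const_mul _) (hii hi1),
    intervalIntegral.integral_const_mul] at h4
  linear_combination -h4

/-- Solutions of transport equations remain nonnegative along particle paths. -/
theorem RadialFlow.nonneg_of_transported (hT : 0 < T)
    (F : RadialFlow κ γ T a ρ u P B ρt ut Pt Bt d d') {g : ℝ} {f : ℝ → ℝ → ℝ} {ft : ℝ × ℝ → ℝ}
    (hf : IsContinuousProfile a T f) (hft : IsTimePrimitive a T f ft)
    (hfi : IntegrableOn ft (radialSpaceTime a T)) {m : ℝ → ℝ} (hm : IntegrableOn m (Ioo 0 T))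
    (hs : ∀ᵐ t, t ∈ Ioo 0 T → ∃ δ, IsTransported (a t) g (f t) (fun r => ft (t, r)) (u t) δ ∧
      ∀ r ∈ Icc 0 (a t), |δ r| ≤ m t) {R : ℝ → ℝ}
    (hR : ∀ t ∈ Icc 0 T, HasDerivWithinAt R (u t (R t)) (Icc 0 T) t)
    (hRa : ∀ t ∈ Icc 0 T, R t ∈ Icc 0 (a t)) (h0 : ∀ r ∈ Icc 0 (R 0), 0 ≤ f 0 r) :
    ∀ t ∈ Icc 0 T, ∀ r ∈ Ioo 0 (R t), 0 ≤ f t r := by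
  have hac := F.continuousOn_radius
  have hRc : ContinuousOn R (Icc 0 T) := fun t ht => (hR t ht).continuousWithinAt
  have hpc : IsContinuousProfile a T (fun t r => r * negSq (f t r)) :=
    isContinuousProfile_radius.mul (hf.comp continuous_negSq)
  have hY := (hft.comp hasDerivAt_negSq (by fun_prop)).radius_mul.isPrimitiveOn_integral hac
    F.radius_pos hpc (by
      have h1 : IsContinuousProfile a T (fun t r => r * (2 * min (f t r) 0)) :=
        isContinuousProfile_radius.mul (hf.comp (ψ := fun s => 2 * min s 0) (by fun_prop))
      refine (h1.integrableOn_mul hac F.radius_pos hfi).congr_fun (fun z _ => ?_)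
        (isOpen_radialSpaceTime (hac.mono Ioo_subset_Icc_self)).measurableSet
      ring) hR (F.cont_velocity.comp_path hRc hRa) hRa
  -- Gronwall's inequality for Y(t) = ∫ r (f⁻)² dr, which is zero initially; m controls |δ|
  -- uniformly on the slice.
  have hYle := hY.nonpos_of_le_mul hT (k := fun t => |1 - 2 * g| * m t) (by
      refine (intervalIntegral.integral_congr (g := fun _ => 0) fun r hr => ?_).trans_le (by simp)
      rw [uIcc_of_le (hRa 0 (left_mem_Icc.2 hT.le)).1] at hr
      simp only
      rw [negSq_of_nonneg (h0 r hr), mul_zero]) (hm.const_mul _) (by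
      filter_upwards [hs] with t ht htT
      obtain ⟨δ, hδ, hδm⟩ := ht htT
      have htI := Ioo_subset_Icc_self htT
      have hRt := hRa t htI
      rw [hδ.integral_negSq (hf.slice htI) (F.cont_velocity.slice htI) (F.radius_pos t htI) hRt]
      have hsub : Icc 0 (R t) ⊆ Icc 0 (a t) := Icc_subset_Icc_right hRt.2
      have hpos : ∀ r ∈ Icc 0 (R t), 0 ≤ r * negSq (f t r) := fun r hr =>
        mul_nonneg hr.1 (negSq_nonneg _)
      have hb : |∫ r in (0 : ℝ)..R t, r * negSq (f t r) * δ r|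
          ≤ m t * ∫ r in (0 : ℝ)..R t, r * negSq (f t r) := by
        rw [← Real.norm_eq_abs, ← intervalIntegral.integral_const_mul]
        refine intervalIntegral.norm_integral_le_of_norm_le hRt.1 (Eventually.of_forall
          fun r hr => ?_) (((hpc.slice htI).mono hsub).intervalIntegrable_of_Icc hRt.1 |>.const_mul _)
        have hr' := Ioc_subset_Icc_self hr
        rw [Real.norm_eq_abs, abs_mul, abs_of_nonneg (hpos r hr'), mul_comm]
        exact mul_le_mul_of_nonneg_right (hδm r (hsub hr')) (hpos r hr')
      calc _ ≤ |(1 - 2 * g) * ∫ r in (0 : ℝ)..R t, r * negSq (f t r) * δ r| := le_abs_self _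
        _ ≤ |1 - 2 * g| * (m t * ∫ r in (0 : ℝ)..R t, r * negSq (f t r)) := by
          rw [abs_mul]
          exact mul_le_mul_of_nonneg_left hb (abs_nonneg _)
        _ = _ := by ring)
  -- A negative value of f at an interior point would make the integral of the continuous function r
  -- (f⁻)² positive.
  intro t ht r hr
  by_contra! hlt
  have hR0 : 0 < R t := hr.1.trans hr.2
  refine absurd (hYle t ht) (not_le.2 (intervalIntegral.integral_pos hR0
    ((hpc.slice ht).mono (Icc_subset_Icc_right (hRa t ht).2)) (fun s hs =>
      mul_nonneg hs.1.le (negSq_nonneg _)) ⟨r, Ioo_subset_Icc_self hr,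
        mul_pos hr.1 (negSq_pos hlt)⟩))

end Flow

/-! ### Conservation of the magnetic flux and the energy identity -/

lemma RadialSlice.velocity_primitive {κ γ A : ℝ} {ρ u P B ρt ut Pt Bt δ δ' : ℝ → ℝ}
    (S : RadialSlice κ γ A ρ u P B ρt ut Pt Bt δ δ') :
    IsPrimitiveOn u (fun r => δ r - u r / r) (Ioo 0 A) := by
  have huc : ContinuousOn u (Ioo 0 A) := fun r hr =>
    (S.velocity_deriv r hr).continuousAt.continuousWithinAt
  exact IsPrimitiveOn.of_hasDerivAt S.velocity_deriv ((S.div_cont.mono Ioo_subset_Icc_self).sub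
    (huc.div continuousOn_id fun r hr => hr.1.ne'))

lemma RadialSlice.radius_mul_velocity_primitive {κ γ A : ℝ} {ρ u P B ρt ut Pt Bt δ δ' : ℝ → ℝ}
    (S : RadialSlice κ γ A ρ u P B ρt ut Pt Bt δ δ') :
    IsPrimitiveOn (fun r => r * u r) (fun r => r * δ r) (Ioo 0 A) := by
  refine IsPrimitiveOn.of_hasDerivAt (fun r hr => ?_)
    (continuousOn_id.mul (S.div_cont.mono Ioo_subset_Icc_self))
  refine ((hasDerivAt_id r).mul (S.velocity_deriv r hr)).congr_deriv ?_
  have := hr.1.ne'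
  simp only [id]
  field_simp
  ring

/-- Integrating B_t = -(uB)_r over (0, R): the flux vanishes at the center because u does, and at R
it cancels the contribution of the moving endpoint. -/
lemma RadialSlice.integral_magnetic {κ γ A R : ℝ} {ρ u P B ρt ut Pt Bt δ δ' : ℝ → ℝ}
    (S : RadialSlice κ γ A ρ u P B ρt ut Pt Bt δ δ') (hA : 0 < A) (hu : ContinuousOn u (Icc 0 A))
    (hB : ContinuousOn B (Icc 0 A)) (hu0 : u 0 = 0) (hR : R ∈ Icc 0 A) :
    B R * u R + ∫ r in (0 : ℝ)..R, Bt r = 0 := by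
  obtain ⟨qr, hq, he⟩ := S.induction
  have h1 : IsPrimitiveOn (fun r => u r * B r) (fun r => -1 * Bt r) (Ioo 0 A) := by
    refine hq.congr_ae ?_
    filter_upwards [he] with r hr hr'
    linear_combination hr hr'
  have h2 := (h1.Icc_of_Ioo hA (hu.mul hB) (S.magnetic_integrable.const_mul _) 0
    (left_mem_Icc.2 hA.le) R hR).2
  rw [intervalIntegral.integral_const_mul, hu0] at h2
  linear_combination -h2

/-- The density of the energy. -/
noncomputable def energyDensity (γ : ℝ) (ρ u P B : ℝ → ℝ → ℝ) (t r : ℝ) : ℝ :=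
  r * (1 / 2 * (ρ t r * (u t r * u t r)) + ((γ - 1)⁻¹ * P t r + 1 / 2 * (B t r * B t r)))

/-- The energy flux is r u (ρu²/2 + γP/(γ-1) + B² - κδ), and its radial derivative is -e_t - κ r δ².
At r = A it exceeds the energy carried by the moving boundary by A u (P + B²/2 - κδ), which the free
surface condition makes zero; at the center it vanishes. -/
lemma RadialSlice.integral_energy {κ γ A : ℝ} {ρ u P B ρt ut Pt Bt δ δ' : ℝ → ℝ}
    (S : RadialSlice κ γ A ρ u P B ρt ut Pt Bt δ δ') (hγ : γ ≠ 1) (hA : 0 < A)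
    (hρ : ContinuousOn ρ (Icc 0 A)) (hu : ContinuousOn u (Icc 0 A)) (hP : ContinuousOn P (Icc 0 A))
    (hB : ContinuousOn B (Icc 0 A)) {et : ℝ → ℝ} (het : ∀ r, et r = r * (1 / 2 * (ρt r * (u r * u r)
      + ρ r * (ut r * u r + u r * ut r)) + ((γ - 1)⁻¹ * Pt r
        + 1 / 2 * (Bt r * B r + B r * Bt r)))) (hi : IntegrableOn et (Ioo 0 A)) :
    A * (1 / 2 * (ρ A * (u A * u A)) + ((γ - 1)⁻¹ * P A + 1 / 2 * (B A * B A))) * u A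
      + ∫ r in (0 : ℝ)..A, et r = -(κ * ∫ r in (0 : ℝ)..A, r * δ r ^ 2) := by
  obtain ⟨wr, hw, hmass⟩ := S.mass
  obtain ⟨Pr, Br, hPr, hBr, hmom⟩ := S.momentum_pressure
  obtain ⟨qr, hq, hind⟩ := S.induction
  have hup := S.velocity_primitive
  have hrup := S.radius_mul_velocity_primitive
  have hδ := S.div_primitive.mono Ioo_subset_Icc_self
  have hγ1 : γ - 1 ≠ 0 := sub_ne_zero.2 hγ
  have hc2 : ContinuousOn (fun r => r * δ r ^ 2) (Icc 0 A) := continuousOn_id.mul (S.div_cont.pow 2)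
  have hi2 : IntegrableOn (fun r => r * δ r ^ 2) (Ioo 0 A) :=
    hc2.integrableOn_Icc.mono_set Ioo_subset_Icc_self
  -- the energy flux
  have hQ := hrup.mul (((hw.mul hup).const_mul (1 / 2)).add
    ((hPr.const_mul (γ / (γ - 1))).add ((hBr.mul hBr).add (hδ.const_mul (-κ)))))
  -- The mass, momentum and induction equations are multiplied by r to remove the quotients by r.
  -- The result is u²/2 times mass, u times momentum and B times induction, with the pressure
  -- equation inserted directly.
  have hQ' := hQ.congr_ae (g₁ := fun r => -1 * et r - κ * (r * δ r ^ 2)) (by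
    filter_upwards [hmass, hmom, hind, hq.ae_unique (hup.mul hBr)] with r h1 h2 h3 h4 hr
    have hr0 := hr.1.ne'
    have e1 := h1 hr
    obtain ⟨e2, e3⟩ := h2 hr
    have e4 := h3 hr
    rw [h4 hr] at e4
    rw [het r]
    have e5 : r * ρt r = -(r * wr r) - ρ r * u r := by
      have : r * (ρt r + wr r + ρ r * u r / r) = 0 := by rw [e1, mul_zero]
      field_simp at this
      linarith
    have e6 : r * (ρ r * ut r) = r * (κ * δ' r) - r * (B r * Br r) - B r ^ 2 - r * Pr r
        - ρ r * u r * (r * δ r - u r) := by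
      have : r * (ρ r * (ut r + u r * (δ r - u r / r)) + Pr r)
        = r * (κ * δ' r - B r * (Br r + B r / r)) := by rw [e2]
      have h5 : r * (u r / r) = u r := by field_simp
      have h6 : r * (B r / r) = B r := by field_simp
      linear_combination this + ρ r * u r * h5 - B r * h6
    have e7 : Pt r = -(u r * Pr r) - γ * P r * δ r := by linear_combination e3
    have e8 : r * Bt r = -((r * δ r - u r) * B r) - r * (u r * Br r) := by
      have h5 : r * (u r / r) = u r := by field_simp
      linear_combination r * e4 + B r * h5
    have e9 : r * (δ r - u r / r) = r * δ r - u r := by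
      have h5 : r * (u r / r) = u r := by field_simp
      linear_combination -h5
    have e10 : γ / (γ - 1) = 1 + (γ - 1)⁻¹ := by
      field_simp
      ring
    have e11 : γ = 1 + (γ - 1) := by ring
    have e12 : (γ - 1)⁻¹ * γ = 1 + (γ - 1)⁻¹ := by
      field_simp
      ring
    rw [e10, e7]
    linear_combination (1 / 2 * (u r * u r)) * e5 + u r * e6 + B r * e8
      + (1 / 2 * (ρ r * u r) * u r) * e9 - (r * P r * δ r) * e12)
  have h3 := (hQ'.Icc_of_Ioo hA ((continuousOn_id.mul hu).mul ((continuousOn_const.mul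
    ((hρ.mul hu).mul hu)).add ((continuousOn_const.mul hP).add ((hB.mul hB).add
      (continuousOn_const.mul S.div_cont))))) ((hi.const_mul _).sub (hi2.const_mul _)) 0
    (left_mem_Icc.2 hA.le) A (right_mem_Icc.2 hA.le)).2
  have hii : ∀ {k : ℝ → ℝ}, IntegrableOn k (Ioo 0 A) → IntervalIntegrable k volume 0 A := fun hk =>
    (intervalIntegrable_iff_integrableOn_Ioo_of_le hA.le).2 hk
  rw [intervalIntegral.integral_sub ((hii hi).const_mul _) ((hii hi2).const_mul _),
    intervalIntegral.integral_const_mul, intervalIntegral.integral_const_mul] at h3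
  have e10 : γ / (γ - 1) = 1 + (γ - 1)⁻¹ := by
    field_simp
    ring
  have hfs := S.free_surface
  rw [e10] at h3
  linear_combination -h3 + (A * u A) * hfs

section Flow

variable {κ γ T : ℝ} {a : ℝ → ℝ} {ρ u P B : ℝ → ℝ → ℝ} {ρt ut Pt Bt d d' : ℝ × ℝ → ℝ}

/-- The magnetic flux through a material disk is constant. -/
theorem RadialFlow.integral_magnetic_eq (F : RadialFlow κ γ T a ρ u P B ρt ut Pt Bt d d')
    {R : ℝ → ℝ} (hR : ∀ t ∈ Icc 0 T, HasDerivWithinAt R (u t (R t)) (Icc 0 T) t)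
    (hRa : ∀ t ∈ Icc 0 T, R t ∈ Icc 0 (a t)) {t : ℝ} (ht : t ∈ Icc 0 T) :
    ∫ r in (0 : ℝ)..R t, B t r = ∫ r in (0 : ℝ)..R 0, B 0 r := by
  have hRc : ContinuousOn R (Icc 0 T) := fun t ht => (hR t ht).continuousWithinAt
  have h1 := F.magnetic_time.isPrimitiveOn_integral F.continuousOn_radius F.radius_pos
    F.cont_magnetic F.magnetic_integrable hR (F.cont_velocity.comp_path hRc hRa) hRa
  have h0 : (0 : ℝ) ∈ Icc 0 T := ⟨le_rfl, ht.1.trans ht.2⟩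
  have h2 := (h1 0 h0 t ht).2
  rw [intervalIntegral.integral_of_le ht.1, integral_Ioc_eq_integral_Ioo,
    setIntegral_congr_ae (g := fun _ => 0) measurableSet_Ioo, integral_zero] at h2
  · linarith
  · filter_upwards [F.slice] with s hs hst
    have hsT : s ∈ Ioo 0 T := ⟨hst.1, hst.2.trans_le ht.2⟩
    have hsI := Ioo_subset_Icc_self hsT
    obtain ⟨δ, hS, -⟩ := hs hsT
    exact hS.integral_magnetic (F.radius_pos s hsI) (F.cont_velocity.slice hsI)
      (F.cont_magnetic.slice hsI) (F.center s hsI).1 (hRa s hsI)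

/-- The energy identity. -/
theorem RadialFlow.exists_dissipation (F : RadialFlow κ γ T a ρ u P B ρt ut Pt Bt d d')
    (hγ : γ ≠ 1) :
    ∃ D : ℝ → ℝ, IsPrimitiveOn (fun t => ∫ r in (0 : ℝ)..a t, energyDensity γ ρ u P B t r)
      (fun t => -D t) (Icc 0 T) ∧
      ∀ᵐ t, t ∈ Ioo 0 T → ∀ δ δ', RadialSlice κ γ (a t) (ρ t) (u t) (P t) (B t)
        (fun r => ρt (t, r)) (fun r => ut (t, r)) (fun r => Pt (t, r)) (fun r => Bt (t, r)) δ δ' →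
        D t = κ * ∫ r in (0 : ℝ)..a t, r * δ r ^ 2 := by
  have hac := F.continuousOn_radius
  have hao := hac.mono (Ioo_subset_Icc_self (a := (0 : ℝ)) (b := T))
  have hDm := (isOpen_radialSpaceTime hao).measurableSet
  have hr := isContinuousProfile_radius (a := a) (T := T)
  have cu := F.cont_velocity
  have hcc : ∀ (c : ℝ) {f : ℝ → ℝ → ℝ}, IsContinuousProfile a T f →
      IsContinuousProfile a T (fun t r => c * f t r) := fun c f hf =>
    hf.comp (continuous_const_mul c)
  have hcont : IsContinuousProfile a T (energyDensity γ ρ u P B) :=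
    hr.mul ((hcc _ (F.cont_density.mul (cu.mul cu))).add ((hcc _ F.cont_pressure).add
      (hcc _ (F.cont_magnetic.mul F.cont_magnetic))))
  have htime := (((F.density_time.mul (F.velocity_time.mul F.velocity_time)).const_mul (1 / 2)).add
    ((F.pressure_time.const_mul (γ - 1)⁻¹).add
      ((F.magnetic_time.mul F.magnetic_time).const_mul (1 / 2)))).radius_mul
  have hint : IntegrableOn (fun z : ℝ × ℝ => z.2 * (1 / 2 * (ρt z * (u z.1 z.2 * u z.1 z.2)
      + ρ z.1 z.2 * (ut z * u z.1 z.2 + u z.1 z.2 * ut z)) + ((γ - 1)⁻¹ * Pt z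
        + 1 / 2 * (Bt z * B z.1 z.2 + B z.1 z.2 * Bt z)))) (radialSpaceTime a T) := by
    have i1 := (hcc (1 / 2) (hr.mul (cu.mul cu))).integrableOn_mul hac F.radius_pos
      F.density_integrable
    -- The derivative u_t enters the energy only as r u_t times the bounded function ρu, so the
    -- weighted integrability is enough.
    have i2 := (F.cont_density.mul cu).integrableOn_mul hac F.radius_pos F.velocity_integrable
    have i3 := (hcc (γ - 1)⁻¹ hr).integrableOn_mul hac F.radius_pos F.pressure_integrable
    have i4 := (hr.mul F.cont_magnetic).integrableOn_mul hac F.radius_pos F.magnetic_integrable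
    refine (((i1.add i2).add i3).add i4).congr_fun (fun z _ => ?_) hDm
    simp only [Pi.add_apply]
    ring
  have hE := htime.isPrimitiveOn_integral hac F.radius_pos hcont hint F.radius_deriv
    (cu.comp_path hac fun t ht => ⟨(F.radius_pos t ht).le, le_rfl⟩)
    fun t ht => ⟨(F.radius_pos t ht).le, le_rfl⟩
  refine ⟨fun t => -(energyDensity γ ρ u P B t (a t) * u t (a t) + ∫ r in (0 : ℝ)..a t,
    r * (1 / 2 * (ρt (t, r) * (u t r * u t r) + ρ t r * (ut (t, r) * u t r + u t r * ut (t, r)))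
      + ((γ - 1)⁻¹ * Pt (t, r) + 1 / 2 * (Bt (t, r) * B t r + B t r * Bt (t, r))))),
    by simpa only [neg_neg] using hE, ?_⟩
  filter_upwards [(integrableOn_radialSpaceTime_slice hao hint).1] with t hi htT δ δ' S
  have htI := Ioo_subset_Icc_self htT
  have := S.integral_energy hγ (F.radius_pos t htI) (F.cont_density.slice htI) (cu.slice htI)
    (F.cont_pressure.slice htI) (F.cont_magnetic.slice htI) (et := fun r => r * (1 / 2 * (ρt (t, r)
      * (u t r * u t r) + ρ t r * (ut (t, r) * u t r + u t r * ut (t, r))) + ((γ - 1)⁻¹ * Pt (t, r)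
        + 1 / 2 * (Bt (t, r) * B t r + B t r * Bt (t, r))))) (fun r => rfl) (hi htT)
  simp only [energyDensity]
  linear_combination -this

end Flow

/-! ### The lower bound for the dissipation -/

lemma sq_integral_mul_le {X : Type} [MeasurableSpace X] {μ : Measure X} {f g : X → ℝ}
    (hf : Integrable (fun x => f x ^ 2) μ) (hg : Integrable (fun x => g x ^ 2) μ)
    (hfg : Integrable (fun x => f x * g x) μ) :
    (∫ x, f x * g x ∂μ) ^ 2 ≤ (∫ x, f x ^ 2 ∂μ) * ∫ x, g x ^ 2 ∂μ := by
  have h := discrim_le_zero (a := ∫ x, g x ^ 2 ∂μ) (b := 2 * ∫ x, f x * g x ∂μ)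
    (c := ∫ x, f x ^ 2 ∂μ) fun s => by
      have h1 : 0 ≤ ∫ x, (f x + s * g x) ^ 2 ∂μ := integral_nonneg fun x => sq_nonneg _
      have h2 : ∫ x, (f x + s * g x) ^ 2 ∂μ
          = ∫ x, ((s * s) * g x ^ 2 + (2 * s) * (f x * g x) + f x ^ 2) ∂μ :=
        integral_congr_ae (Eventually.of_forall fun x => by ring)
      have h3 : Integrable (fun x => (s * s) * g x ^ 2 + (2 * s) * (f x * g x)) μ :=
        (hg.const_mul _).add (hfg.const_mul _)
      rw [h2, integral_add h3 hf,
        integral_add (hg.const_mul _) (hfg.const_mul _), integral_const_mul,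
        integral_const_mul] at h1
      linarith
  unfold discrim at h
  nlinarith

lemma integral_rpow_Ioo {s R : ℝ} (hs : 0 < s) (hR : 0 ≤ R) :
    IntegrableOn (fun r : ℝ => r ^ (s - 1)) (Ioo 0 R) ∧
      ∫ r in Ioo 0 R, r ^ (s - 1) = R ^ s / s := by
  constructor
  · rw [← intervalIntegrable_iff_integrableOn_Ioo_of_le hR]
    exact intervalIntegral.intervalIntegrable_rpow' (by linarith)
  · rw [← integral_Ioc_eq_integral_Ioo, ← intervalIntegral.integral_of_le hR,
      integral_rpow (Or.inl (by linarith)), sub_add_cancel, Real.zero_rpow hs.ne', sub_zero]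

/-- The Cauchy-Schwarz inequality for r^(β - 1/2) and r^(1/2) h. The first factor has square
integral R^(2β)/(2β), finite since β > 0. -/
lemma sq_integral_rpow_mul_le {β R : ℝ} (hβ : 0 < β) (hR : 0 ≤ R) {h : ℝ → ℝ}
    (hi : IntegrableOn (fun r => r * h r ^ 2) (Ioo 0 R))
    (hi' : IntegrableOn (fun r => r ^ β * h r) (Ioo 0 R)) :
    (∫ r in Ioo 0 R, r ^ β * h r) ^ 2 ≤ R ^ (2 * β) / (2 * β) * ∫ r in Ioo 0 R, r * h r ^ 2 := by
  obtain ⟨j1, j2⟩ := integral_rpow_Ioo (s := 2 * β) (by linarith) hR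
  have e1 : ∀ r ∈ Ioo 0 R, r ^ (2 * β - 1) = (r ^ (β - 1 / 2)) ^ 2 := fun r hr => by
    rw [← Real.rpow_natCast, ← Real.rpow_mul hr.1.le]
    congr 1
    push_cast
    ring
  have e2 : ∀ r ∈ Ioo 0 R, r * h r ^ 2 = (r ^ (1 / 2 : ℝ) * h r) ^ 2 := fun r hr => by
    rw [mul_pow, ← Real.rpow_natCast (r ^ (1 / 2 : ℝ)), ← Real.rpow_mul hr.1.le]
    norm_num
  have e3 : ∀ r ∈ Ioo 0 R, r ^ β * h r = r ^ (β - 1 / 2) * (r ^ (1 / 2 : ℝ) * h r) := fun r hr => by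
    rw [← mul_assoc, ← Real.rpow_add hr.1, sub_add_cancel]
  rw [← j2, setIntegral_congr_fun measurableSet_Ioo e1, setIntegral_congr_fun measurableSet_Ioo e2,
    setIntegral_congr_fun measurableSet_Ioo e3]
  exact sq_integral_mul_le (j1.congr_fun e1 measurableSet_Ioo) (hi.congr_fun e2 measurableSet_Ioo)
    (hi'.congr_fun e3 measurableSet_Ioo)

lemma integral_rpow_mul_le {β R : ℝ} (hβ : 0 < β) (hR : 0 ≤ R) {h : ℝ → ℝ}
    (hi : IntegrableOn (fun r => r * h r ^ 2) (Ioo 0 R))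
    (hi' : IntegrableOn (fun r => r ^ β * h r) (Ioo 0 R)) :
    ∫ r in Ioo 0 R, r ^ β * h r ≤ R ^ β / √(2 * β) * √(∫ r in Ioo 0 R, r * h r ^ 2) := by
  have h1 := Real.le_sqrt_of_sq_le (sq_integral_rpow_mul_le hβ hR hi hi')
  refine h1.trans_eq ?_
  rw [Real.sqrt_mul (by positivity), Real.sqrt_div (by positivity), mul_comm 2 β,
    Real.rpow_mul hR, Real.rpow_two, Real.sqrt_sq (by positivity)]

/-- The magnetic flux through a vacuum disk is controlled by the dissipation. -/
theorem RadialSlice.sq_flux_le {κ γ A R α : ℝ} {ρ u P B ρt ut Pt Bt δ δ' : ℝ → ℝ}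
    (S : RadialSlice κ γ A ρ u P B ρt ut Pt Bt δ δ') (hκ : 0 < κ)
    (hB : ContinuousOn B (Icc 0 A)) (hR0 : 0 < R) (hRA : R ≤ A)
    (hvac : ∀ r ∈ Ioo 0 R, ρ r = 0 ∧ P r = 0) (hα : α ∈ Ioo (1 : ℝ) 2) :
    (∫ r in (0 : ℝ)..R, B r) ^ 2 * (2 - α) ^ 2 / 2
      ≤ κ * √(∫ r in (0 : ℝ)..A, r * δ r ^ 2) * R
        * (α / √(2 * α - 2) + (α + 1) / √(2 * α)) := by
  obtain ⟨hα1, hα2⟩ := hα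
  obtain ⟨Pr, Br, hPr, hBr, he⟩ := S.momentum_pressure
  have hsub : Ioo 0 R ⊆ Ioo 0 A := Ioo_subset_Ioo_right hRA
  have hsubI : Icc 0 R ⊆ Icc 0 A := Icc_subset_Icc_right hRA
  have hBc := hB.mono hsubI
  have hδc := S.div_cont.mono hsubI
  have hδp := S.div_primitive.mono (Ioo_subset_Icc_self.trans hsubI)
  have hBp := hBr.mono hsub
  have hpc : ContinuousOn (fun r : ℝ => r ^ (α - 1)) (Icc 0 R) :=
    (Real.continuous_rpow_const (by linarith)).continuousOn
  -- the effective flux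
  have hF : IsPrimitiveOn (fun r => κ * δ r + -1 / 2 * (B r * B r)) (fun r => B r ^ 2 / r)
      (Ioo 0 R) := by
    refine ((hδp.const_mul κ).add ((hBp.mul hBp).const_mul (-1 / 2))).congr_ae ?_
    filter_upwards [he, (hPr.mono hsub).ae_hasDerivAt_of_mem_Ioo] with r h1 h2 hr
    have h3 : Pr r = 0 := by
      refine (h2 hr).unique ((hasDerivAt_const r (0 : ℝ)).congr_of_eventuallyEq ?_)
      filter_upwards [Ioo_mem_nhds hr.1 hr.2] with s hs using (hvac s hs).2
    have h4 := (h1 (hsub hr)).1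
    rw [h3, (hvac r hr).1] at h4
    linear_combination -h4
  -- The multiplier vanishes at 0 and at R, so no boundary value of the effective flux is needed at
  -- the vacuum interface.
  have hφ : IsPrimitiveOn (fun r => r ^ α * (R - r))
      (fun r => r ^ (α - 1) * (α * R - (α + 1) * r)) (Ioo 0 R) := by
    refine IsPrimitiveOn.of_hasDerivAt (fun r hr => ?_)
      ((hpc.mono Ioo_subset_Icc_self).mul (by fun_prop))
    have h1 := (Real.hasDerivAt_rpow_const (p := α) (Or.inl hr.1.ne')).mul
      ((hasDerivAt_id r).const_sub R)
    refine h1.congr_deriv ?_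
    have h2 : r ^ α = r ^ (α - 1) * r := by
      rw [Real.rpow_sub_one hr.1.ne', div_mul_cancel₀ _ hr.1.ne']
    simp only [id]
    rw [h2]
    ring
  set g₁ : ℝ → ℝ := fun r => r ^ (α - 1) * (α * R - (α + 1) * r) * δ r with hg₁
  set g₂ : ℝ → ℝ := fun r => r ^ (α - 1) * B r ^ 2 with hg₂
  have hg₁c : ContinuousOn g₁ (Icc 0 R) := (hpc.mul (by fun_prop)).mul hδc
  have hg₂c : ContinuousOn g₂ (Icc 0 R) := hpc.mul (hBc.pow 2)
  have hg₃c : ContinuousOn (fun r => g₂ r * ((α - 1) / 2 * r)) (Icc 0 R) :=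
    hg₂c.mul (by fun_prop)
  have hio : ∀ {k : ℝ → ℝ}, ContinuousOn k (Icc 0 R) → IntegrableOn k (Ioo 0 R) := fun hk =>
    hk.integrableOn_Icc.mono_set Ioo_subset_Icc_self
  -- The terms in B² combine to r^(α-1) B² [R(2-α)/2 + (α-1) r/2]. Both coefficients are nonnegative
  -- exactly for 1 ≤ α ≤ 2, so the second can be dropped.
  have h1 : IsPrimitiveOn (fun r => r ^ α * (R - r) * (κ * δ r + -1 / 2 * (B r * B r)))
      (fun r => κ * g₁ r + (R * (2 - α) / 2 * g₂ r + g₂ r * ((α - 1) / 2 * r))) (Ioo 0 R) := by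
    refine (hφ.mul hF).congr_ae (Eventually.of_forall fun r hr => ?_)
    have h2 : r ^ α = r ^ (α - 1) * r := by
      rw [Real.rpow_sub_one hr.1.ne', div_mul_cancel₀ _ hr.1.ne']
    have := hr.1.ne'
    simp only [hg₁, hg₂]
    rw [h2]
    field_simp
    ring
  have h2 := (h1.Icc_of_Ioo hR0 (((Real.continuous_rpow_const (by linarith)).continuousOn.mul
    (by fun_prop)).mul ((continuousOn_const.mul hδc).add (continuousOn_const.mul (hBc.mul hBc))))
    (((hio hg₁c).const_mul κ).add (((hio hg₂c).const_mul _).add (hio hg₃c))) 0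
    (left_mem_Icc.2 hR0.le) R (right_mem_Icc.2 hR0.le)).2
  have hg₄ : IntegrableOn (fun r => R * (2 - α) / 2 * g₂ r + g₂ r * ((α - 1) / 2 * r)) (Ioo 0 R) :=
    ((hio hg₂c).const_mul _).add (hio hg₃c)
  rw [Real.zero_rpow (by linarith), sub_self, mul_zero, zero_mul, zero_mul, zero_mul, sub_zero,
    intervalIntegral.integral_of_le hR0.le, integral_Ioc_eq_integral_Ioo,
    integral_add ((hio hg₁c).const_mul κ) hg₄,
    integral_add ((hio hg₂c).const_mul _) (hio hg₃c), integral_const_mul, integral_const_mul] at h2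
  have h3 : 0 ≤ ∫ r in Ioo 0 R, g₂ r * ((α - 1) / 2 * r) :=
    setIntegral_nonneg measurableSet_Ioo fun r hr => mul_nonneg
      (mul_nonneg (Real.rpow_nonneg hr.1.le _) (sq_nonneg _))
      (mul_nonneg (by linarith) hr.1.le)
  -- estimate of the right-hand side
  set N := ∫ r in Ioo 0 R, r * |δ r| ^ 2 with hN
  have hδa : ContinuousOn (fun r => |δ r|) (Icc 0 R) := hδc.abs
  have hNi : IntegrableOn (fun r => r * |δ r| ^ 2) (Ioo 0 R) :=
    hio (continuousOn_id.mul (hδa.pow 2))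
  have hJc : ∀ β : ℝ, 0 < β → ContinuousOn (fun r => r ^ β * |δ r|) (Icc 0 R) := fun β hβ =>
    (Real.continuous_rpow_const hβ.le).continuousOn.mul hδa
  have hJ1 := integral_rpow_mul_le (show 0 < α - 1 by linarith) hR0.le hNi
    (hio (hJc (α - 1) (by linarith)))
  have hJ2 := integral_rpow_mul_le (show 0 < α by linarith) hR0.le hNi (hio (hJc α (by linarith)))
  rw [← hN] at hJ1 hJ2
  -- Estimating the coefficient αR - (α+1)r by the sum αR + (α+1)r produces the two summands of the
  -- bracket. The exponents α - 1 and α must be positive, hence α > 1.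
  have h4 : -(∫ r in Ioo 0 R, g₁ r) ≤ α * R * (∫ r in Ioo 0 R, r ^ (α - 1) * |δ r|)
      + (α + 1) * ∫ r in Ioo 0 R, r ^ α * |δ r| := by
    rw [← integral_neg, ← integral_const_mul, ← integral_const_mul,
      ← integral_add ((hio (hJc (α - 1) (by linarith))).const_mul _)
        ((hio (hJc α (by linarith))).const_mul _)]
    refine setIntegral_mono_on (hio hg₁c).neg (((hio (hJc (α - 1) (by linarith))).const_mul _).add
        ((hio (hJc α (by linarith))).const_mul _)) measurableSet_Ioo fun r hr => ?_
    have h2 : r ^ α = r ^ (α - 1) * r := by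
      rw [Real.rpow_sub_one hr.1.ne', div_mul_cancel₀ _ hr.1.ne']
    have hp : 0 ≤ r ^ (α - 1) := Real.rpow_nonneg hr.1.le _
    simp only [hg₁]
    rw [h2]
    have k1 : -(α * R * δ r) ≤ α * R * |δ r| := by
      have := neg_abs_le (δ r)
      nlinarith [mul_pos (show 0 < α by linarith) hR0]
    have k2 : (α + 1) * r * δ r ≤ (α + 1) * r * |δ r| :=
      mul_le_mul_of_nonneg_left (le_abs_self _) (mul_nonneg (by linarith) hr.1.le)
    nlinarith [mul_le_mul_of_nonneg_left (add_le_add k1 k2) hp]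
  have hRα : R ^ α = R ^ (α - 1) * R := by
    rw [Real.rpow_sub_one hR0.ne', div_mul_cancel₀ _ hR0.ne']
  set I := ∫ r in Ioo 0 R, g₂ r with hI
  have h5 : R * (2 - α) / 2 * I ≤ κ * √N * R ^ α
      * (α / √(2 * α - 2) + (α + 1) / √(2 * α)) := by
    have k0 : R * (2 - α) / 2 * I ≤ κ * -(∫ r in Ioo 0 R, g₁ r) := by linarith
    refine k0.trans ?_
    have k1 := mul_le_mul_of_nonneg_left (h4.trans (add_le_add
      (mul_le_mul_of_nonneg_left hJ1 (show 0 ≤ α * R by nlinarith))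
      (mul_le_mul_of_nonneg_left hJ2 (show 0 ≤ α + 1 by linarith)))) hκ.le
    refine k1.trans_eq ?_
    rw [hRα, show 2 * (α - 1) = 2 * α - 2 by ring]
    ring
  -- estimate of the flux
  have h6 : (∫ r in (0 : ℝ)..R, B r) ^ 2 ≤ R ^ (2 - α) / (2 - α) * I := by
    have hpw : ∀ r ∈ Ioo 0 R, r ^ ((2 - α) / 2) * (r ^ ((α - 2) / 2) * B r) = B r := fun r hr => by
      rw [← mul_assoc, ← Real.rpow_add hr.1, show (2 - α) / 2 + (α - 2) / 2 = 0 by ring,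
        Real.rpow_zero, one_mul]
    have hpw2 : ∀ r ∈ Ioo 0 R, r * (r ^ ((α - 2) / 2) * B r) ^ 2 = g₂ r := fun r hr => by
      simp only [hg₂]
      rw [mul_pow, ← Real.rpow_natCast (r ^ ((α - 2) / 2)), ← Real.rpow_mul hr.1.le, ← mul_assoc,
        show α - 1 = 1 + (α - 2) / 2 * (2 : ℕ) by push_cast; ring, Real.rpow_add hr.1, Real.rpow_one]
    have k := sq_integral_rpow_mul_le (β := (2 - α) / 2) (h := fun r => r ^ ((α - 2) / 2) * B r)
      (by linarith) hR0.le ((hio hg₂c).congr_fun (fun r hr => (hpw2 r hr).symm) measurableSet_Ioo)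
      ((hio hBc).congr_fun (fun r hr => (hpw r hr).symm) measurableSet_Ioo)
    rw [setIntegral_congr_fun measurableSet_Ioo hpw, setIntegral_congr_fun measurableSet_Ioo hpw2,
      show 2 * ((2 - α) / 2) = 2 - α by ring] at k
    rwa [intervalIntegral.integral_of_le hR0.le, integral_Ioc_eq_integral_Ioo]
  have hNle : √N ≤ √(∫ r in (0 : ℝ)..A, r * δ r ^ 2) := by
    refine Real.sqrt_le_sqrt ?_
    rw [intervalIntegral.integral_of_le (hR0.le.trans hRA), integral_Ioc_eq_integral_Ioo, hN]
    simp only [sq_abs]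
    refine setIntegral_mono_set ((continuousOn_id.mul (S.div_cont.pow 2)).integrableOn_Icc.mono_set
      Ioo_subset_Icc_self) ((ae_restrict_iff' measurableSet_Ioo).2 (Eventually.of_forall
        fun r hr => mul_nonneg hr.1.le (sq_nonneg _))) hsub.eventuallyLE
  set K := α / √(2 * α - 2) + (α + 1) / √(2 * α) with hK
  have hK0 : 0 ≤ K := add_nonneg (div_nonneg (by linarith) (Real.sqrt_nonneg _))
    (div_nonneg (by linarith) (Real.sqrt_nonneg _))
  have hRR : R ^ (2 - α) * R ^ α = R * R := by
    rw [← Real.rpow_add hR0, sub_add_cancel, Real.rpow_two, sq]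
  have h2α : 0 < 2 - α := by linarith
  have hRp : 0 < R ^ (2 - α) := Real.rpow_pos_of_pos hR0 _
  -- The power R^(2-α) from the flux estimate meets R^α from the dissipation estimate; their product
  -- R² leaves a single factor R after division, independently of α.
  have h7 : R * ((∫ r in (0 : ℝ)..R, B r) ^ 2 * (2 - α) ^ 2 / 2) ≤ R * (κ * √N * R * K) := by
    calc R * ((∫ r in (0 : ℝ)..R, B r) ^ 2 * (2 - α) ^ 2 / 2)
        ≤ R * ((R ^ (2 - α) / (2 - α) * I) * (2 - α) ^ 2 / 2) := by gcongr
      _ = R ^ (2 - α) * (R * (2 - α) / 2 * I) := by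
        field_simp
      _ ≤ R ^ (2 - α) * (κ * √N * R ^ α * K) := mul_le_mul_of_nonneg_left h5 hRp.le
      _ = (R ^ (2 - α) * R ^ α) * (κ * √N * K) := by ring
      _ = _ := by
        rw [hRR]
        ring
  refine (le_of_mul_le_mul_left h7 hR0).trans ?_
  gcongr

/-- The growth of the radius is controlled by the dissipation. -/
lemma RadialSlice.velocity_boundary_le {κ γ A : ℝ} {ρ u P B ρt ut Pt Bt δ δ' : ℝ → ℝ}
    (S : RadialSlice κ γ A ρ u P B ρt ut Pt Bt δ δ') (hA : 0 < A) (hu : ContinuousOn u (Icc 0 A))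
    {c : ℝ} (hc : 0 < c) : u A ≤ c / 2 + (∫ r in (0 : ℝ)..A, r * δ r ^ 2) / (4 * c) := by
  have hc2 : ContinuousOn (fun r => r * δ r ^ 2) (Icc 0 A) := continuousOn_id.mul (S.div_cont.pow 2)
  have hc1 : ContinuousOn (fun r => r * δ r) (Icc 0 A) := continuousOn_id.mul S.div_cont
  have h1 := (S.radius_mul_velocity_primitive.Icc_of_Ioo hA (continuousOn_id.mul hu)
    (hc1.integrableOn_Icc.mono_set Ioo_subset_Icc_self) 0 (left_mem_Icc.2 hA.le) A
    (right_mem_Icc.2 hA.le)).2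
  have hi2 := hc2.intervalIntegrable_of_Icc (μ := volume) hA.le
  have hi0 : IntervalIntegrable (fun r : ℝ => c / A * r) volume 0 A :=
    (by fun_prop : Continuous fun r : ℝ => c / A * r).intervalIntegrable _ _
  have h2 : ∫ r in (0 : ℝ)..A, r * δ r
      ≤ ∫ r in (0 : ℝ)..A, (c / A * r + A / (4 * c) * (r * δ r ^ 2)) := by
    refine intervalIntegral.integral_mono_on hA.le (hc1.intervalIntegrable_of_Icc hA.le)
      (hi0.add (hi2.const_mul _)) fun r hr => ?_
    -- Young's inequality as a completed square. The term c/A · r integrates to A c/2, so dividing A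
    -- u(A) = ∫ rδ by A leaves c/2.
    have h3 : 0 ≤ r * (A / (4 * c)) * (δ r - 2 * c / A) ^ 2 :=
      mul_nonneg (mul_nonneg hr.1 (by positivity)) (sq_nonneg _)
    have h4 : r * (A / (4 * c)) * (δ r - 2 * c / A) ^ 2
        = c / A * r + A / (4 * c) * (r * δ r ^ 2) - r * δ r := by
      field_simp
      ring
    linarith
  rw [intervalIntegral.integral_add hi0 (hi2.const_mul _), intervalIntegral.integral_const_mul,
    intervalIntegral.integral_const_mul, integral_id, h1] at h2
  have h5 : A * u A ≤ A * (c / 2 + (∫ r in (0 : ℝ)..A, r * δ r ^ 2) / (4 * c)) := by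
    refine (by linarith : A * u A ≤ _).trans_eq (?_ : c / A * ((A ^ 2 - 0 ^ 2) / 2)
      + A / (4 * c) * ∫ r in (0 : ℝ)..A, r * δ r ^ 2 = _)
    field_simp
    ring
  exact le_of_mul_le_mul_left h5 hA

/-! ### The lifespan -/

section Flow

variable {κ γ T : ℝ} {a : ℝ → ℝ} {ρ u P B : ℝ → ℝ → ℝ} {ρt ut Pt Bt d d' : ℝ × ℝ → ℝ}

/-- Density and pressure remain nonnegative. -/
lemma RadialFlow.nonneg (hT : 0 < T) (F : RadialFlow κ γ T a ρ u P B ρt ut Pt Bt d d')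
    (h0 : ∀ r ∈ Icc 0 (a 0), 0 ≤ ρ 0 r ∧ 0 ≤ P 0 r) :
    ∀ t ∈ Icc 0 T, ∀ r ∈ Ioo 0 (a t), 0 ≤ ρ t r ∧ 0 ≤ P t r := by
  obtain ⟨m, hm, hS⟩ := F.exists_div_bound hT
  have ham : ∀ t ∈ Icc 0 T, a t ∈ Icc 0 (a t) := fun t ht => ⟨(F.radius_pos t ht).le, le_rfl⟩
  have h1 := F.nonneg_of_transported hT F.cont_density F.density_time F.density_integrable hm (by
    filter_upwards [hS] with t ht htT
    obtain ⟨δ, δ', S, hδ⟩ := ht htT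
    exact ⟨δ, S.transport_density, hδ⟩) F.radius_deriv ham fun r hr => (h0 r hr).1
  have h2 := F.nonneg_of_transported hT F.cont_pressure F.pressure_time F.pressure_integrable hm (by
    filter_upwards [hS] with t ht htT
    obtain ⟨δ, δ', S, hδ⟩ := ht htT
    exact ⟨δ, S.transport_pressure, hδ⟩) F.radius_deriv ham fun r hr => (h0 r hr).2
  exact fun t ht r hr => ⟨h1 t ht r hr, h2 t ht r hr⟩

/-- A vacuum disk is transported by the flow. -/
lemma RadialFlow.vacuum (hT : 0 < T) (F : RadialFlow κ γ T a ρ u P B ρt ut Pt Bt d d')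
    {R : ℝ → ℝ} (hR : ∀ t ∈ Icc 0 T, HasDerivWithinAt R (u t (R t)) (Icc 0 T) t)
    (hRa : ∀ t ∈ Icc 0 T, R t ∈ Icc 0 (a t)) (h0 : ∀ r ∈ Icc 0 (R 0), ρ 0 r = 0 ∧ P 0 r = 0) :
    ∀ t ∈ Icc 0 T, ∀ r ∈ Ioo 0 (R t), ρ t r = 0 ∧ P t r = 0 := by
  obtain ⟨m, hm, hS⟩ := F.exists_div_bound hT
  have h1 := F.nonneg_of_transported hT F.cont_density F.density_time F.density_integrable hm (by
    filter_upwards [hS] with t ht htT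
    obtain ⟨δ, δ', S, hδ⟩ := ht htT
    exact ⟨δ, S.transport_density, hδ⟩) hR hRa fun r hr => (h0 r hr).1.ge
  -- The transport equation is linear, so -ρ also stays nonnegative if it is so initially; together
  -- the two signs give ρ = 0. The same is done for P.
  have h1' := F.nonneg_of_transported hT (F.cont_density.comp (continuous_const_mul (-1)))
    (F.density_time.const_mul (-1)) (F.density_integrable.const_mul (-1)) hm (by
    filter_upwards [hS] with t ht htT
    obtain ⟨δ, δ', S, hδ⟩ := ht htT
    exact ⟨δ, S.transport_density.neg, hδ⟩) hR hRa fun r hr => by simp [(h0 r hr).1]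
  have h2 := F.nonneg_of_transported hT F.cont_pressure F.pressure_time F.pressure_integrable hm (by
    filter_upwards [hS] with t ht htT
    obtain ⟨δ, δ', S, hδ⟩ := ht htT
    exact ⟨δ, S.transport_pressure, hδ⟩) hR hRa fun r hr => (h0 r hr).2.ge
  have h2' := F.nonneg_of_transported hT (F.cont_pressure.comp (continuous_const_mul (-1)))
    (F.pressure_time.const_mul (-1)) (F.pressure_integrable.const_mul (-1)) hm (by
    filter_upwards [hS] with t ht htT
    obtain ⟨δ, δ', S, hδ⟩ := ht htT
    exact ⟨δ, S.transport_pressure.neg, hδ⟩) hR hRa fun r hr => by simp [(h0 r hr).2]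
  intro t ht r hr
  exact ⟨le_antisymm (by linarith [h1' t ht r hr]) (h1 t ht r hr),
    le_antisymm (by linarith [h2' t ht r hr]) (h2 t ht r hr)⟩

/-- The lifespan of a flow with an initial vacuum disk of radius `r₀`. -/
theorem RadialFlow.sq_mul_log_le (hT : 0 < T) (F : RadialFlow κ γ T a ρ u P B ρt ut Pt Bt d d')
    (hκ : 0 < κ) (hγ : 1 < γ) (h0 : ∀ r ∈ Icc 0 (a 0), 0 ≤ ρ 0 r ∧ 0 ≤ P 0 r) {r₀ : ℝ}
    (hr₀ : r₀ ∈ Icc 0 (a 0)) (hvac : ∀ r ∈ Icc 0 r₀, ρ 0 r = 0 ∧ P 0 r = 0)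
    (hb : ∫ r in (0 : ℝ)..r₀, B 0 r ≠ 0) {E₀ C α : ℝ}
    (hE : ∫ r in (0 : ℝ)..a 0, energyDensity γ ρ u P B 0 r = E₀)
    (hC : |a 0| + 1 + |E₀ / κ| ≤ C) (hα : α ∈ Ioo (1 : ℝ) 2) :
    ((∫ r in (0 : ℝ)..r₀, B 0 r) ^ 2 * (2 - α) ^ 2
      / (2 * √κ * C * (α / √(2 * α - 2) + (α + 1) / √(2 * α)))) ^ 2 * Real.log (1 + T) ≤ E₀ := by
  obtain ⟨hα1, hα2⟩ := id hα
  have hac := F.continuousOn_radius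
  have h0T : (0 : ℝ) ∈ Icc 0 T := left_mem_Icc.2 hT.le
  obtain ⟨R, hR0, hR, hRa⟩ := exists_particle_path hT.le F.radius_pos F.radius_deriv F.cont_velocity
    (fun t ht => (F.center t ht).1) hr₀
  have hpos := F.nonneg hT h0
  have hv := F.vacuum hT hR hRa (by rwa [hR0])
  obtain ⟨D, hD, hDS⟩ := F.exists_dissipation hγ.ne'
  have hflux : ∀ t ∈ Icc 0 T, ∫ r in (0 : ℝ)..R t, B t r = ∫ r in (0 : ℝ)..r₀, B 0 r :=
    fun t ht => by rw [F.integral_magnetic_eq hR hRa ht, hR0]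
  -- The disk cannot collapse to the center, since it carries the nonzero conserved flux.
  have hRpos : ∀ t ∈ Icc 0 T, 0 < R t := by
    intro t ht
    refine lt_of_le_of_ne (hRa t ht).1 fun h => hb ?_
    rw [← hflux t ht, ← h, intervalIntegral.integral_same]
  have hEpos : ∀ t ∈ Icc 0 T, 0 ≤ ∫ r in (0 : ℝ)..a t, energyDensity γ ρ u P B t r := by
    intro t ht
    rw [intervalIntegral.integral_of_le (F.radius_pos t ht).le, integral_Ioc_eq_integral_Ioo]
    refine setIntegral_nonneg measurableSet_Ioo fun r hr => ?_
    obtain ⟨h1, h2⟩ := hpos t ht r hr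
    have h3 : 0 < γ - 1 := by linarith
    exact mul_nonneg hr.1.le (add_nonneg (mul_nonneg (by norm_num)
      (mul_nonneg h1 (mul_self_nonneg _))) (add_nonneg (mul_nonneg (inv_nonneg.2 h3.le) h2)
        (mul_nonneg (by norm_num) (mul_self_nonneg _))))
  -- The dissipation is at most the energy lost, and the remaining energy is nonnegative; the signs
  -- of ρ and P enter here.
  have hDint : ∀ t ∈ Icc 0 T, IntervalIntegrable D volume 0 t ∧ ∫ s in (0 : ℝ)..t, D s ≤ E₀ := by
    intro t ht
    obtain ⟨h1, h2⟩ := hD 0 h0T t ht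
    have h1' : IntervalIntegrable D volume 0 t := by
      simpa only [Pi.neg_def, neg_neg] using h1.neg
    refine ⟨h1', ?_⟩
    simp only [intervalIntegral.integral_neg, hE] at h2
    linarith [hEpos t ht]
  have hE0 : 0 ≤ E₀ := hE ▸ hEpos 0 h0T
  have hS : ∀ᵐ t, t ∈ Ioo 0 T → ∃ δ δ', RadialSlice κ γ (a t) (ρ t) (u t) (P t) (B t)
      (fun r => ρt (t, r)) (fun r => ut (t, r)) (fun r => Pt (t, r)) (fun r => Bt (t, r)) δ δ' ∧
      D t = κ * ∫ r in (0 : ℝ)..a t, r * δ r ^ 2 := by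
    filter_upwards [F.slice, hDS] with t h1 h2 ht
    obtain ⟨δ, S, -⟩ := h1 ht
    exact ⟨δ, _, S, h2 ht _ _ S⟩
  -- growth of the radius
  have hgrow : ∀ t ∈ Icc 0 T, a t ≤ C * √(1 + t) := by
    intro t ht
    have ht1 : 0 < 1 + t := by linarith [ht.1]
    -- The Young parameter is constant in s but depends on the final time t. It balances the terms t
    -- c/2 and E₀/(4κc), both then of order √(1 + t).
    set c : ℝ := 1 / √(1 + t) with hc
    have hs : 0 < √(1 + t) := Real.sqrt_pos.2 ht1
    have hc0 : 0 < c := by positivity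
    have hsub : Icc 0 t ⊆ Icc 0 T := Icc_subset_Icc_right ht.2
    have hpath := F.cont_velocity.comp_path hac
      fun t ht => ⟨(F.radius_pos t ht).le, le_rfl⟩
    have h1 : ∫ s in (0 : ℝ)..t, u s (a s) = a t - a 0 :=
      intervalIntegral.integral_eq_sub_of_hasDerivAt_of_le ht.1 (hac.mono hsub)
        (fun s hs => (F.radius_deriv s (hsub (Ioo_subset_Icc_self hs))).hasDerivAt
          (Icc_mem_nhds hs.1 (hs.2.trans_le ht.2)))
        ((hpath.mono hsub).intervalIntegrable_of_Icc ht.1)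
    have h2 : ∫ s in (0 : ℝ)..t, u s (a s) ≤ ∫ s in (0 : ℝ)..t, (c / 2 + (4 * κ * c)⁻¹ * D s) := by
      refine intervalIntegral.integral_mono_ae_restrict ht.1
        ((hpath.mono hsub).intervalIntegrable_of_Icc ht.1)
        (intervalIntegrable_const.add ((hDint t ht).1.const_mul _)) ?_
      have hne : ∀ᵐ s : ℝ, s ≠ T := by simp [ae_iff]
      have hne0 : ∀ᵐ s : ℝ, s ≠ 0 := by simp [ae_iff]
      rw [EventuallyLE, ae_restrict_iff' measurableSet_Icc]
      filter_upwards [hS, hne, hne0] with s hs h3 h4 hst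
      have hsI := hsub hst
      obtain ⟨δ, δ', S, hδ⟩ := hs ⟨lt_of_le_of_ne hsI.1 h4.symm, lt_of_le_of_ne hsI.2 h3⟩
      refine (S.velocity_boundary_le (F.radius_pos s hsI) (F.cont_velocity.slice hsI) hc0).trans_eq ?_
      rw [hδ]
      field_simp
    rw [h1, intervalIntegral.integral_add intervalIntegrable_const ((hDint t ht).1.const_mul _),
      intervalIntegral.integral_const, intervalIntegral.integral_const_mul, smul_eq_mul,
      sub_zero] at h2
    have h3 : (4 * κ * c)⁻¹ * ∫ s in (0 : ℝ)..t, D s ≤ (4 * κ * c)⁻¹ * E₀ :=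
      mul_le_mul_of_nonneg_left (hDint t ht).2 (by positivity)
    have h4 : t * (c / 2) ≤ √(1 + t) := by
      have h5 : (1 + t) * c = √(1 + t) := by
        rw [hc, mul_one_div, Real.div_sqrt]
      nlinarith
    have h5 : (4 * κ * c)⁻¹ * E₀ = (E₀ / κ) / 4 * √(1 + t) := by
      rw [hc]
      field_simp
    have h6 : 0 ≤ E₀ / κ := by positivity
    have h7 : 1 ≤ √(1 + t) := Real.one_le_sqrt.2 (by linarith [ht.1])
    rw [abs_of_nonneg h6] at hC
    have h8 : a 0 ≤ |a 0| * √(1 + t) :=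
      (le_abs_self _).trans (le_mul_of_one_le_right (abs_nonneg _) h7)
    have h9 : (|a 0| + 1 + E₀ / κ) * √(1 + t) ≤ C * √(1 + t) := mul_le_mul_of_nonneg_right hC hs.le
    have h10 : 0 ≤ E₀ / κ * √(1 + t) := by positivity
    nlinarith
  -- lower bound for the dissipation
  set b := ∫ r in (0 : ℝ)..r₀, B 0 r with hbdef
  set K := α / √(2 * α - 2) + (α + 1) / √(2 * α) with hK
  have hK0 : 0 < K := add_pos (div_pos (by linarith) (Real.sqrt_pos.2 (by linarith)))
    (div_pos (by linarith) (Real.sqrt_pos.2 (by linarith)))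
  have hC0 : 0 < C := by
    have := abs_nonneg (a 0)
    have := abs_nonneg (E₀ / κ)
    linarith
  have hκs : 0 < √κ := Real.sqrt_pos.2 hκ
  set X := b ^ 2 * (2 - α) ^ 2 / (2 * √κ * C * K) with hX
  have hX0 : 0 ≤ X := by positivity
  -- With N = ∫ r δ² and R(t) ≤ a(t) ≤ C √(1 + t), the flux estimate reads X ≤ √κ √N √(1 + t). Since
  -- D = κN, squaring gives the claim.
  have hlow : ∀ᵐ t, t ∈ Ioo 0 T → X ^ 2 * (1 + t)⁻¹ ≤ D t := by
    filter_upwards [hS] with t hs ht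
    obtain ⟨δ, δ', S, hδ⟩ := hs ht
    have htI := Ioo_subset_Icc_self ht
    have ht1 : 0 < 1 + t := by linarith [ht.1]
    have h1 := S.sq_flux_le hκ (F.cont_magnetic.slice htI) (hRpos t htI) (hRa t htI).2 (hv t htI) hα
    rw [hflux t htI, ← hK] at h1
    set N := ∫ r in (0 : ℝ)..a t, r * δ r ^ 2 with hN
    have hN0 : 0 ≤ N := intervalIntegral.integral_nonneg (F.radius_pos t htI).le fun r hr =>
      mul_nonneg hr.1 (sq_nonneg _)
    have h2 : κ * √N * R t * K ≤ κ * √N * (C * √(1 + t)) * K := by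
      have := (hRa t htI).2.trans (hgrow t htI)
      gcongr
    have h3 : X ≤ √κ * √N * √(1 + t) := by
      rw [hX, div_le_iff₀ (by positivity)]
      have h4 : √κ * √κ = κ := Real.mul_self_sqrt hκ.le
      have h5 : √κ * √N * √(1 + t) * (2 * √κ * C * K)
          = 2 * ((√κ * √κ) * √N * (C * √(1 + t)) * K) := by ring
      rw [h5, h4]
      linarith
    have h4 : X ^ 2 ≤ D t * (1 + t) := by
      calc X ^ 2 ≤ (√κ * √N * √(1 + t)) ^ 2 := pow_le_pow_left₀ hX0 h3 2
        _ = _ := by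
          rw [mul_pow, mul_pow, Real.sq_sqrt hκ.le, Real.sq_sqrt hN0, Real.sq_sqrt ht1.le, hδ]
    rwa [← div_eq_mul_inv, div_le_iff₀ ht1]
  have hTT : T ∈ Icc 0 T := right_mem_Icc.2 hT.le
  have hlog : ∫ t in (0 : ℝ)..T, X ^ 2 * (1 + t)⁻¹ = X ^ 2 * Real.log (1 + T) := by
    rw [intervalIntegral.integral_const_mul]
    congr 1
    rw [intervalIntegral.integral_comp_add_left (fun t => t⁻¹) 1, integral_inv_of_pos (by norm_num)
      (by linarith)]
    simp
  rw [← hlog]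
  refine le_trans ?_ (hDint T hTT).2
  refine intervalIntegral.integral_mono_ae_restrict hT.le ?_ (hDint T hTT).1 ?_
  · refine ContinuousOn.intervalIntegrable_of_Icc hT.le (continuousOn_const.mul
      (ContinuousOn.inv₀ (by fun_prop) fun t ht => ?_))
    have := ht.1
    positivity
  · have hne : ∀ᵐ s : ℝ, s ≠ T := by simp [ae_iff]
    have hne0 : ∀ᵐ s : ℝ, s ≠ 0 := by simp [ae_iff]
    rw [EventuallyLE, ae_restrict_iff' measurableSet_Icc]
    filter_upwards [hlow, hne, hne0] with s hs h3 h4 hst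
    exact hs ⟨lt_of_le_of_ne hst.1 h4.symm, lt_of_le_of_ne hst.2 h3⟩

end Flow

/-- The constant in the bound for the lifespan. -/
noncomputable def lifespanConst (a₀ E₀ μ lam : ℝ) : ℝ := |a₀| + 1 + |E₀ / (2 * μ + lam)|

lemma lifespanConst_pos (a₀ E₀ μ lam : ℝ) : 0 < lifespanConst a₀ E₀ μ lam := by
  unfold lifespanConst
  positivity

/-- The logarithmic inequality X² log(1 + T) ≤ E₀ is solved for T, after expressing flux and energy
at time zero by the initial data. -/
theorem IsStrongSolution.le_lifespanBound {μ lam γ q a₀ r₀ : ℝ} {ρ₀ u₀ P₀ B₀ : ℝ → ℝ} {T : ℝ}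
    {a : ℝ → ℝ} {ρ u P B : ℝ → ℝ → ℝ} (hμ : 0 < μ) (hlam : 0 ≤ μ + lam) (hγ : 1 < γ) (hq : 2 < q)
    (hpos : ∀ r ∈ Icc 0 a₀, 0 ≤ ρ₀ r ∧ 0 ≤ P₀ r) (hr₀ : r₀ ∈ Ioo 0 a₀)
    (hvac : ∀ r ∈ Icc 0 r₀, ρ₀ r = 0 ∧ P₀ r = 0) (hb : ∫ r in (0 : ℝ)..r₀, B₀ r ≠ 0) (hT : 0 < T)
    (h : IsStrongSolution μ lam γ q a₀ ρ₀ u₀ P₀ B₀ T a ρ u P B) {α : ℝ} (hα : α ∈ Ioo (1 : ℝ) 2) :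
    T ≤ lifespanBound μ lam (initialEnergy γ a₀ ρ₀ u₀ P₀ B₀) (∫ r in (0 : ℝ)..r₀, B₀ r)
      (lifespanConst a₀ (initialEnergy γ a₀ ρ₀ u₀ P₀ B₀) μ lam) α := by
  obtain ⟨ρt, ut, Pt, Bt, d, d', F⟩ := h.exists_radialFlow hq
  have hκ : 0 < 2 * μ + lam := by linarith
  have ha0 := h.radius_zero
  have hsub : Icc 0 r₀ ⊆ Icc 0 a₀ := Icc_subset_Icc_right hr₀.2.le
  have hbe : ∫ r in (0 : ℝ)..r₀, B 0 r = ∫ r in (0 : ℝ)..r₀, B₀ r := by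
    refine intervalIntegral.integral_congr fun r hr => ?_
    rw [uIcc_of_le hr₀.1.le] at hr
    exact (h.initial r (hsub hr)).2.2.2
  have hEe : ∫ r in (0 : ℝ)..a 0, energyDensity γ ρ u P B 0 r = initialEnergy γ a₀ ρ₀ u₀ P₀ B₀ := by
    rw [ha0, initialEnergy]
    refine intervalIntegral.integral_congr fun r hr => ?_
    rw [uIcc_of_le (hr₀.1.trans hr₀.2).le] at hr
    obtain ⟨e1, e2, e3, e4⟩ := h.initial r hr
    simp only [energyDensity, e1, e2, e3, e4]
    ring
  have key := F.sq_mul_log_le hT hκ hγ (by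
      rw [ha0]
      intro r hr
      rw [(h.initial r hr).1, (h.initial r hr).2.2.1]
      exact hpos r hr) (r₀ := r₀) (by rw [ha0]; exact Ioo_subset_Icc_self hr₀) (by
      intro r hr
      rw [(h.initial r (hsub hr)).1, (h.initial r (hsub hr)).2.2.1]
      exact hvac r hr) (by rwa [hbe]) hEe
      (C := lifespanConst a₀ (initialEnergy γ a₀ ρ₀ u₀ P₀ B₀) μ lam) (by rw [ha0, lifespanConst]) hα
  rw [hbe] at key
  set E₀ := initialEnergy γ a₀ ρ₀ u₀ P₀ B₀ with hE₀
  set b := ∫ r in (0 : ℝ)..r₀, B₀ r with hbd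
  have hC := lifespanConst_pos a₀ E₀ μ lam
  set X := b ^ 2 * (2 - α) ^ 2 / (2 * √(2 * μ + lam) * lifespanConst a₀ E₀ μ lam
    * (α / √(2 * α - 2) + (α + 1) / √(2 * α))) with hX
  -- Strict positivity, which uses b ≠ 0 and α < 2, allows division by X².
  have hX0 : 0 < X := by
    have h1 : 0 < α / √(2 * α - 2) + (α + 1) / √(2 * α) :=
      add_pos (div_pos (by linarith [hα.1]) (Real.sqrt_pos.2 (by linarith [hα.1])))
        (div_pos (by linarith [hα.1]) (Real.sqrt_pos.2 (by linarith [hα.1])))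
    have h2 : 0 < b ^ 2 := by positivity
    have h3 : 0 < 2 - α := by linarith [hα.2]
    have h4 : 0 < √(2 * μ + lam) := Real.sqrt_pos.2 hκ
    positivity
  have hlog : Real.log (1 + T) ≤ E₀ * X ^ (-2 : ℤ) := by
    rw [zpow_neg, ← div_eq_mul_inv, le_div_iff₀ (zpow_pos hX0 2)]
    have : X ^ (2 : ℤ) = X ^ 2 := by norm_cast
    rw [this, mul_comm]
    exact key
  have hexp := (Real.log_le_iff_le_exp (by linarith)).1 hlog
  unfold lifespanBound
  rw [sq_abs, ← hX]
  linarith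

end RadialMHD

/-! ### The blow-up theorem -/

theorem theorem1p4 :
    ∃ C : ℝ → ℝ → ℝ → ℝ → ℝ, (∀ a₀ E₀ μ lam : ℝ, 0 < C a₀ E₀ μ lam) ∧
      ∀ (μ lam γ q : ℝ), 0 < μ → 0 ≤ μ + lam → 1 < γ → 2 < q →
      ∀ (a₀ r₀ : ℝ) (ρ₀ u₀ P₀ B₀ : ℝ → ℝ),
        (∀ r ∈ Set.Icc 0 a₀, 0 ≤ ρ₀ r ∧ 0 ≤ P₀ r) →
        r₀ ∈ Set.Ioo 0 a₀ →
        (∀ r ∈ Set.Icc 0 r₀, ρ₀ r = 0 ∧ P₀ r = 0) →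
        (∫ r in (0 : ℝ)..r₀, B₀ r) ≠ 0 →
      ∀ (T : EReal) (a : ℝ → ℝ) (ρ u P B : ℝ → ℝ → ℝ), 0 < T →
        (∀ T' : ℝ, 0 < T' → (T' : EReal) < T →
          RadialMHD.IsStrongSolution μ lam γ q a₀ ρ₀ u₀ P₀ B₀ T' a ρ u P B) →
        T < ⊤ ∧ ∀ α ∈ Set.Ioo (1 : ℝ) 2,
          T ≤ ((RadialMHD.lifespanBound μ lam (RadialMHD.initialEnergy γ a₀ ρ₀ u₀ P₀ B₀)
            (∫ r in (0 : ℝ)..r₀, B₀ r)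
            (C a₀ (RadialMHD.initialEnergy γ a₀ ρ₀ u₀ P₀ B₀) μ lam) α : ℝ) : EReal) := by
  refine ⟨RadialMHD.lifespanConst, RadialMHD.lifespanConst_pos, ?_⟩
  intro μ lam γ q hμ hlam hγ hq a₀ r₀ ρ₀ u₀ P₀ B₀ hpos hr₀ hvac hb T a ρ u P B hT hsol
  have key : ∀ α ∈ Set.Ioo (1 : ℝ) 2,
      T ≤ ((RadialMHD.lifespanBound μ lam (RadialMHD.initialEnergy γ a₀ ρ₀ u₀ P₀ B₀)
        (∫ r in (0 : ℝ)..r₀, B₀ r) (RadialMHD.lifespanConst a₀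
          (RadialMHD.initialEnergy γ a₀ ρ₀ u₀ P₀ B₀) μ lam) α : ℝ) : EReal) := by
    intro α hα
    by_contra! hlt
    -- A real time S strictly between max(bound, 0) and T is positive, and the solution is strong on
    -- [0, S], contradicting the bound for S. Infinite T is covered as well.
    obtain ⟨S, hS, hST⟩ := EReal.lt_iff_exists_real_btwn.1 (max_lt hlt hT)
    have h0 : 0 < S := EReal.coe_pos.1 ((le_max_right _ _).trans_lt hS)
    have h1 := EReal.coe_lt_coe_iff.1 ((le_max_left _ _).trans_lt hS)
    exact absurd ((hsol S h0 hST).le_lifespanBound hμ hlam hγ hq hpos hr₀ hvac hb h0 hα) (not_le.2 h1)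
  -- Any α in (1, 2) shows that T is finite.
  exact ⟨(key (3 / 2) ⟨by norm_num, by norm_num⟩).trans_lt (EReal.coe_lt_top _), key⟩
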